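/- **Setting.** A system has $L$ transmitting RAUs and $Z$ receiving RAUs with $M$ antennas each, $K$ downlink users and $J$ uplink users. Given are channels $h_{D,k}\in\mathbb C^{LM}$, $h_{\mathrm{IUI},j,k}\in\mathbb C$, $h_{U,j,z}\in\mathbb C^M$, a serving R-RAU $z(j)$ for each uplink user $j$, noise powers $\sigma_{D,k}^2,\sigma_{U,z}^2>0$, residual interference powers $\delta_{l,z}^2\ge 0$, budgets $\bar P_{D,l},\bar P_{U,j},C_{D,l}$, QoS rates $R_{D,\min,k},R_{U,\min,j}>0$ and $\theta>0$. Let $T_l$ be the diagonal $0/1$ matrix selecting the antennas of T-RAU $l$, and write $t_{l,k}=\mathrm{Tr}(Q_kT_l)$ and $\lambda_\theta(t)=1-e^{-\theta t}$. The variables are Hermitian $Q=(Q_k)_k$, real $P=(P_j)_j$ and receivers $u=(u_j)_j$, $u_j\in\mathbb C^M$ (user $j$ is received only at $z(j)$). Put $$\tilde\gamma_{D,k}=\sum_{k'\ne k}h_{D,k}^HQ_{k'}h_{D,k}+\sum_jP_j|h_{\mathrm{IUI},j,k}|^2+\sigma_{D,k}^2,$$ $$\tilde\gamma_{U,j}=\sum_{j'\neq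 j}P_{j'}|u_j^Hh_{U,j',z(j)}|^2+\|u_j\|^2\Big(\sigma_{U,z(j)}^2+\sum_{k,l}t_{l,k}\,\delta_{l,z(j)}^2\Big),$$ $$\tilde R_{D,k}=\log_2\Big(1+\frac{h_{D,k}^HQ_kh_{D,k}}{\tilde\gamma_{D,k}}\Big),\qquad \tilde R_{U,j}=\log_2\Big(1+\frac{P_j|u_j^Hh_{U,j,z(j)}|^2}{\tilde\gamma_{U,j}}\Big).$$ For a fixed receiver $u$ and a set $\mathcal O$ of switched-off links $(l,k)$, let $X_{\mathcal O}(u)$ be the convex set of all $(Q,P)$ with $\sum_kt_{l,k}\le\bar P_{D,l}$ for all $l$, $Q_k\succeq 0$ for all $k$, $0\le P_j\le\bar P_{U,j}$ for all $j$, $(2^{R_{D,\min,k}}-1)\tilde\gamma_{D,k}\le h_{D,k}^HQ_kh_{D,k}$ for all $k$, $(2^{R_{U,\min,j}}-1)\tilde\gamma_{U,j}\le P_j|u_j^Hh_{U,j,z(j)}|^2$ for all $j$, and $t_{l,k}=0$ for all $(l,k)\in\mathcal O$. Given link weights $w_{l,k}$ (functions of $t_{l,k}$), problem $\mathcal P(w,\mathcal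 O,u)$ is to maximize $F_u(Q,P)=\sum_k\tilde R_{D,k}+\sum_j\tilde R_{U,j}$ over $(Q,P)\in X_{\mathcal O}(u)$ subject to the backhaul constraints $G_l(Q,P)=\sum_kw_{l,k}(t_{l,k})\tilde R_{D,k}\le C_{D,l}$ for all $l$. The *relaxed sum-rate problem* is $\mathcal P(\lambda_\theta,\emptyset,u)$. Given an association $\psi\in\{0,1\}^{L\times K}$, the *second-stage problem* is $\mathcal P(\psi,\{\psi=0\},u)$. A point $x=(Q,P)$ is *stationary* for $\mathcal P(w,\mathcal O,u)$ if it is feasible and there are $\nu_l\ge 0$ with $\nu_l(G_l(x)-C_{D,l})=0$ such that the directional derivatives at $x$ satisfy $DF_u(x)[y-x]-\sum_l\nu_lDG_l(x)[y-x]\le 0$ for all $y\in X_{\mathcal O}(u)$. It is *regular* (constraint qualification) if some $y\in X_{\mathcal O}(u)$ satisfies all uplink QoS inequalities strictly and $DG_l(x)[y-x]<0$ for every $l$ with $G_l(x)=C_{D,l}$. **Algorithm, first stage.** Write $F_u=f-h$ with $$f=\sum_k\log_2(h_{D,k}^HQ_kh_{D,k}+\tilde\gamma_{D,k})+\sum_j\log_2(P_j|u_j^Hh_{U,j,z(j)}|^2+\tilde\gamma_{U,j}),\qquad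 h=\sum_k\log_2\tilde\gamma_{D,k}+\sum_j\log_2\tilde\gamma_{U,j}.$$ The initial state has $Q_k^{(0)}\succeq 0$, $P_j^{(0)}\ge 0$, $\rho_k^{(0)}>0$, $\phi_k^{(0)}>0$ and $u_j^{(0)}\ne 0$, and is otherwise arbitrary. In step $n$, with $u=u^{(n)}$ fixed and $h^{(n)}$ the first-order expansion of $h$ at $(Q^{(n)},P^{(n)})$, one takes for $(Q,P,\rho,\mu,\hat\rho)^{(n+1)}$ any maximizer of $f-h^{(n)}$ subject to $(Q,P)\in X_\emptyset(u^{(n)})$ and $$\rho_k\ge 0,\quad \mu_k>0,\quad \tilde\gamma_{D,k}\ge\frac1{\mu_k},\quad \frac{\mu_k^2}{2\phi_k^{(n)}}+\frac{\phi_k^{(n)}}2(h_{D,k}^HQ_kh_{D,k})^2\le 2^{\rho_k^{(n)}}\big(1+\ln 2\,(\rho_k-\rho_k^{(n)})\big)-1,$$ $$\frac{\rho_k-\rho_k^{(n)}}{\rho_k^{(n)}}+\ln\rho_k^{(n)}+\Psi^{(n)}_{l,k}(t_{l,k})\le\ln\hat\rho_{l,k},\qquad\sum_k\hat\rho_{l,k}\le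 C_{D,l},$$ where $\Psi^{(n)}_{l,k}$ is the first-order expansion of $t\mapsto\ln\lambda_\theta(t)$ at $t^{(n)}_{l,k}=\mathrm{Tr}(Q_k^{(n)}T_l)$; on a link with $t_{l,k}^{(n)}=0$, where this expansion does not exist, the constraint with the logarithm is replaced by its limiting form $t_{l,k}=0$, $\hat\rho_{l,k}\ge 0$. Then $\phi_k^{(n+1)}=\mu_k^{(n+1)}/(h_{D,k}^HQ_k^{(n+1)}h_{D,k})$, and $u^{(n+1)}$ is the MMSE receiver at $(Q,P)^{(n+1)}$, where the MMSE receiver at $(Q,P)$ is $$u_j=\sqrt{P_j}\Big(\sum_{j'}P_{j'}h_{U,j',z(j)}h_{U,j',z(j)}^H+\Big(\sum_{k,l}t_{l,k}\delta_{l,z(j)}^2+\sigma_{U,z(j)}^2\Big)I\Big)^{-1}h_{U,j,z(j)}.$$ **Second stage.** For an association $\psi_{l,k}=1\iff\lambda_\theta(\mathrm{Tr}(\bar Q_kT_l))>\xi$, obtained from covariances $\bar Q$ (for instance those returned by the first stage) and a threshold $\xi$, the same iteration is run with $X_{\{\psi=0\}}(u^{(n)})$ in place of $X_\emptyset(u^{(n)})$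 and with $\sum_{k:\psi_{l,k}=1}\rho_k\le C_{D,l}$ for all $l$ in place of the constraints on $\hat\rho$. **Proposition.** In both stages, if the first subproblem is feasible, then the iteration can be carried out for all $n$ (every subproblem met has a maximizer). For every run of either stage, whatever maximizers are chosen: 1. the iterates $(Q,P,u)^{(n)}$ stay in a compact set; the optimal values of the subproblems, and the sum rates $F_{u^{(n)}}(Q^{(n)},P^{(n)})$ for $n\ge 1$, are nondecreasing and converge to a common limit $R^\star$; at every limit point $(\bar x,\bar u)$ of the iterates, $F_{\bar u}(\bar x)=R^\star$ and $\bar u$ is the MMSE receiver at $\bar x$; 2. (first stage) every limit point $(\bar x,\bar u)$ is feasible for the relaxed sum-rate problem $\mathcal P(\lambda_\theta,\emptyset,\bar u)$. If all $\bar t_{l,k}$ are positive and $\bar x$ is regular for that problem, then $\bar x$ is a stationary point of it. In general, with $\bar{\mathcal O}=\{(l,k):\bar t_{l,k}=0\}$, if $\bar x$ is regular for $\mathcal P(\lambda_\theta,\bar{\mathcal O},\bar u)$, then it is a stationary point of $\mathcal P(\lambda_\theta,\bar{\mathcal O},\bar u)$; 3. (second stage) every limit point $(\bar x,\bar u)$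 is feasible for the second-stage problem $\mathcal P(\psi,\{\psi=0\},\bar u)$ and, if $\bar x$ is regular for it, a stationary point of it. -/

import Mathlib

open Filter Topology
open scoped Matrix ComplexOrder

namespace NAFD

/-- Data of a distributed antenna system with network-assisted full duplex: `L` transmitting RAUs and
`Z` receiving RAUs with `M` antennas each, `K` downlink users and `J` uplink users. An antenna of the
whole transmit array is a pair (T-RAU, antenna). -/
structure System (K J L Z M : ℕ) where
  /-- downlink channels -/
  hD : Fin K → (Fin L × Fin M → ℂ)
  /-- inter-user interference channels, uplink user `j` to downlink user `k` -/
  hIUI : Fin J → Fin K → ℂ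
  /-- uplink channels, uplink user `j` to R-RAU `z` -/
  hU : Fin J → Fin Z → (Fin M → ℂ)
  /-- the R-RAU that detects uplink user `j` -/
  serv : Fin J → Fin Z
  /-- noise powers at the downlink users -/
  sigD : Fin K → ℝ
  /-- noise powers at the R-RAUs -/
  sigU : Fin Z → ℝ
  /-- residual inter-RAU interference powers -/
  del : Fin L → Fin Z → ℝ
  /-- T-RAU power budgets -/
  PDmax : Fin L → ℝ
  /-- uplink power budgets -/
  PUmax : Fin J → ℝ
  /-- backhaul capacities of the T-RAUs -/
  C : Fin L → ℝ
  /-- downlink QoS rates -/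
  RDmin : Fin K → ℝ
  /-- uplink QoS rates -/
  RUmin : Fin J → ℝ
  /-- parameter of the smooth approximation of the indicator function -/
  theta : ℝ
  sigD_pos : ∀ k, 0 < sigD k
  sigU_pos : ∀ z, 0 < sigU z
  del_nonneg : ∀ l z, 0 ≤ del l z
  RDmin_pos : ∀ k, 0 < RDmin k
  RUmin_pos : ∀ j, 0 < RUmin j
  theta_pos : 0 < theta

/-- A matrix on the whole transmit array. -/
abbrev Mat (L M : ℕ) := Matrix (Fin L × Fin M) (Fin L × Fin M) ℂ

/-- The variables `(Q, P)`: transmit covariances of the downlink users, powers of the uplink users. -/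
abbrev Point (K J L M : ℕ) := (Fin K → Mat L M) × (Fin J → ℝ)

/-- The receivers; `u j` is the receive vector of uplink user `j` at its serving R-RAU (the receive
vectors of `j` at all other R-RAUs are zero). -/
abbrev Receiver (J M : ℕ) := Fin J → (Fin M → ℂ)

noncomputable section

variable {K J L Z M : ℕ}

/-! ### The relaxed sum-rate problem -/

/-- The selection matrix `T_l` of the antennas of T-RAU `l`. -/
def T (l : Fin L) : Mat L M :=
  Matrix.diagonal (fun p => if p.1 = l then 1 else 0)

/-- `Tr (Q T_l)`. -/
def trT (Q : Mat L M) (l : Fin L) : ℝ := (Q * T l).trace.re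

/-- `h_kᴴ Q h_k`. -/
def quadD (S : System K J L Z M) (k : Fin K) (Q : Mat L M) : ℝ :=
  (star (S.hD k) ⬝ᵥ (Q *ᵥ S.hD k)).re

/-- `|vᴴ h_{j',z(j)}|²`, the gain of user `j'` after the receive vector `v` used for user `j`. -/
def gainU (S : System K J L Z M) (j j' : Fin J) (v : Fin M → ℂ) : ℝ :=
  ‖star v ⬝ᵥ S.hU j' (S.serv j)‖ ^ 2

/-- The squared Euclidean norm of a receive vector. -/
def sqNorm (v : Fin M → ℂ) : ℝ := ∑ m, ‖v m‖ ^ 2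

/-- Residual interference power from the T-RAUs at R-RAU `z`. -/
def iri (S : System K J L Z M) (z : Fin Z) (Q : Fin K → Mat L M) : ℝ :=
  ∑ k, ∑ l, trT (Q k) l * S.del l z

/-- Interference plus noise at downlink user `k`. -/
def gamD (S : System K J L Z M) (k : Fin K) (x : Point K J L M) : ℝ :=
  (∑ k' ∈ Finset.univ.erase k, quadD S k (x.1 k')) + (∑ j, x.2 j * ‖S.hIUI j k‖ ^ 2) + S.sigD k

/-- Interference plus noise for uplink user `j` after reception. -/
def gamU (S : System K J L Z M) (u : Receiver J M) (j : Fin J) (x : Point K J L M) : ℝ :=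
  (∑ j' ∈ Finset.univ.erase j, x.2 j' * gainU S j j' (u j)) + S.sigU (S.serv j) * sqNorm (u j)
    + sqNorm (u j) * iri S (S.serv j) x.1

/-- Downlink rate. -/
def rateD (S : System K J L Z M) (k : Fin K) (x : Point K J L M) : ℝ :=
  Real.logb 2 (1 + quadD S k (x.1 k) / gamD S k x)

/-- Uplink rate. -/
def rateU (S : System K J L Z M) (u : Receiver J M) (j : Fin J) (x : Point K J L M) : ℝ :=
  Real.logb 2 (1 + x.2 j * gainU S j j (u j) / gamU S u j x)

/-- The objective: the sum rate. -/
def sumRate (S : System K J L Z M) (u : Receiver J M) (x : Point K J L M) : ℝ :=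
  (∑ k, rateD S k x) + ∑ j, rateU S u j x

/-- The smooth approximation `1 - exp (-θ t)` of the indicator of `t ≠ 0`. -/
def lam (S : System K J L Z M) (t : ℝ) : ℝ := 1 - Real.exp (-S.theta * t)

/-- The constraints of the relaxed problem that are convex for a fixed receiver: per-RAU power,
positive semidefiniteness, uplink power, downlink QoS and uplink QoS; moreover the links `(l, k)` in
`off` are switched off. -/
def convexSet (S : System K J L Z M) (off : Fin L → Fin K → Prop) (u : Receiver J M) :
    Set (Point K J L M) :=
  {x | (∀ l, ∑ k, trT (x.1 k) l ≤ S.PDmax l) ∧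
    (∀ k, (x.1 k).PosSemidef) ∧
    (∀ j, 0 ≤ x.2 j ∧ x.2 j ≤ S.PUmax j) ∧
    (∀ k, ((2 : ℝ) ^ S.RDmin k - 1) * gamD S k x - quadD S k (x.1 k) ≤ 0) ∧
    (∀ j, ((2 : ℝ) ^ S.RUmin j - 1) * gamU S u j x - x.2 j * gainU S j j (u j) ≤ 0) ∧
    (∀ l k, off l k → trT (x.1 k) l = 0)}

/-- Backhaul load of T-RAU `l`, where link `(l, k)` has the weight `w l k (Tr (Q_k T_l))`. -/
def load (S : System K J L Z M) (w : Fin L → Fin K → ℝ → ℝ) (l : Fin L) (x : Point K J L M) : ℝ :=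
  ∑ k, w l k (trT (x.1 k) l) * rateD S k x

/-- Feasibility for the problem of maximizing the sum rate for the fixed receiver `u`, with link
weights `w` in the backhaul constraints and the links in `off` switched off. -/
def IsFeasible (S : System K J L Z M) (w : Fin L → Fin K → ℝ → ℝ) (off : Fin L → Fin K → Prop)
    (u : Receiver J M) (x : Point K J L M) : Prop :=
  x ∈ convexSet S off u ∧ ∀ l, load S w l x ≤ S.C l

/-- Stationary (Karush-Kuhn-Tucker) points of that problem: there are multipliers `ν` of the
nonconvex backhaul constraints such that the gradient of the Lagrangian at `x` lies in the normal
cone of the convex set of all other constraints. -/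
def IsStationary (S : System K J L Z M) (w : Fin L → Fin K → ℝ → ℝ) (off : Fin L → Fin K → Prop)
    (u : Receiver J M) (x : Point K J L M) : Prop :=
  IsFeasible S w off u x ∧
    ∃ ν : Fin L → ℝ, (∀ l, 0 ≤ ν l) ∧ (∀ l, ν l * (load S w l x - S.C l) = 0) ∧
      ∀ y ∈ convexSet S off u,
        lineDeriv ℝ (sumRate S u) x (y - x) - ∑ l, ν l * lineDeriv ℝ (load S w l) x (y - x) ≤ 0

/-- The Mangasarian-Fromovitz constraint qualification of that problem at `x`: some direction into
the convex set decreases all active backhaul loads and makes the uplink QoS constraints strict. -/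
def IsRegular (S : System K J L Z M) (w : Fin L → Fin K → ℝ → ℝ) (off : Fin L → Fin K → Prop)
    (u : Receiver J M) (x : Point K J L M) : Prop :=
  ∃ y ∈ convexSet S off u,
    (∀ j, ((2 : ℝ) ^ S.RUmin j - 1) * gamU S u j y - y.2 j * gainU S j j (u j) < 0) ∧
    ∀ l, load S w l x = S.C l → lineDeriv ℝ (load S w l) x (y - x) < 0

/-- First stage: the weight of link `(l, k)` is `1 - exp (-θ Tr (Q_k T_l))`. -/
def weight1 (S : System K J L Z M) : Fin L → Fin K → ℝ → ℝ := fun _ _ t => lam S t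

/-- First stage: no link is switched off. -/
def noneOff : Fin L → Fin K → Prop := fun _ _ => False

/-- The links that are switched off at `x`. -/
def offAt (x : Point K J L M) : Fin L → Fin K → Prop := fun l k => trT (x.1 k) l = 0

/-- The user-RAU association obtained from the covariances `Q` with threshold `ξ`. -/
def assoc (S : System K J L Z M) (ξ : ℝ) (Q : Fin K → Mat L M) : Fin L → Fin K → Prop :=
  fun l k => ξ < lam S (trT (Q k) l)

open Classical in
/-- Second stage: the weight of a link is one if it is associated and zero otherwise. -/
def weight2 (ψ : Fin L → Fin K → Prop) : Fin L → Fin K → ℝ → ℝ :=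
  fun l k _ => if ψ l k then 1 else 0

/-- Second stage: the links that are not associated are switched off. -/
def notAssoc (ψ : Fin L → Fin K → Prop) : Fin L → Fin K → Prop := fun l k => ¬ ψ l k

/-! ### The algorithm -/

/-- The variables of a subproblem (without `ρhat`): `(Q, P)`, `ρ` and `μ`. -/
structure Vars (K J L M : ℕ) where
  x : Point K J L M
  ρ : Fin K → ℝ
  μ : Fin K → ℝ

/-- The state of the iteration: the variables, the parameters `φ` and the receivers. -/
structure State (K J L M : ℕ) extends Vars K J L M where
  φ : Fin K → ℝ
  u : Receiver J M

/-- First part of the difference-of-concave decomposition of the objective. -/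
def fPart (S : System K J L Z M) (u : Receiver J M) (x : Point K J L M) : ℝ :=
  (∑ k, Real.logb 2 (quadD S k (x.1 k) + gamD S k x))
    + ∑ j, Real.logb 2 (x.2 j * gainU S j j (u j) + gamU S u j x)

/-- Second part of the difference-of-concave decomposition of the objective. -/
def hPart (S : System K J L Z M) (u : Receiver J M) (x : Point K J L M) : ℝ :=
  (∑ k, Real.logb 2 (gamD S k x)) + ∑ j, Real.logb 2 (gamU S u j x)

/-- The first-order approximation of `hPart` at the state `s`. -/
def hLin (S : System K J L Z M) (s : State K J L M) (x : Point K J L M) : ℝ :=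
  hPart S s.u s.x
    + (∑ k, (gamD S k s.x)⁻¹ / Real.log 2 *
        ((∑ j, (x.2 j - s.x.2 j) * ‖S.hIUI j k‖ ^ 2)
          + ∑ k' ∈ Finset.univ.erase k, quadD S k (x.1 k' - s.x.1 k')))
    + ∑ j, (gamU S s.u j s.x)⁻¹ / Real.log 2 *
        ((∑ j' ∈ Finset.univ.erase j, (x.2 j' - s.x.2 j') * gainU S j j' (s.u j))
          + sqNorm (s.u j) * iri S (S.serv j) (fun k => x.1 k - s.x.1 k))

/-- The objective of the subproblem at the state `s`. -/
def surrogate (S : System K J L Z M) (s : State K J L M) (x : Point K J L M) : ℝ :=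
  fPart S s.u x - hLin S s x

/-- The convexified form at the state `s` of the constraints that make `ρ_k` an upper bound of the
rate of downlink user `k`: `γ_k ≥ 1 / μ_k`, and `μ_k h_kᴴ Q_k h_k ≤ 2 ^ ρ_k - 1` with the left side
replaced by its convex majorant and the right side by its first-order Taylor expansion. -/
def RateBound (S : System K J L Z M) (s : State K J L M) (v : Vars K J L M) : Prop :=
  ∀ k, 0 ≤ v.ρ k ∧ 0 < v.μ k ∧ 1 / v.μ k ≤ gamD S k v.x ∧
    1 / (2 * s.φ k) * v.μ k ^ 2 + s.φ k / 2 * quadD S k (v.x.1 k) ^ 2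
      ≤ (2 : ℝ) ^ s.ρ k * (Real.log 2 * (v.ρ k - s.ρ k) + 1) - 1

/-- The first-order upper bound of `log (1 - exp (-θ t))` at `t₀`. -/
def Psi (S : System K J L Z M) (t₀ t : ℝ) : ℝ :=
  Real.log (1 - Real.exp (-S.theta * t₀))
    + S.theta * Real.exp (-S.theta * t₀) * t / (1 - Real.exp (-S.theta * t₀))
    - S.theta * Real.exp (-S.theta * t₀) * t₀ / (1 - Real.exp (-S.theta * t₀))

/-- The linearized form at the state `s` of `ρ_k (1 - exp (-θ Tr (Q_k T_l))) ≤ ρhat_{l,k}`. On a link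
with `Tr (Q_k T_l) = 0` at the linearization point the linearization of the logarithm does not
exist; its limit, as this trace decreases to zero, says that the link stays switched off. -/
def BackhaulLin (S : System K J L Z M) (s : State K J L M) (v : Vars K J L M)
    (ρhat : Fin L → Fin K → ℝ) : Prop :=
  ∀ l k,
    (0 < trT (s.x.1 k) l → 0 < ρhat l k ∧
      (v.ρ k - s.ρ k) / s.ρ k + Real.log (s.ρ k) + Psi S (trT (s.x.1 k) l) (trT (v.x.1 k) l)
        ≤ Real.log (ρhat l k)) ∧
    (trT (s.x.1 k) l = 0 → 0 ≤ ρhat l k ∧ trT (v.x.1 k) l = 0)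

/-- Feasibility for the first-stage subproblem at the state `s`. -/
def Feasible1 (S : System K J L Z M) (s : State K J L M) (v : Vars K J L M)
    (ρhat : Fin L → Fin K → ℝ) : Prop :=
  v.x ∈ convexSet S noneOff s.u ∧ RateBound S s v ∧ BackhaulLin S s v ρhat ∧
    ∀ l, ∑ k, ρhat l k ≤ S.C l

open Classical in
/-- Feasibility for the second-stage subproblem at the state `s`, for the association `ψ`. -/
def Feasible2 (S : System K J L Z M) (ψ : Fin L → Fin K → Prop) (s : State K J L M)
    (v : Vars K J L M) : Prop :=
  v.x ∈ convexSet S (notAssoc ψ) s.u ∧ RateBound S s v ∧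
    ∀ l, ∑ k with ψ l k, v.ρ k ≤ S.C l

/-- The MMSE receivers for `(Q, P)`. -/
def mmse (S : System K J L Z M) (x : Point K J L M) : Receiver J M := fun j =>
  ((Real.sqrt (x.2 j) : ℝ) : ℂ) •
    (((∑ j', ((x.2 j' : ℝ) : ℂ) •
          Matrix.vecMulVec (S.hU j' (S.serv j)) (star (S.hU j' (S.serv j))))
        + ((iri S (S.serv j) x.1 : ℝ) : ℂ) • (1 : Matrix (Fin M) (Fin M) ℂ)
        + ((S.sigU (S.serv j) : ℝ) : ℂ) • (1 : Matrix (Fin M) (Fin M) ℂ))⁻¹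
      *ᵥ S.hU j (S.serv j))

/-- Admissible initial states: arbitrary, possibly infeasible, points at which the first subproblem is
defined. -/
def IsInit (s : State K J L M) : Prop :=
  (∀ k, (s.x.1 k).PosSemidef) ∧ (∀ j, 0 ≤ s.x.2 j) ∧ (∀ k, 0 < s.ρ k) ∧ (∀ k, 0 < s.φ k) ∧
    ∀ j, s.u j ≠ 0

/-- The closed-form updates of `φ` and of the receivers, after the subproblem has been solved. -/
def IsUpdate (S : System K J L Z M) (s' : State K J L M) : Prop :=
  (∀ k, s'.φ k = s'.μ k / quadD S k (s'.x.1 k)) ∧ s'.u = mmse S s'.x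

/-- Runs of the first-stage algorithm; any optimal solution of a subproblem may be chosen. -/
def IsRun1 (S : System K J L Z M) (s : ℕ → State K J L M) : Prop :=
  IsInit (s 0) ∧ ∀ n,
    (∃ ρhat, Feasible1 S (s n) (s (n + 1)).toVars ρhat) ∧
    (∀ v ρhat, Feasible1 S (s n) v ρhat →
      surrogate S (s n) v.x ≤ surrogate S (s n) (s (n + 1)).x) ∧
    IsUpdate S (s (n + 1))

/-- Runs of the second-stage algorithm for the association `ψ`. -/
def IsRun2 (S : System K J L Z M) (ψ : Fin L → Fin K → Prop) (s : ℕ → State K J L M) : Prop :=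
  IsInit (s 0) ∧ ∀ n,
    Feasible2 S ψ (s n) (s (n + 1)).toVars ∧
    (∀ v, Feasible2 S ψ (s n) v → surrogate S (s n) v.x ≤ surrogate S (s n) (s (n + 1)).x) ∧
    IsUpdate S (s (n + 1))

/-- `(x, u)` is a limit point of the iterates. -/
def IsLimitPoint (s : ℕ → State K J L M) (x : Point K J L M) (u : Receiver J M) : Prop :=
  MapClusterPt (x, u) atTop (fun n => ((s n).x, (s n).u))

/-- The iterates stay in a compact set; the optimal values of the subproblems and the sum rates are
nondecreasing and converge to the same limit; at every limit point the sum rate is that limit and the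
receivers are the MMSE receivers. -/
def Converges (S : System K J L Z M) (s : ℕ → State K J L M) : Prop :=
  (∃ B : Set (Point K J L M × Receiver J M), IsCompact B ∧ ∀ n, ((s n).x, (s n).u) ∈ B) ∧
  Monotone (fun n => surrogate S (s n) (s (n + 1)).x) ∧
  Monotone (fun n => sumRate S (s (n + 1)).u (s (n + 1)).x) ∧
  ∃ R : ℝ, Tendsto (fun n => surrogate S (s n) (s (n + 1)).x) atTop (𝓝 R) ∧
    Tendsto (fun n => sumRate S (s n).u (s n).x) atTop (𝓝 R) ∧
    ∀ x u, IsLimitPoint s x u → sumRate S u x = R ∧ u = mmse S x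

end

end NAFD

namespace NAFD

noncomputable section

variable {K J L Z M : ℕ}

/-! ### Positive semidefinite matrices -/

/-! The algorithm is an inner approximation scheme. At a state, the concave part `hPart` of the
objective is replaced by its tangent, which gives a minorant of the sum rate. Every nonconvex
constraint is replaced by a stronger convex one: the tangent of `2 ^ ρ`, Young's inequality for the
product of `μ` and the signal power, and the tangents of `log ρ` and of `log (lam t)`. All of these
are exact at the expansion point once `φ` is updated. A solution therefore satisfies the true
constraints and, after the updates, is feasible for the next subproblem (`Feas.good`, `Good.feas`).
The MMSE receivers maximize each uplink signal-to-interference ratio (`mmse_optimal`), so changing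
to them keeps feasibility and does not lower the sum rate. Optimal values and sum rates thus
interlace, and compactness gives their common limit.

For stationarity, both stages are treated as instances of one `Scheme`, with the auxiliary variables
eliminated through `rmin`. The QoS constraints keep signal powers, rate bounds and receivers away
from zero, and the backhaul bounds `ρ` above, so along an ultrafilter the whole state converges to a
state with the same invariants (`IsRun.exists_limit`). A point strictly feasible for the limiting
subproblem is feasible for late subproblems, hence its surrogate value is at most the limit
(`IsRun.surr_le_of_strict`). Directions that decrease the active loads lead to such points
(`Good.eventually_backhaul`): at an active load every rate bound of positive weight must be tight,
and there the majorants are exact to first order. So no such direction raises the sum rate to first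
order, and a separation argument (`exists_multipliers`) produces the multipliers. -/

theorem posSemidef_diag_re_nonneg {n : Type*} {A : Matrix n n ℂ} (hA : A.PosSemidef) (i : n) :
    0 ≤ (A i i).re := by
  have := hA.diag_nonneg (i := i)
  exact (Complex.nonneg_iff.1 this).1

section Psd

variable {n : Type*} [Fintype n]

/-- A positive semidefinite matrix defines a possibly degenerate inner product, for which the
abstract inequality already holds. It serves both the entry bounds and the optimality of the MMSE
receivers. -/
theorem posSemidef_cauchy_schwarz {A : Matrix n n ℂ} (hA : A.PosSemidef) (v w : n → ℂ) :
    ‖star v ⬝ᵥ (A *ᵥ w)‖ ^ 2 ≤ (star v ⬝ᵥ (A *ᵥ v)).re * (star w ⬝ᵥ (A *ᵥ w)).re := by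
  let c : PreInnerProductSpace.Core ℂ (n → ℂ) :=
    { inner := fun x y => (A *ᵥ y) ⬝ᵥ star x
      conj_inner_symm := fun x y => by
        rw [dotProduct_comm, Matrix.star_dotProduct, starRingEnd_apply, star_star,
          Matrix.star_mulVec, dotProduct_comm (A *ᵥ y), Matrix.dotProduct_mulVec,
          hA.isHermitian.eq]
      re_inner_nonneg := fun x => dotProduct_comm _ (star x) ▸ hA.re_dotProduct_nonneg x
      add_left := by simp only [star_add, dotProduct_add, forall_const]
      smul_left := fun _ _ _ => by
        rw [← smul_eq_mul, ← dotProduct_smul, starRingEnd_apply, ← star_smul] }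
  have h := @InnerProductSpace.Core.inner_mul_inner_self_le ℂ (n → ℂ) _ _ _ c v w
  have hs := @InnerProductSpace.Core.norm_inner_symm ℂ (n → ℂ) _ _ _ c v w
  rw [← hs, ← sq] at h
  have e : ∀ x y : n → ℂ, star x ⬝ᵥ (A *ᵥ y) = (A *ᵥ y) ⬝ᵥ star x :=
    fun x y => dotProduct_comm _ _
  rw [e, e, e]
  exact h

/-- Cauchy–Schwarz at two basis vectors. Through it a power budget, which limits only the trace,
bounds the whole covariance. -/
theorem posSemidef_norm_apply_le {A : Matrix n n ℂ} (hA : A.PosSemidef) (i j : n) :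
    ‖A i j‖ ≤ ∑ m, (A m m).re := by
  classical
  have h := posSemidef_cauchy_schwarz hA (Pi.single i 1) (Pi.single j 1)
  have e : ∀ i j : n, star (Pi.single i (1 : ℂ)) ⬝ᵥ (A *ᵥ Pi.single j 1) = A i j := by
    intro i j
    rw [← Pi.single_star, star_one]
    simp
  rw [e, e, e] at h
  have hd := posSemidef_diag_re_nonneg hA
  have hi : (A i i).re ≤ ∑ m, (A m m).re :=
    Finset.single_le_sum (f := fun m => (A m m).re) (fun m _ => hd m) (Finset.mem_univ i)
  have hj : (A j j).re ≤ ∑ m, (A m m).re :=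
    Finset.single_le_sum (f := fun m => (A m m).re) (fun m _ => hd m) (Finset.mem_univ j)
  refine abs_le_of_sq_le_sq' ?_ ((hd i).trans hi) |>.2
  calc ‖A i j‖ ^ 2 ≤ (A i i).re * (A j j).re := h
    _ ≤ (∑ m, (A m m).re) * ∑ m, (A m m).re :=
      mul_le_mul hi hj (hd j) ((hd i).trans hi)
    _ = _ := by ring

theorem isClosed_posSemidef : IsClosed {A : Matrix n n ℂ | A.PosSemidef} := by
  simp only [Matrix.posSemidef_iff_dotProduct_mulVec, Set.ofPred_and, Set.ofPred_forall]
  refine IsClosed.inter ?_ (isClosed_iInter fun x => ?_)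
  · exact isClosed_eq (by fun_prop) continuous_id
  · have : Continuous fun A : Matrix n n ℂ => star x ⬝ᵥ (A *ᵥ x) := by fun_prop
    have hc : IsClosed {z : ℂ | 0 ≤ z} := by
      simp only [Complex.nonneg_iff, Set.ofPred_and]
      exact (isClosed_le continuous_const Complex.continuous_re).inter
        (isClosed_eq continuous_const Complex.continuous_im)
    exact hc.preimage this

end Psd

/-! ### The elementary quantities as linear maps -/

/-- `Tr (Q T_l)` as a linear map. -/
def trTL (l : Fin L) : Mat L M →ₗ[ℝ] ℝ where
  toFun Q := trT Q l
  map_add' Q Q' := by simp [trT, add_mul]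
  map_smul' r Q := by simp [trT]

/-- `h_kᴴ Q h_k` as a linear map. -/
def quadDL (S : System K J L Z M) (k : Fin K) : Mat L M →ₗ[ℝ] ℝ where
  toFun Q := quadD S k Q
  map_add' Q Q' := by simp [quadD, Matrix.add_mulVec]
  map_smul' r Q := by simp [quadD, Matrix.smul_mulVec]

theorem trTL_apply (l : Fin L) (Q : Mat L M) : trTL l Q = trT Q l := rfl

theorem quadDL_apply (S : System K J L Z M) (k : Fin K) (Q : Mat L M) :
    quadDL S k Q = quadD S k Q := rfl

/-- The covariance of user `k` as a linear map of the point. -/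
def covL (k : Fin K) : Point K J L M →ₗ[ℝ] Mat L M :=
  (LinearMap.proj k).comp (LinearMap.fst ℝ _ _)

/-- The power of user `j` as a linear map of the point. -/
def powL (j : Fin J) : Point K J L M →ₗ[ℝ] ℝ :=
  (LinearMap.proj j).comp (LinearMap.snd ℝ _ _)

/-- The residual interference as a linear map of the point. -/
def iriL (S : System K J L Z M) (z : Fin Z) : Point K J L M →ₗ[ℝ] ℝ :=
  ∑ k, ∑ l, S.del l z • (trTL l).comp (covL k)

theorem iriL_apply (S : System K J L Z M) (z : Fin Z) (x : Point K J L M) :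
    iriL S z x = iri S z x.1 := by
  simp [iriL, iri, covL, trTL_apply, mul_comm]

/-- The linear part of `gamD`. -/
def gamDL (S : System K J L Z M) (k : Fin K) : Point K J L M →ₗ[ℝ] ℝ :=
  (∑ k' ∈ Finset.univ.erase k, (quadDL S k).comp (covL k')) + ∑ j, (‖S.hIUI j k‖ ^ 2) • powL j

/-- The linear part of `gamU`. -/
def gamUL (S : System K J L Z M) (u : Receiver J M) (j : Fin J) : Point K J L M →ₗ[ℝ] ℝ :=
  (∑ j' ∈ Finset.univ.erase j, gainU S j j' (u j) • powL j')
    + sqNorm (u j) • iriL S (S.serv j)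

theorem gamDL_apply (S : System K J L Z M) (k : Fin K) (x : Point K J L M) :
    gamDL S k x = (∑ j, x.2 j * ‖S.hIUI j k‖ ^ 2)
      + ∑ k' ∈ Finset.univ.erase k, quadD S k (x.1 k') := by
  simp [gamDL, LinearMap.sum_apply, powL, covL, quadDL_apply, mul_comm, add_comm]

theorem gamUL_apply (S : System K J L Z M) (u : Receiver J M) (j : Fin J) (x : Point K J L M) :
    gamUL S u j x = (∑ j' ∈ Finset.univ.erase j, x.2 j' * gainU S j j' (u j))
      + sqNorm (u j) * iri S (S.serv j) x.1 := by
  simp [gamUL, LinearMap.sum_apply, powL, iriL_apply, mul_comm]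

/-- Interference is affine in the point for fixed receivers; splitting off the noise reduces
convexity and differentiation to linear maps. -/
theorem gamD_eq (S : System K J L Z M) (k : Fin K) (x : Point K J L M) :
    gamD S k x = gamDL S k x + S.sigD k := by
  rw [gamDL_apply, gamD]; ring

theorem gamU_eq (S : System K J L Z M) (u : Receiver J M) (j : Fin J) (x : Point K J L M) :
    gamU S u j x = gamUL S u j x + S.sigU (S.serv j) * sqNorm (u j) := by
  rw [gamUL_apply, gamU]; ring

/-- The received power of downlink user `k` as a linear map of the point. -/
def sigDL (S : System K J L Z M) (k : Fin K) : Point K J L M →ₗ[ℝ] ℝ :=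
  (quadDL S k).comp (covL k)

/-- The received power of uplink user `j` as a linear map of the point. -/
def sigUL (S : System K J L Z M) (u : Receiver J M) (j : Fin J) : Point K J L M →ₗ[ℝ] ℝ :=
  gainU S j j (u j) • powL j

/-- The trace on link `(l, k)` as a linear map of the point. -/
def linkL (l : Fin L) (k : Fin K) : Point K J L M →ₗ[ℝ] ℝ := (trTL l).comp (covL k)

theorem sigDL_apply (S : System K J L Z M) (k : Fin K) (x : Point K J L M) :
    sigDL S k x = quadD S k (x.1 k) := rfl

theorem sigUL_apply (S : System K J L Z M) (u : Receiver J M) (j : Fin J) (x : Point K J L M) :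
    sigUL S u j x = x.2 j * gainU S j j (u j) := by
  simp [sigUL, powL, mul_comm]

theorem linkL_apply (l : Fin L) (k : Fin K) (x : Point K J L M) :
    linkL l k x = trT (x.1 k) l := rfl

/-! ### Continuity -/

@[fun_prop]
theorem continuous_trT (l : Fin L) : Continuous fun Q : Mat L M => trT Q l := by
  unfold trT
  fun_prop

@[fun_prop]
theorem continuous_quadD (S : System K J L Z M) (k : Fin K) :
    Continuous fun Q : Mat L M => quadD S k Q := by
  unfold quadD
  fun_prop

@[fun_prop]
theorem continuous_gainU (S : System K J L Z M) (j j' : Fin J) :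
    Continuous fun v : Fin M → ℂ => gainU S j j' v := by
  unfold gainU dotProduct
  fun_prop

@[fun_prop]
theorem continuous_sqNorm : Continuous fun v : Fin M → ℂ => sqNorm v := by
  unfold sqNorm
  fun_prop

@[fun_prop]
theorem continuous_iri (S : System K J L Z M) (z : Fin Z) :
    Continuous fun Q : Fin K → Mat L M => iri S z Q := by
  unfold iri
  fun_prop

@[fun_prop]
theorem continuous_gamD (S : System K J L Z M) (k : Fin K) :
    Continuous fun x : Point K J L M => gamD S k x := by
  unfold gamD
  fun_prop

theorem continuous_gamU (S : System K J L Z M) (j : Fin J) :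
    Continuous fun p : Point K J L M × Receiver J M => gamU S p.2 j p.1 := by
  unfold gamU
  fun_prop

@[fun_prop]
theorem continuous_gamU_left (S : System K J L Z M) (u : Receiver J M) (j : Fin J) :
    Continuous fun x : Point K J L M => gamU S u j x :=
  (continuous_gamU S j).comp (by fun_prop : Continuous fun x : Point K J L M => (x, u))

theorem continuous_sigU (S : System K J L Z M) (j : Fin J) :
    Continuous fun p : Point K J L M × Receiver J M => p.1.2 j * gainU S j j (p.2 j) := by
  fun_prop

/-! ### Positivity -/

/-- The points with positive semidefinite covariances and nonnegative powers. -/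
def cone (K J L M : ℕ) : Set (Point K J L M) := {x | (∀ k, (x.1 k).PosSemidef) ∧ ∀ j, 0 ≤ x.2 j}

theorem trT_eq (Q : Mat L M) (l : Fin L) : trT Q l = ∑ m, (Q (l, m) (l, m)).re := by
  simp only [trT, T, Matrix.trace, Matrix.diag, Matrix.mul_diagonal, Complex.re_sum,
    Fintype.sum_prod_type]
  rw [Finset.sum_eq_single l]
  · simp
  · intro b _ hb; simp [hb]
  · simp

theorem trT_nonneg {Q : Mat L M} (hQ : Q.PosSemidef) (l : Fin L) : 0 ≤ trT Q l := by
  rw [trT_eq]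
  exact Finset.sum_nonneg fun m _ => posSemidef_diag_re_nonneg hQ _

theorem sum_trT (Q : Mat L M) : ∑ l, trT Q l = ∑ p, (Q p p).re := by
  simp [trT_eq, Fintype.sum_prod_type]

theorem quadD_nonneg (S : System K J L Z M) (k : Fin K) {Q : Mat L M} (hQ : Q.PosSemidef) :
    0 ≤ quadD S k Q := hQ.re_dotProduct_nonneg (S.hD k)

theorem gainU_nonneg (S : System K J L Z M) (j j' : Fin J) (v : Fin M → ℂ) :
    0 ≤ gainU S j j' v := by unfold gainU; positivity

theorem sqNorm_nonneg (v : Fin M → ℂ) : 0 ≤ sqNorm v := by unfold sqNorm; positivity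

theorem sqNorm_pos {v : Fin M → ℂ} (hv : v ≠ 0) : 0 < sqNorm v := by
  obtain ⟨m, hm⟩ := Function.ne_iff.1 hv
  have : 0 < ‖v m‖ ^ 2 := by
    have : v m ≠ 0 := hm
    positivity
  exact this.trans_le
    (Finset.single_le_sum (f := fun m => ‖v m‖ ^ 2) (fun m _ => by positivity) (Finset.mem_univ m))

theorem iri_nonneg (S : System K J L Z M) (z : Fin Z) {x : Point K J L M} (hx : x ∈ cone K J L M) :
    0 ≤ iri S z x.1 :=
  Finset.sum_nonneg fun k _ => Finset.sum_nonneg fun l _ =>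
    mul_nonneg (trT_nonneg (hx.1 k) l) (S.del_nonneg l z)

theorem sigD_le_gamD (S : System K J L Z M) (k : Fin K) {x : Point K J L M}
    (hx : x ∈ cone K J L M) : S.sigD k ≤ gamD S k x := by
  have h1 : 0 ≤ ∑ k' ∈ Finset.univ.erase k, quadD S k (x.1 k') :=
    Finset.sum_nonneg fun k' _ => quadD_nonneg S k (hx.1 k')
  have h2 : 0 ≤ ∑ j, x.2 j * ‖S.hIUI j k‖ ^ 2 :=
    Finset.sum_nonneg fun j _ => mul_nonneg (hx.2 j) (by positivity)
  unfold gamD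
  linarith

theorem gamD_pos (S : System K J L Z M) (k : Fin K) {x : Point K J L M}
    (hx : x ∈ cone K J L M) : 0 < gamD S k x :=
  (S.sigD_pos k).trans_le (sigD_le_gamD S k hx)

theorem sigU_le_gamU (S : System K J L Z M) (u : Receiver J M) (j : Fin J) {x : Point K J L M}
    (hx : x ∈ cone K J L M) : S.sigU (S.serv j) * sqNorm (u j) ≤ gamU S u j x := by
  have h1 : 0 ≤ ∑ j' ∈ Finset.univ.erase j, x.2 j' * gainU S j j' (u j) :=
    Finset.sum_nonneg fun j' _ => mul_nonneg (hx.2 j') (gainU_nonneg _ _ _ _)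
  have h2 := mul_nonneg (sqNorm_nonneg (u j)) (iri_nonneg S (S.serv j) hx)
  unfold gamU
  linarith

theorem gamU_pos (S : System K J L Z M) {u : Receiver J M} (j : Fin J) {x : Point K J L M}
    (hx : x ∈ cone K J L M) (hu : u j ≠ 0) : 0 < gamU S u j x :=
  (mul_pos (S.sigU_pos _) (sqNorm_pos hu)).trans_le (sigU_le_gamU S u j hx)

theorem convexSet_subset_cone (S : System K J L Z M) (off : Fin L → Fin K → Prop)
    (u : Receiver J M) : convexSet S off u ⊆ cone K J L M :=
  fun _ hx => ⟨hx.2.1, fun j => (hx.2.2.1 j).1⟩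

theorem dotProduct_star_self_re (v : Fin M → ℂ) : (star v ⬝ᵥ v).re = sqNorm v := by
  simp only [dotProduct, sqNorm, Complex.re_sum, Pi.star_apply]
  refine Finset.sum_congr rfl fun m _ => ?_
  rw [← Complex.normSq_eq_norm_sq, Complex.normSq_apply]
  simp

theorem norm_dotProduct_sq_le (v w : Fin M → ℂ) :
    ‖star v ⬝ᵥ w‖ ^ 2 ≤ sqNorm v * sqNorm w := by
  have := posSemidef_cauchy_schwarz (Matrix.PosSemidef.one (n := Fin M) (R := ℂ)) v w
  simpa only [Matrix.one_mulVec, dotProduct_star_self_re] using this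

theorem rpow_two_sub_one_pos {r : ℝ} (hr : 0 < r) : 0 < (2 : ℝ) ^ r - 1 := by
  have := Real.one_lt_rpow (by norm_num : (1 : ℝ) < 2) hr
  linarith

/-- The interference is at least the noise, so a positive QoS rate forces a signal power bounded
below uniformly. This makes the division in the update of `φ` harmless, also in the limit. -/
theorem quadD_lower {S : System K J L Z M} {off : Fin L → Fin K → Prop} {u : Receiver J M}
    {x : Point K J L M} (hx : x ∈ convexSet S off u) (k : Fin K) :
    ((2 : ℝ) ^ S.RDmin k - 1) * S.sigD k ≤ quadD S k (x.1 k) := by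
  have h := hx.2.2.2.1 k
  have h1 := sigD_le_gamD S k (convexSet_subset_cone S off u hx)
  have h2 := mul_le_mul_of_nonneg_left h1 (rpow_two_sub_one_pos (S.RDmin_pos k)).le
  linarith

theorem quadD_pos {S : System K J L Z M} {off : Fin L → Fin K → Prop} {u : Receiver J M}
    {x : Point K J L M} (hx : x ∈ convexSet S off u) (k : Fin K) : 0 < quadD S k (x.1 k) :=
  (mul_pos (rpow_two_sub_one_pos (S.RDmin_pos k)) (S.sigD_pos k)).trans_le (quadD_lower hx k)

/-- Both sides of the uplink QoS inequality scale with the squared norm of the receiver, which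
cancels by Cauchy–Schwarz. The resulting bound does not mention the receiver, so it survives
receiver updates and limits. -/
theorem power_lower {S : System K J L Z M} {off : Fin L → Fin K → Prop} {u : Receiver J M}
    {x : Point K J L M} (hx : x ∈ convexSet S off u) {j : Fin J} (hu : u j ≠ 0) :
    ((2 : ℝ) ^ S.RUmin j - 1) * S.sigU (S.serv j) ≤ x.2 j * sqNorm (S.hU j (S.serv j)) := by
  have h := hx.2.2.2.2.1 j
  have h1 := sigU_le_gamU S u j (convexSet_subset_cone S off u hx)
  have h2 := mul_le_mul_of_nonneg_left h1 (rpow_two_sub_one_pos (S.RUmin_pos j)).le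
  have h3 := mul_le_mul_of_nonneg_left (norm_dotProduct_sq_le (u j) (S.hU j (S.serv j)))
    (hx.2.2.1 j).1
  have h4 : x.2 j * gainU S j j (u j) ≤ x.2 j * (sqNorm (u j) * sqNorm (S.hU j (S.serv j))) := h3
  refine le_of_mul_le_mul_right ?_ (sqNorm_pos hu)
  nlinarith

/-! ### Compactness and convexity of the convex constraint set -/

/-- The points with positive semidefinite covariances that respect the power budgets. -/
def budgetSet (S : System K J L Z M) : Set (Point K J L M) :=
  {x | (∀ l, ∑ k, trT (x.1 k) l ≤ S.PDmax l) ∧ (∀ k, (x.1 k).PosSemidef) ∧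
    ∀ j, 0 ≤ x.2 j ∧ x.2 j ≤ S.PUmax j}

/-- Each matrix entry is bounded by the trace, and the trace by the sum of all power budgets. -/
theorem isCompact_budgetSet (S : System K J L Z M) : IsCompact (budgetSet S) := by
  have hc : IsCompact ((Set.univ.pi fun _ : Fin K => Set.univ.pi fun _ : Fin L × Fin M =>
      Set.univ.pi fun _ : Fin L × Fin M => Metric.closedBall (0 : ℂ) (∑ l, S.PDmax l)) ×ˢ
      (Set.univ.pi fun j : Fin J => Set.Icc 0 (S.PUmax j))) :=
    (isCompact_univ_pi fun _ => isCompact_univ_pi fun _ => isCompact_univ_pi fun _ =>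
      isCompact_closedBall _ _).prod (isCompact_univ_pi fun _ => isCompact_Icc)
  refine IsCompact.of_isClosed_subset (X := Point K J L M) hc ?_ ?_
  · simp only [budgetSet, Set.ofPred_and, Set.ofPred_forall]
    refine IsClosed.inter (isClosed_iInter fun l => isClosed_le (by fun_prop) (by fun_prop))
      (IsClosed.inter (isClosed_iInter fun k => ?_) (isClosed_iInter fun j =>
        (isClosed_le (by fun_prop) (by fun_prop)).inter (isClosed_le (by fun_prop) (by fun_prop))))
    exact isClosed_posSemidef.preimage (by fun_prop : Continuous fun x : Point K J L M => x.1 k)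
  · rintro x ⟨h1, h2, h3⟩
    refine ⟨fun k _ p _ q _ => ?_, fun j _ => h3 j⟩
    rw [mem_closedBall_zero_iff]
    refine (posSemidef_norm_apply_le (h2 k) p q).trans ?_
    rw [← sum_trT]
    refine Finset.sum_le_sum fun l _ => le_trans ?_ (h1 l)
    exact Finset.single_le_sum (f := fun k => trT (x.1 k) l)
      (fun k _ => trT_nonneg (h2 k) l) (Finset.mem_univ k)

theorem convexSet_subset_budgetSet (S : System K J L Z M) (off : Fin L → Fin K → Prop)
    (u : Receiver J M) : convexSet S off u ⊆ budgetSet S :=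
  fun _ hx => ⟨hx.1, hx.2.1, hx.2.2.1⟩

theorem isCompact_convexSet (S : System K J L Z M) (off : Fin L → Fin K → Prop)
    (u : Receiver J M) : IsCompact (convexSet S off u) := by
  have : convexSet S off u = budgetSet S ∩
      ((⋂ k, {x | ((2 : ℝ) ^ S.RDmin k - 1) * gamD S k x - quadD S k (x.1 k) ≤ 0}) ∩
      ((⋂ j, {x | ((2 : ℝ) ^ S.RUmin j - 1) * gamU S u j x - x.2 j * gainU S j j (u j) ≤ 0}) ∩
      (⋂ l, ⋂ k, ⋂ _ : off l k, {x | trT (x.1 k) l = 0}))) := by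
    ext x
    simp [convexSet, budgetSet, and_assoc]
  rw [this]
  refine (isCompact_budgetSet S).inter_right (IsClosed.inter (isClosed_iInter fun k => ?_)
    (IsClosed.inter (isClosed_iInter fun j => ?_)
    (isClosed_iInter fun l => isClosed_iInter fun k => isClosed_iInter fun _ => ?_)))
  · exact isClosed_le (by fun_prop) (by fun_prop)
  · exact isClosed_le (by fun_prop) (by fun_prop)
  · exact isClosed_eq (by fun_prop) (by fun_prop)

/-- The uplink quality-of-service constraint function. -/
def qosU (S : System K J L Z M) (u : Receiver J M) (j : Fin J) (x : Point K J L M) : ℝ :=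
  ((2 : ℝ) ^ S.RUmin j - 1) * gamU S u j x - x.2 j * gainU S j j (u j)

/-- Being affine, the constraint becomes strict on a mixture of a feasible and a strictly feasible
point as soon as the latter has positive weight. -/
theorem qosU_combo (S : System K J L Z M) (u : Receiver J M) (j : Fin J) (x y : Point K J L M)
    {a b : ℝ} (hab : a + b = 1) :
    qosU S u j (a • x + b • y) = a * qosU S u j x + b * qosU S u j y := by
  have hb : b = 1 - a := by linarith
  subst hb
  simp only [qosU, gamU_eq, ← sigUL_apply, map_add, map_smul, smul_eq_mul]
  ring

theorem convex_convexSet (S : System K J L Z M) (off : Fin L → Fin K → Prop)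
    (u : Receiver J M) : Convex ℝ (convexSet S off u) := by
  rintro x ⟨h1, h2, h3, h4, h5, h6⟩ y ⟨k1, k2, k3, k4, k5, k6⟩ a b ha hb hab
  refine ⟨fun l => ?_, fun k => ?_, fun j => ?_, fun k => ?_, fun j => ?_, fun l k hlk => ?_⟩
  · have : ∑ k, trT ((a • x + b • y).1 k) l = a * ∑ k, trT (x.1 k) l + b * ∑ k, trT (y.1 k) l := by
      simp only [← linkL_apply, map_add, map_smul, smul_eq_mul, Finset.sum_add_distrib,
        Finset.mul_sum]
    rw [this]
    calc _ ≤ a * S.PDmax l + b * S.PDmax l :=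
          add_le_add (mul_le_mul_of_nonneg_left (h1 l) ha) (mul_le_mul_of_nonneg_left (k1 l) hb)
      _ = _ := by rw [← add_mul, hab, one_mul]
  · exact ((h2 k).smul ha).add ((k2 k).smul hb)
  · have e : (a • x + b • y).2 j = a * x.2 j + b * y.2 j := rfl
    rw [e]
    refine ⟨add_nonneg (mul_nonneg ha (h3 j).1) (mul_nonneg hb (k3 j).1), ?_⟩
    calc _ ≤ a * S.PUmax j + b * S.PUmax j :=
          add_le_add (mul_le_mul_of_nonneg_left (h3 j).2 ha)
            (mul_le_mul_of_nonneg_left (k3 j).2 hb)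
      _ = _ := by rw [← add_mul, hab, one_mul]
  · have hb' : b = 1 - a := by linarith
    have e : ((2 : ℝ) ^ S.RDmin k - 1) * gamD S k (a • x + b • y)
        - quadD S k ((a • x + b • y).1 k)
        = a * (((2 : ℝ) ^ S.RDmin k - 1) * gamD S k x - quadD S k (x.1 k))
          + b * (((2 : ℝ) ^ S.RDmin k - 1) * gamD S k y - quadD S k (y.1 k)) := by
      simp only [gamD_eq, ← sigDL_apply, map_add, map_smul, smul_eq_mul, hb']
      ring
    rw [e]
    exact add_nonpos (mul_nonpos_of_nonneg_of_nonpos ha (h4 k))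
      (mul_nonpos_of_nonneg_of_nonpos hb (k4 k))
  · have e := qosU_combo S u j x y hab
    exact e.trans_le (add_nonpos (mul_nonpos_of_nonneg_of_nonpos ha (h5 j))
      (mul_nonpos_of_nonneg_of_nonpos hb (k5 j)))
  · rw [← linkL_apply, map_add, map_smul, map_smul, linkL_apply, linkL_apply, h6 l k hlk,
      k6 l k hlk]
    simp

/-! ### The MMSE receivers -/

/-- The covariance of the signal received at R-RAU `z`. -/
def covU (S : System K J L Z M) (z : Fin Z) (x : Point K J L M) : Matrix (Fin M) (Fin M) ℂ :=
  (∑ j', ((x.2 j' : ℝ) : ℂ) • Matrix.vecMulVec (S.hU j' z) (star (S.hU j' z)))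
    + ((iri S z x.1 : ℝ) : ℂ) • (1 : Matrix (Fin M) (Fin M) ℂ)
    + ((S.sigU z : ℝ) : ℂ) • (1 : Matrix (Fin M) (Fin M) ℂ)

theorem mmse_eq (S : System K J L Z M) (x : Point K J L M) (j : Fin J) :
    mmse S x j = ((Real.sqrt (x.2 j) : ℝ) : ℂ) •
      ((covU S (S.serv j) x)⁻¹ *ᵥ S.hU j (S.serv j)) := rfl

theorem posDef_covU (S : System K J L Z M) (z : Fin Z) {x : Point K J L M}
    (hx : x ∈ cone K J L M) : (covU S z x).PosDef := by
  refine Matrix.PosDef.posSemidef_add (Matrix.PosSemidef.add ?_ ?_) ?_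
  · refine Matrix.posSemidef_sum _ fun j _ => ?_
    exact (Matrix.posSemidef_vecMulVec_self_star _).smul (by exact_mod_cast hx.2 j)
  · exact Matrix.PosSemidef.one.smul (by exact_mod_cast iri_nonneg S z hx)
  · exact Matrix.PosDef.one.smul (by exact_mod_cast S.sigU_pos z)

theorem star_dotProduct_vecMulVec (v h : Fin M → ℂ) :
    star v ⬝ᵥ (Matrix.vecMulVec h (star h) *ᵥ v) = ((‖star v ⬝ᵥ h‖ ^ 2 : ℝ) : ℂ) := by
  rw [Matrix.vecMulVec_mulVec, dotProduct_smul, ← Complex.normSq_eq_norm_sq,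
    Complex.normSq_eq_conj_mul_self]
  have : star h ⬝ᵥ v = (starRingEnd ℂ) (star v ⬝ᵥ h) := by
    rw [starRingEnd_apply, Matrix.star_dotProduct]
  simp [this, mul_comm]

/-- The quadratic form of the received covariance is signal plus interference plus noise, so
maximizing the ratio is a Rayleigh quotient problem for this matrix. -/
theorem covU_quad (S : System K J L Z M) (u : Receiver J M) (j : Fin J) (x : Point K J L M) :
    (star (u j) ⬝ᵥ (covU S (S.serv j) x *ᵥ u j)).re
      = x.2 j * gainU S j j (u j) + gamU S u j x := by
  have e : star (u j) ⬝ᵥ (covU S (S.serv j) x *ᵥ u j)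
      = (∑ j', ((x.2 j' : ℝ) : ℂ) * ((gainU S j j' (u j) : ℝ) : ℂ))
        + ((iri S (S.serv j) x.1 : ℝ) : ℂ) * (star (u j) ⬝ᵥ u j)
        + ((S.sigU (S.serv j) : ℝ) : ℂ) * (star (u j) ⬝ᵥ u j) := by
    simp only [covU, Matrix.add_mulVec, Matrix.sum_mulVec, Matrix.smul_mulVec, Matrix.one_mulVec,
      dotProduct_add, dotProduct_sum, dotProduct_smul, star_dotProduct_vecMulVec, smul_eq_mul,
      gainU]
  rw [e]
  simp only [Complex.add_re, Complex.re_sum, Complex.re_ofReal_mul, Complex.ofReal_re,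
    dotProduct_star_self_re]
  rw [← Finset.add_sum_erase _ _ (Finset.mem_univ j), gamU]
  ring

theorem mmse_ne_zero (S : System K J L Z M) {x : Point K J L M} (hx : x ∈ cone K J L M) {j : Fin J}
    (hP : 0 < x.2 j) (hh : S.hU j (S.serv j) ≠ 0) : mmse S x j ≠ 0 := by
  rw [mmse_eq]
  have hs : ((Real.sqrt (x.2 j) : ℝ) : ℂ) ≠ 0 := by
    exact_mod_cast (Real.sqrt_pos.2 hP).ne'
  refine smul_ne_zero hs fun h => hh ?_
  have hu := (Matrix.isUnit_iff_isUnit_det _).1 (posDef_covU S (S.serv j) hx).isUnit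
  have : covU S (S.serv j) x *ᵥ ((covU S (S.serv j) x)⁻¹ *ᵥ S.hU j (S.serv j))
      = S.hU j (S.serv j) := by
    rw [Matrix.mulVec_mulVec, Matrix.mul_nonsing_inv _ hu, Matrix.one_mulVec]
  rw [← this, h, Matrix.mulVec_zero]

/-- The MMSE receivers maximize the signal-to-interference-plus-noise ratios. -/
theorem mmse_optimal (S : System K J L Z M) {x : Point K J L M} (hx : x ∈ cone K J L M)
    (u : Receiver J M) {j : Fin J} (hP : 0 < x.2 j) :
    x.2 j * gainU S j j (u j) * gamU S (mmse S x) j x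
      ≤ x.2 j * gainU S j j (mmse S x j) * gamU S u j x := by
  set A := covU S (S.serv j) x with hA
  set h := S.hU j (S.serv j) with hh'
  set w := A⁻¹ *ᵥ h with hw
  have hAp : A.PosDef := posDef_covU S (S.serv j) hx
  have hu := (Matrix.isUnit_iff_isUnit_det _).1 hAp.isUnit
  have hAw : A *ᵥ w = h := by
    rw [hw, Matrix.mulVec_mulVec, Matrix.mul_nonsing_inv _ hu, Matrix.one_mulVec]
  -- Since `A *ᵥ w = h`, Cauchy–Schwarz in the metric of `A` bounds the gain of any receiver by its
  -- total received power times `star w ⬝ᵥ h`. The MMSE receiver is a multiple of `w`, where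
  -- equality holds.
  have hcs := posSemidef_cauchy_schwarz hAp.posSemidef (u j) w
  have hm : mmse S x j = ((Real.sqrt (x.2 j) : ℝ) : ℂ) • w := mmse_eq S x j
  have hsq : ‖((Real.sqrt (x.2 j) : ℝ) : ℂ)‖ ^ 2 = x.2 j := by
    rw [Complex.norm_real, Real.norm_eq_abs, sq_abs, Real.sq_sqrt hP.le]
  have hconj : (starRingEnd ℂ) ((Real.sqrt (x.2 j) : ℝ) : ℂ) * ((Real.sqrt (x.2 j) : ℝ) : ℂ)
      = ((x.2 j : ℝ) : ℂ) := by
    rw [Complex.conj_ofReal, ← Complex.ofReal_mul, Real.mul_self_sqrt hP.le]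
  have hwre : star w ⬝ᵥ h = (((star w ⬝ᵥ h).re : ℝ) : ℂ) := by
    have := hAp.posSemidef.dotProduct_mulVec_nonneg w
    rw [hAw] at this
    exact Complex.ext rfl (by simpa using (Complex.nonneg_iff.1 this).2.symm)
  have hg : gainU S j j (mmse S x j) = x.2 j * (star w ⬝ᵥ h).re ^ 2 := by
    have : gainU S j j (mmse S x j) = ‖star (mmse S x j) ⬝ᵥ h‖ ^ 2 := rfl
    rw [this, hm, star_smul, smul_dotProduct, norm_smul, mul_pow, norm_star, hsq, hwre,
      Complex.norm_real, Real.norm_eq_abs, sq_abs, Complex.ofReal_re]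
  have hT : x.2 j * gainU S j j (mmse S x j) + gamU S (mmse S x) j x
      = x.2 j * (star w ⬝ᵥ h).re := by
    rw [← covU_quad, ← hA, hm, Matrix.mulVec_smul, hAw, star_smul, smul_dotProduct,
      dotProduct_smul, smul_eq_mul, smul_eq_mul, ← mul_assoc]
    rw [← starRingEnd_apply, hconj, Complex.re_ofReal_mul]
  have hTu := covU_quad S u j x
  rw [← hA] at hTu
  rw [hTu, hAw] at hcs
  have hgu : ‖star (u j) ⬝ᵥ h‖ ^ 2 = gainU S j j (u j) := rfl
  rw [hgu] at hcs
  set q := (star w ⬝ᵥ h).re with hq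
  have hq0 : 0 ≤ q := by
    have := hAp.posSemidef.re_dotProduct_nonneg w
    rw [hAw] at this
    exact this
  have hγ : gamU S (mmse S x) j x = x.2 j * q - x.2 j * gainU S j j (mmse S x j) := by linarith
  rw [hγ, hg]
  have := mul_le_mul_of_nonneg_left hcs (by positivity : 0 ≤ x.2 j * x.2 j * q)
  nlinarith

/-- The inverse is the adjugate divided by the determinant, which does not vanish on the cone
because the noise makes the covariance positive definite. -/
theorem continuousOn_mmse (S : System K J L Z M) :
    ContinuousOn (fun x : Point K J L M => mmse S x) (cone K J L M) := by
  rw [continuousOn_pi]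
  intro j
  simp only [mmse_eq]
  have hc : Continuous fun x : Point K J L M => covU S (S.serv j) x := by
    unfold covU
    fun_prop
  have hinv : ContinuousOn (fun x : Point K J L M => (covU S (S.serv j) x)⁻¹)
      (cone K J L M) := by
    simp only [Matrix.inv_def]
    have ha : Continuous fun x : Point K J L M => (covU S (S.serv j) x).adjugate := by fun_prop
    suffices hd : ContinuousOn (fun x : Point K J L M => Ring.inverse (covU S (S.serv j) x).det)
        (cone K J L M) from hd.smul ha.continuousOn
    intro x hx
    have hu := (Matrix.isUnit_iff_isUnit_det _).1 (posDef_covU S (S.serv j) hx).isUnit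
    have hd : ContinuousAt (fun x : Point K J L M => (covU S (S.serv j) x).det) x := by fun_prop
    simp only [Ring.inverse_eq_inv']
    exact (hd.inv₀ hu.ne_zero).continuousWithinAt
  have hs : Continuous fun x : Point K J L M => ((Real.sqrt (x.2 j) : ℝ) : ℂ) := by fun_prop
  refine hs.continuousOn.smul ?_
  have hm : Continuous fun B : Matrix (Fin M) (Fin M) ℂ => B *ᵥ S.hU j (S.serv j) := by fun_prop
  exact hm.comp_continuousOn hinv

theorem power_pos {S : System K J L Z M} {off : Fin L → Fin K → Prop} {u : Receiver J M}
    {x : Point K J L M} (hx : x ∈ convexSet S off u) {j : Fin J} (hu : u j ≠ 0) :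
    0 < x.2 j ∧ S.hU j (S.serv j) ≠ 0 := by
  have h := (mul_pos (rpow_two_sub_one_pos (S.RUmin_pos j)) (S.sigU_pos (S.serv j))).trans_le
    (power_lower hx hu)
  refine ⟨(hx.2.2.1 j).1.lt_of_ne' fun h0 => ?_, fun h0 => ?_⟩
  · simp [h0] at h
  · simp [h0, sqNorm] at h

/-- Points of the convex constraint set stay there when the receivers become MMSE receivers. -/
theorem mem_convexSet_mmse {S : System K J L Z M} {off : Fin L → Fin K → Prop} {u : Receiver J M}
    {x : Point K J L M} (hx : x ∈ convexSet S off u) (hu : ∀ j, u j ≠ 0) :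
    x ∈ convexSet S off (mmse S x) := by
  refine ⟨hx.1, hx.2.1, hx.2.2.1, hx.2.2.2.1, fun j => ?_, hx.2.2.2.2.2⟩
  obtain ⟨hP, hh⟩ := power_pos hx (hu j)
  have hxc := convexSet_subset_cone S off u hx
  have h1 := mmse_optimal S hxc u hP
  have h2 := hx.2.2.2.2.1 j
  have h3 := gamU_pos S j hxc (hu j)
  have h4 := gamU_pos S j hxc (mmse_ne_zero S hxc hP hh)
  have h5 := mul_le_mul_of_nonneg_right (sub_nonpos.1 h2) h4.le
  have h6 : (((2 : ℝ) ^ S.RUmin j - 1) * gamU S (mmse S x) j x) * gamU S u j x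
      ≤ (x.2 j * gainU S j j (mmse S x j)) * gamU S u j x := by linarith
  exact sub_nonpos.2 (le_of_mul_le_mul_right h6 h3)

/-- Receivers enter only the uplink rates, and each of these is increasing in the ratio that the
MMSE receiver maximizes. -/
theorem sumRate_le_mmse {S : System K J L Z M} {off : Fin L → Fin K → Prop} {u : Receiver J M}
    {x : Point K J L M} (hx : x ∈ convexSet S off u) (hu : ∀ j, u j ≠ 0) :
    sumRate S u x ≤ sumRate S (mmse S x) x := by
  refine add_le_add_right (Finset.sum_le_sum fun j _ => ?_) _
  obtain ⟨hP, hh⟩ := power_pos hx (hu j)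
  have hxc := convexSet_subset_cone S off u hx
  have h1 := mmse_optimal S hxc u hP
  have h3 := gamU_pos S j hxc (hu j)
  have h4 := gamU_pos S j hxc (mmse_ne_zero S hxc hP hh)
  have h5 := mul_nonneg hP.le (gainU_nonneg S j j (u j))
  have h6 : 0 ≤ x.2 j * gainU S j j (u j) / gamU S u j x := by positivity
  refine Real.logb_le_logb_of_le (by norm_num) (by positivity) ?_
  have := (div_le_div_iff₀ h3 h4).2 h1
  linarith

/-! ### The surrogate objective -/

/-- The pairs of a point of the cone and receivers without zero receive vectors. -/
def domain (K J L M : ℕ) : Set (Point K J L M × Receiver J M) :=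
  {p | p.1 ∈ cone K J L M ∧ ∀ j, p.2 j ≠ 0}

theorem logb_one_add_div {a g : ℝ} (hg : 0 < g) (h : 0 < a + g) :
    Real.logb 2 (1 + a / g) = Real.logb 2 (a + g) - Real.logb 2 g := by
  rw [← Real.logb_div h.ne' hg.ne']
  congr 1
  field_simp
  ring

theorem sumRate_eq (S : System K J L Z M) {x : Point K J L M} {u : Receiver J M}
    (h : (x, u) ∈ domain K J L M) : sumRate S u x = fPart S u x - hPart S u x := by
  unfold sumRate fPart hPart rateD rateU
  rw [add_sub_add_comm, ← Finset.sum_sub_distrib, ← Finset.sum_sub_distrib]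
  congr 1
  · exact Finset.sum_congr rfl fun k _ => logb_one_add_div (gamD_pos S k h.1)
      (add_pos_of_nonneg_of_pos (quadD_nonneg S k (h.1.1 k)) (gamD_pos S k h.1))
  · exact Finset.sum_congr rfl fun j _ => logb_one_add_div (gamU_pos S j h.1 (h.2 j))
      (add_pos_of_nonneg_of_pos (mul_nonneg (h.1.2 j) (gainU_nonneg _ _ _ _))
        (gamU_pos S j h.1 (h.2 j)))

/-- The surrogate objective as a function of the expansion point and the receivers. -/
def surr (S : System K J L Z M) (p : Point K J L M × Receiver J M) (x : Point K J L M) : ℝ :=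
  fPart S p.2 x - (hPart S p.2 p.1
    + (∑ k, (gamD S k p.1)⁻¹ / Real.log 2 * (gamD S k x - gamD S k p.1))
    + ∑ j, (gamU S p.2 j p.1)⁻¹ / Real.log 2 * (gamU S p.2 j x - gamU S p.2 j p.1))

/-- Increments of the affine interferences are exactly the linear terms in `hLin`. In this form the
surrogate depends on the state only through the point and the receivers, as needed for passing to
limits. -/
theorem surrogate_eq (S : System K J L Z M) (s : State K J L M) (x : Point K J L M) :
    surrogate S s x = surr S (s.x, s.u) x := by
  have e1 : ∀ k, gamD S k x - gamD S k s.x = (∑ j, (x.2 j - s.x.2 j) * ‖S.hIUI j k‖ ^ 2)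
      + ∑ k' ∈ Finset.univ.erase k, quadD S k (x.1 k' - s.x.1 k') := by
    intro k
    have := gamDL_apply S k (x - s.x)
    rw [map_sub] at this
    rw [gamD_eq, gamD_eq, add_sub_add_right_eq_sub, this]
    rfl
  have e2 : ∀ j, gamU S s.u j x - gamU S s.u j s.x
      = (∑ j' ∈ Finset.univ.erase j, (x.2 j' - s.x.2 j') * gainU S j j' (s.u j))
        + sqNorm (s.u j) * iri S (S.serv j) (fun k => x.1 k - s.x.1 k) := by
    intro j
    have := gamUL_apply S s.u j (x - s.x)
    rw [map_sub] at this
    rw [gamU_eq, gamU_eq, add_sub_add_right_eq_sub, this]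
    rfl
  simp only [surrogate, surr, hLin, e1, e2]

theorem surr_self (S : System K J L Z M) {x : Point K J L M} {u : Receiver J M}
    (h : (x, u) ∈ domain K J L M) : surr S (x, u) x = sumRate S u x := by
  rw [sumRate_eq S h]
  simp [surr]

theorem logb_le_tangent {g g₀ : ℝ} (hg : 0 < g) (hg₀ : 0 < g₀) :
    Real.logb 2 g ≤ Real.logb 2 g₀ + g₀⁻¹ / Real.log 2 * (g - g₀) := by
  have hl : 0 < Real.log 2 := Real.log_pos (by norm_num)
  have h := Real.log_le_sub_one_of_pos (div_pos hg hg₀)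
  rw [Real.log_div hg.ne' hg₀.ne'] at h
  have e : g₀⁻¹ / Real.log 2 * (g - g₀) = (g / g₀ - 1) / Real.log 2 := by
    field_simp
  rw [e, Real.logb, Real.logb, ← add_div]
  exact div_le_div_of_nonneg_right (by linarith) hl.le

/-- The tangent of the concave `hPart` lies above it, and it is subtracted. -/
theorem surr_le_sumRate (S : System K J L Z M) {x y : Point K J L M} {u : Receiver J M}
    (hx : x ∈ cone K J L M) (h : (y, u) ∈ domain K J L M) :
    surr S (x, u) y ≤ sumRate S u y := by
  rw [sumRate_eq S h]
  have h1 : ∑ k, Real.logb 2 (gamD S k y) ≤ ∑ k, (Real.logb 2 (gamD S k x)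
      + (gamD S k x)⁻¹ / Real.log 2 * (gamD S k y - gamD S k x)) :=
    Finset.sum_le_sum fun k _ => logb_le_tangent (gamD_pos S k h.1) (gamD_pos S k hx)
  have h2 : ∑ j, Real.logb 2 (gamU S u j y) ≤ ∑ j, (Real.logb 2 (gamU S u j x)
      + (gamU S u j x)⁻¹ / Real.log 2 * (gamU S u j y - gamU S u j x)) :=
    Finset.sum_le_sum fun j _ => logb_le_tangent (gamU_pos S j h.1 (h.2 j))
      (gamU_pos S j hx (h.2 j))
  rw [Finset.sum_add_distrib] at h1 h2
  simp only [surr, hPart]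
  linarith

/-! ### Continuity of the objective and of the surrogate -/

theorem continuousAt_logb {X : Type*} [TopologicalSpace X] {f : X → ℝ} {a : X}
    (hf : ContinuousAt f a) (h : f a ≠ 0) : ContinuousAt (fun x => Real.logb 2 (f x)) a := by
  unfold Real.logb
  exact (hf.log h).div_const _

theorem continuousAt_fPart (S : System K J L Z M) {p : Point K J L M × Receiver J M}
    (hp : p ∈ domain K J L M) :
    ContinuousAt (fun p : Point K J L M × Receiver J M => fPart S p.2 p.1) p := by
  unfold fPart
  refine ContinuousAt.add (tendsto_finsetSum _ fun k _ => ?_) (tendsto_finsetSum _ fun j _ => ?_)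
  · refine continuousAt_logb (Continuous.continuousAt (by fun_prop)) ?_
    exact (add_pos_of_nonneg_of_pos (quadD_nonneg S k (hp.1.1 k)) (gamD_pos S k hp.1)).ne'
  · refine continuousAt_logb ((continuous_sigU S j).add (continuous_gamU S j)).continuousAt ?_
    exact (add_pos_of_nonneg_of_pos (mul_nonneg (hp.1.2 j) (gainU_nonneg _ _ _ _))
      (gamU_pos S j hp.1 (hp.2 j))).ne'

theorem continuousAt_hPart (S : System K J L Z M) {p : Point K J L M × Receiver J M}
    (hp : p ∈ domain K J L M) :
    ContinuousAt (fun p : Point K J L M × Receiver J M => hPart S p.2 p.1) p := by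
  unfold hPart
  refine ContinuousAt.add (tendsto_finsetSum _ fun k _ => ?_) (tendsto_finsetSum _ fun j _ => ?_)
  · exact continuousAt_logb (Continuous.continuousAt (by fun_prop)) (gamD_pos S k hp.1).ne'
  · exact continuousAt_logb (continuous_gamU S j).continuousAt (gamU_pos S j hp.1 (hp.2 j)).ne'

theorem continuousAt_rateD (S : System K J L Z M) {x : Point K J L M} (hx : x ∈ cone K J L M)
    (k : Fin K) : ContinuousAt (fun x : Point K J L M => rateD S k x) x := by
  unfold rateD
  have h1 := gamD_pos S k hx
  have h2 := quadD_nonneg S k (hx.1 k)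
  refine continuousAt_logb (continuousAt_const.add (ContinuousAt.div ?_ ?_ h1.ne')) ?_
  · exact Continuous.continuousAt (by fun_prop)
  · exact Continuous.continuousAt (by fun_prop)
  · positivity

theorem continuousAt_sumRate (S : System K J L Z M) {p : Point K J L M × Receiver J M}
    (hp : p ∈ domain K J L M) :
    ContinuousAt (fun p : Point K J L M × Receiver J M => sumRate S p.2 p.1) p := by
  unfold sumRate
  refine ContinuousAt.add (tendsto_finsetSum _ fun k _ => ?_) (tendsto_finsetSum _ fun j _ => ?_)
  · exact ContinuousAt.comp (f := Prod.fst) (continuousAt_rateD S hp.1 k) continuousAt_fst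
  · have h1 := gamU_pos S j hp.1 (hp.2 j)
    have h2 := mul_nonneg (hp.1.2 j) (gainU_nonneg S j j (p.2 j))
    unfold rateU
    refine continuousAt_logb (continuousAt_const.add (ContinuousAt.div
      (continuous_sigU S j).continuousAt (continuous_gamU S j).continuousAt h1.ne')) ?_
    positivity

theorem continuousAt_surr_left (S : System K J L Z M) {p : Point K J L M × Receiver J M}
    (hp : p ∈ domain K J L M) {x : Point K J L M} (hx : x ∈ cone K J L M) :
    ContinuousAt (fun p : Point K J L M × Receiver J M => surr S p x) p := by
  unfold surr
  have hj : Continuous fun p : Point K J L M × Receiver J M => (x, p.2) := by fun_prop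
  have hf : ContinuousAt (fun p : Point K J L M × Receiver J M => fPart S p.2 x) p :=
    ContinuousAt.comp (f := fun p : Point K J L M × Receiver J M => (x, p.2))
      (g := fun p : Point K J L M × Receiver J M => fPart S p.2 p.1)
      (continuousAt_fPart S (p := (x, p.2)) ⟨hx, hp.2⟩) hj.continuousAt
  refine hf.sub (ContinuousAt.add (ContinuousAt.add (continuousAt_hPart S hp)
    (tendsto_finsetSum _ fun k _ => ?_)) (tendsto_finsetSum _ fun j _ => ?_))
  · have hg : ContinuousAt (fun p : Point K J L M × Receiver J M => gamD S k p.1) p :=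
      Continuous.continuousAt (by fun_prop)
    exact ((hg.inv₀ (gamD_pos S k hp.1).ne').div_const _).mul (continuousAt_const.sub hg)
  · have hg := (continuous_gamU S j).continuousAt (x := p)
    have hg' : ContinuousAt (fun p : Point K J L M × Receiver J M => gamU S p.2 j x) p :=
      ((continuous_gamU S j).comp hj).continuousAt
    exact ((hg.inv₀ (gamU_pos S j hp.1 (hp.2 j)).ne').div_const _).mul (hg'.sub hg)

theorem continuousAt_surr_right (S : System K J L Z M) (x₀ : Point K J L M) {u : Receiver J M}
    {x : Point K J L M} (h : (x, u) ∈ domain K J L M) :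
    ContinuousAt (fun x : Point K J L M => surr S (x₀, u) x) x := by
  unfold surr
  have hf : ContinuousAt (fun x : Point K J L M => fPart S u x) x :=
    ContinuousAt.comp (f := fun x : Point K J L M => (x, u))
      (g := fun p : Point K J L M × Receiver J M => fPart S p.2 p.1)
      (continuousAt_fPart S h) (Continuous.continuousAt (by fun_prop))
  exact hf.sub (Continuous.continuousAt (by fun_prop))

/-! ### A common form of both stages -/

/-- The backhaul part of a stage of the algorithm: the switched-off links, the link weights, and a
majorant `c ρ₀ t₀ ρ t` of the load `w t * ρ` of a link that is exact to first order at
`(ρ₀, t₀)`. -/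
structure Scheme (K L : ℕ) where
  /-- the switched-off links at a point, depending on their traces -/
  off : Fin L → Fin K → ℝ → Prop
  /-- the link weights -/
  w : Fin L → Fin K → ℝ → ℝ
  /-- the derivatives of the link weights -/
  wd : Fin L → Fin K → ℝ → ℝ
  /-- the majorants of the link loads -/
  c : Fin L → Fin K → ℝ → ℝ → ℝ → ℝ → ℝ
  off_trans : ∀ {l k t₀ t}, (off l k t₀ → t = 0) → off l k t → t = 0
  off_lim : ∀ {l k} {F : Filter ℕ} {τ : ℕ → ℝ} {t₀ : ℝ}, Tendsto τ F (𝓝 t₀) → ¬ off l k t₀ →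
    ∀ᶠ n in F, ¬ off l k (τ n)
  off_closed : ∀ {l k} {F : Filter ℕ} [F.NeBot] {τ : ℕ → ℝ} {t₀ : ℝ}, Tendsto τ F (𝓝 t₀) →
    (∀ᶠ n in F, off l k (τ n) → τ n = 0) → off l k t₀ → t₀ = 0
  w_nonneg : ∀ l k {t}, 0 ≤ t → 0 ≤ w l k t
  w_deriv : ∀ l k t, HasDerivAt (w l k) (wd l k t) t
  -- The uniform lower bound `ω` turns the backhaul capacity into an upper bound for `ρ`.
  w_pos : ∀ t₁, 0 < t₁ → ∃ ω, 0 < ω ∧ ∀ l k t₀ t, ¬ off l k t₀ → t₁ ≤ t → ω ≤ w l k t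
  wd_zero : ∀ {l k t t'}, w l k t = 0 → (off l k t → t' = 0) → wd l k t * t' = 0
  le_c : ∀ {l k ρ₀ t₀ ρ t}, 0 < ρ₀ → 0 < ρ → 0 ≤ t₀ → 0 ≤ t → (off l k t₀ → t = 0) →
    w l k t * ρ ≤ c l k ρ₀ t₀ ρ t
  c_self : ∀ {l k ρ₀ t₀}, 0 < ρ₀ → 0 ≤ t₀ → c l k ρ₀ t₀ ρ₀ t₀ = w l k t₀ * ρ₀
  c_mono : ∀ {l k ρ₀ t₀ t}, 0 < ρ₀ → Monotone fun ρ => c l k ρ₀ t₀ ρ t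
  c_cont : ∀ {l k ρ₀ t₀}, 0 < ρ₀ → Continuous fun p : ℝ × ℝ => c l k ρ₀ t₀ p.1 p.2
  -- The trace `t` of the test point stays fixed while the expansion data converge. At a link
  -- switched off in the limit this is required only for `t = 0`, since a first-stage expansion need
  -- not converge for other `t`.
  c_lim : ∀ {l k} {F : Filter ℕ} {ρ₀ τ₀ r : ℕ → ℝ} {ρ t₀ r' t : ℝ}, Tendsto ρ₀ F (𝓝 ρ) → 0 < ρ →
    (∀ᶠ n in F, 0 ≤ τ₀ n) → Tendsto τ₀ F (𝓝 t₀) → 0 ≤ t₀ → Tendsto r F (𝓝 r') →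
    (off l k t₀ → t = 0) →
    Tendsto (fun n => c l k (ρ₀ n) (τ₀ n) (r n) t) F (𝓝 (c l k ρ t₀ r' t))
  c_zero : ∀ {l k ρ₀ t₀ ρ t}, 0 ≤ t₀ → w l k t₀ = 0 → c l k ρ₀ t₀ ρ t = 0
  c_strict : ∀ {l k ρ₀ t₀ ρ}, 0 < ρ₀ → 0 ≤ t₀ → 0 < w l k t₀ → ρ < ρ₀ →
    c l k ρ₀ t₀ ρ t₀ < w l k t₀ * ρ₀
  c_deriv : ∀ {l k t₀ t' ρ'} {r : ℝ → ℝ}, 0 < r 0 → 0 ≤ t₀ → 0 < w l k t₀ →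
    HasDerivAt r ρ' 0 →
    HasDerivAt (fun ε => c l k (r 0) t₀ (r ε) (t₀ + ε * t')) (wd l k t₀ * t' * r 0 + w l k t₀ * ρ') 0

namespace Scheme

/-- The links that are switched off in the subproblem at the point `x`. -/
def offOf (A : Scheme K L) (x : Point K J L M) : Fin L → Fin K → Prop :=
  fun l k => A.off l k (trT (x.1 k) l)

/-- Feasibility for the subproblem at the state `s`. -/
def Feas (A : Scheme K L) (S : System K J L Z M) (s : State K J L M) (v : Vars K J L M) : Prop :=
  v.x ∈ convexSet S (A.offOf s.x) s.u ∧ RateBound S s v ∧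
    ∀ l, ∑ k, A.c l k (s.ρ k) (trT (s.x.1 k) l) (v.ρ k) (trT (v.x.1 k) l) ≤ S.C l

/-- Runs of the algorithm. -/
def IsRun (A : Scheme K L) (S : System K J L Z M) (s : ℕ → State K J L M) : Prop :=
  IsInit (s 0) ∧ ∀ n, A.Feas S (s n) (s (n + 1)).toVars ∧
    (∀ v, A.Feas S (s n) v → surrogate S (s n) v.x ≤ surrogate S (s n) (s (n + 1)).x) ∧
    IsUpdate S (s (n + 1))

end Scheme

/-! ### Elimination of the auxiliary variables -/

/-- The smallest admissible upper bound of the rate of a downlink user with signal power `a` and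
interference `g`, for the parameters `ρ₀` and `φ`. -/
def rbound (ρ₀ φ g a : ℝ) : ℝ :=
  max 0 (ρ₀ + ((1 + (1 / (2 * φ) * (1 / g) ^ 2 + φ / 2 * a ^ 2)) / (2 : ℝ) ^ ρ₀ - 1) / Real.log 2)

/-- The smallest admissible rate bounds at the state `s` for the point `x`. -/
def rmin (S : System K J L Z M) (s : State K J L M) (k : Fin K) (x : Point K J L M) : ℝ :=
  rbound (s.ρ k) (s.φ k) (gamD S k x) (quadD S k (x.1 k))

/-- After linearization the rate constraint is affine in `ρ` with positive slope, so it can be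
solved for `ρ`. -/
theorem rbound_aux {ρ₀ q ρ : ℝ} :
    ρ₀ + ((1 + q) / (2 : ℝ) ^ ρ₀ - 1) / Real.log 2 ≤ ρ ↔
      q ≤ (2 : ℝ) ^ ρ₀ * (Real.log 2 * (ρ - ρ₀) + 1) - 1 := by
  have hl : 0 < Real.log 2 := Real.log_pos (by norm_num)
  have h2 : (0 : ℝ) < 2 ^ ρ₀ := by positivity
  rw [← le_sub_iff_add_le', div_le_iff₀ hl, sub_le_iff_le_add, div_le_iff₀ h2]
  constructor <;> intro h <;> nlinarith

/-- The left side of the rate constraint increases with `μ > 0`, so the least admissible `μ`, the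
reciprocal of the interference, gives the weakest demand on `ρ`. -/
theorem rmin_le {S : System K J L Z M} {s : State K J L M} {v : Vars K J L M}
    (hφ : ∀ k, 0 < s.φ k) (hv : v.x ∈ cone K J L M) (h : RateBound S s v) (k : Fin K) :
    rmin S s k v.x ≤ v.ρ k := by
  obtain ⟨h1, h2, h3, h4⟩ := h k
  refine max_le h1 (rbound_aux.2 (le_trans ?_ h4))
  have hg := gamD_pos S k hv
  have h5 : 1 / gamD S k v.x ≤ v.μ k := (one_div_le hg h2).2 h3
  have h6 : 0 ≤ 1 / gamD S k v.x := by positivity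
  have := hφ k
  gcongr

theorem rateBound_rmin {S : System K J L Z M} {s : State K J L M} {x : Point K J L M}
    (hx : x ∈ cone K J L M) :
    RateBound S s ⟨x, fun k => rmin S s k x, fun k => 1 / gamD S k x⟩ := by
  intro k
  have hg := gamD_pos S k hx
  exact ⟨le_max_left _ _, by positivity, by simp, rbound_aux.1 (le_max_right _ _)⟩

/-- Feasibility of a point for the subproblem at `s` after elimination of the other variables. -/
def Scheme.RFeas (A : Scheme K L) (S : System K J L Z M) (s : State K J L M)
    (x : Point K J L M) : Prop :=
  x ∈ convexSet S (A.offOf s.x) s.u ∧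
    ∀ l, ∑ k, A.c l k (s.ρ k) (trT (s.x.1 k) l) (rmin S s k x) (trT (x.1 k) l) ≤ S.C l

/-- The load majorants are monotone in `ρ`, so lowering the rate bounds to `rmin` preserves the
backhaul constraints. -/
theorem Scheme.Feas.rfeas {A : Scheme K L} {S : System K J L Z M} {s : State K J L M}
    {v : Vars K J L M} (h : A.Feas S s v) (hs : IsInit s) : A.RFeas S s v.x := by
  obtain ⟨h1, h2, h3⟩ := h
  refine ⟨h1, fun l => le_trans (Finset.sum_le_sum fun k _ => ?_) (h3 l)⟩
  exact A.c_mono (hs.2.2.1 k) (rmin_le hs.2.2.2.1 (convexSet_subset_cone S _ _ h1) h2 k)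

theorem Scheme.RFeas.feas {A : Scheme K L} {S : System K J L Z M} {s : State K J L M}
    {x : Point K J L M} (h : A.RFeas S s x) :
    A.Feas S s ⟨x, fun k => rmin S s k x, fun k => 1 / gamD S k x⟩ :=
  ⟨h.1, rateBound_rmin (convexSet_subset_cone S _ _ h.1), h.2⟩

/-- Joint continuity is used twice: with a moving point for existence of maximizers, and with moving
parameters `ρ₀`, `φ` for the limiting subproblem. -/
theorem continuousAt_rbound {X : Type*} [TopologicalSpace X] {ρ₀ φ g a : X → ℝ} {x : X}
    (hρ : ContinuousAt ρ₀ x) (hφ : ContinuousAt φ x) (hg : ContinuousAt g x)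
    (ha : ContinuousAt a x) (hφ0 : φ x ≠ 0) (hg0 : g x ≠ 0) :
    ContinuousAt (fun y => rbound (ρ₀ y) (φ y) (g y) (a y)) x := by
  unfold rbound
  have h2 : ContinuousAt (fun y => (2 : ℝ) ^ ρ₀ y) x :=
    ContinuousAt.rpow continuousAt_const hρ (Or.inl two_ne_zero)
  have h2' : (2 : ℝ) ^ ρ₀ x ≠ 0 := by positivity
  refine continuousAt_const.max (hρ.add (((ContinuousAt.div (continuousAt_const.add
    (ContinuousAt.add ?_ ?_)) h2 h2').sub continuousAt_const).div_const _))
  · exact (continuousAt_const.div (continuousAt_const.mul hφ) (mul_ne_zero two_ne_zero hφ0)).mul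
      ((continuousAt_const.div hg hg0).pow 2)
  · exact (hφ.div_const _).mul (ha.pow 2)

theorem continuousAt_rmin {S : System K J L Z M} {s : State K J L M} (hφ : ∀ k, 0 < s.φ k)
    {x : Point K J L M} (hx : x ∈ cone K J L M) (k : Fin K) :
    ContinuousAt (fun x => rmin S s k x) x :=
  continuousAt_rbound continuousAt_const continuousAt_const
    (Continuous.continuousAt (by fun_prop)) (Continuous.continuousAt (by fun_prop))
    (hφ k).ne' (gamD_pos S k hx).ne'

/-- A feasible subproblem has an optimal solution. -/
theorem Scheme.exists_maximizer (A : Scheme K L) (S : System K J L Z M) {s : State K J L M}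
    (hs : IsInit s) (h : ∃ v, A.Feas S s v) :
    ∃ v, A.Feas S s v ∧ ∀ v', A.Feas S s v' → surrogate S s v'.x ≤ surrogate S s v.x := by
  have hcs := isCompact_convexSet S (A.offOf s.x) s.u
  have hcont : ContinuousOn (fun x l => ∑ k, A.c l k (s.ρ k) (trT (s.x.1 k) l) (rmin S s k x)
      (trT (x.1 k) l)) (convexSet S (A.offOf s.x) s.u) := by
    refine continuousOn_pi.2 fun l => continuousOn_finsetSum _ fun k _ => fun x hx => ?_
    have hr := continuousAt_rmin (S := S) hs.2.2.2.1 (convexSet_subset_cone S _ _ hx) k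
    have ht : ContinuousAt (fun x : Point K J L M => trT (x.1 k) l) x :=
      Continuous.continuousAt (by fun_prop)
    have hc := (A.c_cont (l := l) (k := k) (t₀ := trT (s.x.1 k) l)
      (hs.2.2.1 k)).continuousAt (x := (rmin S s k x, trT (x.1 k) l))
    exact (ContinuousAt.comp (f := fun x : Point K J L M => (rmin S s k x, trT (x.1 k) l))
      (g := fun p : ℝ × ℝ => A.c l k (s.ρ k) (trT (s.x.1 k) l) p.1 p.2)
      hc (hr.prodMk ht)).continuousWithinAt
  -- After elimination only the point varies, in a compact convex set; the open condition on `μ` no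
  -- longer interferes with compactness.
  have hR : IsCompact {x | A.RFeas S s x} := by
    refine hcs.of_isClosed_subset ?_ fun x hx => hx.1
    exact hcont.preimage_isClosed_of_isClosed hcs.isClosed (isClosed_Iic (a := S.C))
  obtain ⟨v₀, hv₀⟩ := h
  have hso : ContinuousOn (fun x => surrogate S s x) {x | A.RFeas S s x} := by
    intro x hx
    simp only [surrogate_eq]
    exact (continuousAt_surr_right S s.x
      ⟨convexSet_subset_cone S _ _ hx.1, hs.2.2.2.2⟩).continuousWithinAt
  obtain ⟨x, hx, hmax⟩ := hR.exists_isMaxOn ⟨v₀.x, hv₀.rfeas hs⟩ hso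
  exact ⟨_, Scheme.RFeas.feas hx, fun v' hv' => hmax (hv'.rfeas hs)⟩

/-! ### Invariants of a run -/

namespace Scheme

variable {A : Scheme K L} {S : System K J L Z M}

/-- The properties of all states of a run after the initial one. -/
structure Good (A : Scheme K L) (S : System K J L Z M) (s : State K J L M) : Prop where
  init : IsInit s
  mem : s.x ∈ convexSet S (A.offOf s.x) s.u
  mmse_eq : s.u = mmse S s.x
  φ_eq : ∀ k, s.φ k = s.μ k / quadD S k (s.x.1 k)
  μ_pos : ∀ k, 0 < s.μ k
  μ_ge : ∀ k, 1 / gamD S k s.x ≤ s.μ k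
  -- This is the original nonconvex constraint; unlike its convexification it does not refer to an
  -- earlier state.
  ρ_ge : ∀ k, s.μ k * quadD S k (s.x.1 k) ≤ (2 : ℝ) ^ s.ρ k - 1
  load_le : ∀ l, ∑ k, A.w l k (trT (s.x.1 k) l) * s.ρ k ≤ S.C l
  power_ge : ∀ j, ((2 : ℝ) ^ S.RUmin j - 1) * S.sigU (S.serv j)
    ≤ s.x.2 j * sqNorm (S.hU j (S.serv j))

/-- A convex function lies above its tangent. -/
theorem two_rpow_ge {ρ ρ₀ : ℝ} :
    (2 : ℝ) ^ ρ₀ * (Real.log 2 * (ρ - ρ₀) + 1) ≤ (2 : ℝ) ^ ρ := by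
  have h := Real.add_one_le_exp (Real.log 2 * (ρ - ρ₀))
  have e : (2 : ℝ) ^ ρ = (2 : ℝ) ^ ρ₀ * Real.exp (Real.log 2 * (ρ - ρ₀)) := by
    rw [← Real.rpow_def_of_pos two_pos, ← Real.rpow_add two_pos]
    congr 1
    ring
  rw [e]
  exact mul_le_mul_of_nonneg_left h (by positivity)

/-- The gap is the square `(μ - φ * a) ^ 2 / (2 * φ)`, which vanishes for `φ = μ / a`; this explains
the update of `φ`. -/
theorem mul_le_young {φ μ a : ℝ} (hφ : 0 < φ) : μ * a ≤ 1 / (2 * φ) * μ ^ 2 + φ / 2 * a ^ 2 := by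
  have e : 1 / (2 * φ) * μ ^ 2 + φ / 2 * a ^ 2 - μ * a = (μ - φ * a) ^ 2 / (2 * φ) := by
    field_simp
    ring
  have : 0 ≤ (μ - φ * a) ^ 2 / (2 * φ) := by positivity
  linarith

/-- The convexified constraints imply the true ones, and the receiver update preserves the uplink
QoS. The QoS bounds also keep the new `φ` positive and the receivers nonzero, so the next subproblem
is well defined. -/
theorem Feas.good {s s' : State K J L M} (hs : IsInit s) (h : A.Feas S s s'.toVars)
    (hu : IsUpdate S s') : A.Good S s' := by
  obtain ⟨h1, h2, h3⟩ := h
  have hc := convexSet_subset_cone S _ _ h1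
  have ha := quadD_pos h1
  have hμ : ∀ k, 0 < s'.μ k := fun k => (h2 k).2.1
  have hρ : ∀ k, s'.μ k * quadD S k (s'.x.1 k) ≤ (2 : ℝ) ^ s'.ρ k - 1 := by
    intro k
    have h4 := (mul_le_young (hs.2.2.2.1 k)).trans (h2 k).2.2.2
    have := two_rpow_ge (ρ := s'.ρ k) (ρ₀ := s.ρ k)
    linarith
  have hρ0 : ∀ k, 0 < s'.ρ k := by
    intro k
    refine (h2 k).1.lt_of_ne' fun h0 => ?_
    have := hρ k
    have h5 := mul_pos (hμ k) (ha k)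
    rw [h0] at this
    simp only [Real.rpow_zero, sub_self] at this
    linarith
  have hne : ∀ j, s'.u j ≠ 0 := by
    intro j
    rw [hu.2]
    obtain ⟨hP, hh⟩ := power_pos h1 (hs.2.2.2.2 j)
    exact mmse_ne_zero S hc hP hh
  refine ⟨⟨hc.1, hc.2, hρ0, fun k => ?_, hne⟩, ?_, hu.2, hu.1, hμ, fun k => ?_, hρ, fun l => ?_,
    fun j => power_lower h1 (hs.2.2.2.2 j)⟩
  · rw [hu.1]
    exact div_pos (hμ k) (ha k)
  · rw [hu.2]
    have := mem_convexSet_mmse h1 hs.2.2.2.2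
    exact ⟨this.1, this.2.1, this.2.2.1, this.2.2.2.1, this.2.2.2.2.1, fun l k hlk =>
      A.off_trans (h1.2.2.2.2.2 l k) hlk⟩
  · exact (one_div_le (gamD_pos S k hc) (hμ k)).2 (h2 k).2.2.1
  · refine (Finset.sum_le_sum fun k _ => ?_).trans (h3 l)
    exact A.le_c (hs.2.2.1 k) (hρ0 k) (trT_nonneg (hs.1 k) l) (trT_nonneg (hc.1 k) l)
      (h1.2.2.2.2.2 l k)

/-- All approximations are exact at their expansion point, so a state is a candidate in its own
subproblem. Both monotonicity and the absence of breakdown rest on this. -/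
theorem Good.feas {s : State K J L M} (h : A.Good S s) : A.Feas S s s.toVars := by
  refine ⟨h.mem, fun k => ⟨(h.init.2.2.1 k).le, h.μ_pos k, ?_, ?_⟩, fun l => ?_⟩
  · have hg := gamD_pos S k (convexSet_subset_cone S _ _ h.mem)
    exact (one_div_le (h.μ_pos k) hg).2 (h.μ_ge k)
  · refine le_trans (le_of_eq ?_) ((h.ρ_ge k).trans (by simp))
    have ha := quadD_pos h.mem k
    have hμ := h.μ_pos k
    rw [h.φ_eq k]
    field_simp
    ring
  · refine le_trans (le_of_eq (Finset.sum_congr rfl fun k _ => ?_)) (h.load_le l)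
    exact A.c_self (h.init.2.2.1 k) (trT_nonneg (h.init.1 k) l)

theorem Good.domain {s : State K J L M} (h : A.Good S s) : (s.x, s.u) ∈ domain K J L M :=
  ⟨convexSet_subset_cone S _ _ h.mem, h.init.2.2.2.2⟩

/-- The iteration never breaks down. -/
theorem exists_run {s₀ : State K J L M} (h₀ : IsInit s₀) (hf : ∃ v, A.Feas S s₀ v) :
    ∃ s, A.IsRun S s ∧ s 0 = s₀ := by
  have step : ∀ s : {s : State K J L M // IsInit s ∧ ∃ v, A.Feas S s v},
      ∃ s' : {s : State K J L M // IsInit s ∧ ∃ v, A.Feas S s v},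
        A.Feas S s.1 s'.1.toVars ∧
        (∀ v, A.Feas S s.1 v → surrogate S s.1 v.x ≤ surrogate S s.1 s'.1.x) ∧
        IsUpdate S s'.1 := by
    rintro ⟨s, hs, hv⟩
    obtain ⟨v, hv, hmax⟩ := A.exists_maximizer S hs hv
    let s' : State K J L M :=
      { v with φ := fun k => v.μ k / quadD S k (v.x.1 k), u := mmse S v.x }
    have hu : IsUpdate S s' := ⟨fun _ => rfl, rfl⟩
    have hg : A.Good S s' := Feas.good (s' := s') hs hv hu
    exact ⟨⟨s', hg.init, _, hg.feas⟩, hv, hmax, hu⟩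
  choose next hnext using step
  let σ : ℕ → {s : State K J L M // IsInit s ∧ ∃ v, A.Feas S s v} :=
    fun n => Nat.rec ⟨s₀, h₀, hf⟩ (fun _ s => next s) n
  exact ⟨fun n => (σ n).1, ⟨h₀, fun n => hnext (σ n)⟩, rfl⟩

theorem IsRun.isInit {s : ℕ → State K J L M} (h : A.IsRun S s) (n : ℕ) : IsInit (s n) := by
  induction n with
  | zero => exact h.1
  | succ n ih => exact (Feas.good ih (h.2 n).1 (h.2 n).2.2).init

theorem IsRun.good {s : ℕ → State K J L M} (h : A.IsRun S s) (n : ℕ) : A.Good S (s (n + 1)) :=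
  Feas.good (h.isInit n) (h.2 n).1 (h.2 n).2.2

end Scheme

/-! ### Convergence of the objective values -/

/-- A compact set containing all iterates of a run after the initial one. -/
def trap (S : System K J L Z M) : Set (Point K J L M) :=
  {x | x ∈ budgetSet S ∧ ∀ j, ((2 : ℝ) ^ S.RUmin j - 1) * S.sigU (S.serv j)
    ≤ x.2 j * sqNorm (S.hU j (S.serv j))}

theorem trap_subset_cone (S : System K J L Z M) : trap S ⊆ cone K J L M :=
  fun _ hx => ⟨hx.1.2.1, fun j => (hx.1.2.2 j).1⟩

theorem isCompact_trap (S : System K J L Z M) : IsCompact (trap S) := by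
  have : trap S = budgetSet S ∩ ⋂ j, {x | ((2 : ℝ) ^ S.RUmin j - 1) * S.sigU (S.serv j)
      ≤ x.2 j * sqNorm (S.hU j (S.serv j))} := by
    ext x
    simp [trap]
  rw [this]
  exact (isCompact_budgetSet S).inter_right
    (isClosed_iInter fun j => isClosed_le (by fun_prop) (by fun_prop))

theorem mem_domain_of_mem_trap (S : System K J L Z M) {x : Point K J L M} (hx : x ∈ trap S) :
    (x, mmse S x) ∈ domain K J L M := by
  have hc := trap_subset_cone S hx
  refine ⟨hc, fun j => ?_⟩
  have h := (mul_pos (rpow_two_sub_one_pos (S.RUmin_pos j)) (S.sigU_pos (S.serv j))).trans_le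
    (hx.2 j)
  refine mmse_ne_zero S hc ((hx.1.2.2 j).1.lt_of_ne' fun h0 => ?_) fun h0 => ?_
  · simp [h0] at h
  · simp [h0, sqNorm] at h

/-- The points of the trap with their MMSE receivers. -/
def trapGraph (S : System K J L Z M) : Set (Point K J L M × Receiver J M) :=
  (fun x => (x, mmse S x)) '' trap S

/-- The receivers need no bound of their own: they are a continuous function of a point in a compact
set. -/
theorem isCompact_trapGraph (S : System K J L Z M) : IsCompact (trapGraph S) :=
  (isCompact_trap S).image_of_continuousOn
    (continuousOn_id.prodMk ((continuousOn_mmse S).mono (trap_subset_cone S)))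

theorem trapGraph_subset_domain (S : System K J L Z M) : trapGraph S ⊆ domain K J L M := by
  rintro _ ⟨x, hx, rfl⟩
  exact mem_domain_of_mem_trap S hx

namespace Scheme

variable {A : Scheme K L} {S : System K J L Z M} {s : ℕ → State K J L M}

theorem Good.mem_trapGraph {s : State K J L M} (h : A.Good S s) : (s.x, s.u) ∈ trapGraph S :=
  ⟨s.x, ⟨convexSet_subset_budgetSet S _ _ h.mem, h.power_ge⟩, by rw [h.mmse_eq]⟩

/-- The surrogate is a minorant for the old receivers, and the MMSE update can only raise the sum
rate. -/
theorem IsRun.surrogate_le (h : A.IsRun S s) (n : ℕ) :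
    surrogate S (s n) (s (n + 1)).x ≤ sumRate S (s (n + 1)).u (s (n + 1)).x := by
  have hn := h.isInit n
  have hm := (h.2 n).1.1
  rw [surrogate_eq, (h.good n).mmse_eq]
  exact (surr_le_sumRate S ⟨hn.1, hn.2.1⟩ ⟨convexSet_subset_cone S _ _ hm, hn.2.2.2.2⟩).trans
    (sumRate_le_mmse hm hn.2.2.2.2)

/-- The current point is feasible for its own subproblem, where the surrogate equals the sum rate.
-/
theorem IsRun.sumRate_le (h : A.IsRun S s) (n : ℕ) :
    sumRate S (s (n + 1)).u (s (n + 1)).x ≤ surrogate S (s (n + 1)) (s (n + 2)).x := by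
  have hg := h.good n
  have := (h.2 (n + 1)).2.1 _ hg.feas
  rwa [surrogate_eq S (s (n + 1)) (s (n + 1)).x, surr_self S hg.domain] at this

theorem mem_trapGraph_of_tendsto (h : A.IsRun S s) {F : Filter ℕ} [F.NeBot] (hF : F ≤ atTop)
    {p : Point K J L M × Receiver J M} (hp : Tendsto (fun n => ((s n).x, (s n).u)) F (𝓝 p)) :
    p ∈ trapGraph S := by
  refine (isCompact_trapGraph S).isClosed.mem_of_tendsto hp (hF ?_)
  filter_upwards [eventually_ge_atTop 1] with n hn
  obtain ⟨m, rfl⟩ := Nat.exists_eq_add_of_le' hn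
  exact (h.good m).mem_trapGraph

theorem IsRun.converges (h : A.IsRun S s) : Converges S s := by
  have hb1 := h.surrogate_le
  have hb2 := h.sumRate_le
  have hmono : Monotone fun n => surrogate S (s n) (s (n + 1)).x :=
    monotone_nat_of_le_succ fun n => (hb1 n).trans (hb2 n)
  obtain ⟨b, hb⟩ := (isCompact_trapGraph S).bddAbove_image
    (f := fun p : Point K J L M × Receiver J M => sumRate S p.2 p.1)
    (fun p hp => (continuousAt_sumRate S (trapGraph_subset_domain S hp)).continuousWithinAt)
  have hbdd : BddAbove (Set.range fun n => surrogate S (s n) (s (n + 1)).x) := by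
    refine ⟨b, ?_⟩
    rintro _ ⟨n, rfl⟩
    exact (hb1 n).trans (hb ⟨_, (h.good n).mem_trapGraph, rfl⟩)
  have hlim := tendsto_atTop_ciSup hmono hbdd
  set R := ⨆ n, surrogate S (s n) (s (n + 1)).x with hR
  have hlim' : Tendsto (fun n => sumRate S (s n).u (s n).x) atTop (𝓝 R) := by
    refine (tendsto_add_atTop_iff_nat 1).1 ?_
    exact tendsto_of_tendsto_of_tendsto_of_le_of_le hlim ((tendsto_add_atTop_iff_nat 1).2 hlim)
      hb1 hb2
  -- The arbitrary initial state need not lie in the trap and is added by hand.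
  refine ⟨⟨insert ((s 0).x, (s 0).u) (trapGraph S), (isCompact_trapGraph S).insert _, fun n => ?_⟩,
    hmono, monotone_nat_of_le_succ fun n => (hb2 n).trans (hb1 (n + 1)), R, hlim, hlim',
    fun x u hxu => ?_⟩
  · cases n with
    | zero => exact Set.mem_insert _ _
    | succ n => exact Set.mem_insert_of_mem _ (h.good n).mem_trapGraph
  · obtain ⟨U, hU, ht⟩ := mapClusterPt_iff_ultrafilter.1 hxu
    have hmem := mem_trapGraph_of_tendsto h hU ht
    refine ⟨?_, ?_⟩
    · have hc := (continuousAt_sumRate S (trapGraph_subset_domain S hmem)).tendsto.comp ht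
      exact tendsto_nhds_unique hc (hlim'.mono_left hU)
    · obtain ⟨y, _, hy⟩ := hmem
      obtain ⟨rfl, rfl⟩ := Prod.ext_iff.1 hy
      rfl

end Scheme

/-! ### Lagrange multipliers -/

/-- Lagrange multipliers for a linear objective and linear constraints on a convex set, under
Slater's condition. -/
theorem exists_multipliers {E ι : Type*} [AddCommGroup E] [Module ℝ E] [Fintype ι] {D : Set E}
    (hD : Convex ℝ D) (f : E →ₗ[ℝ] ℝ) (g : ι → E →ₗ[ℝ] ℝ) {d₀ : E} (hd₀ : d₀ ∈ D)
    (hg₀ : ∀ i, g i d₀ < 0) (h : ∀ d ∈ D, (∀ i, g i d < 0) → f d ≤ 0) :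
    ∃ ν : ι → ℝ, (∀ i, 0 ≤ ν i) ∧ ∀ d ∈ D, f d ≤ ∑ i, ν i * g i d := by
  classical
  -- The set of values that some direction beats strictly in every coordinate. It is open and convex
  -- and, by `h`, misses the origin, so a hyperplane separates it from the origin.
  let V : Set (ℝ × (ι → ℝ)) := {p | ∃ d ∈ D, p.1 < f d ∧ ∀ i, g i d < p.2 i}
  have hVo : IsOpen V := by
    have : V = ⋃ d ∈ D, {p : ℝ × (ι → ℝ) | p.1 < f d} ∩ ⋂ i, {p | g i d < p.2 i} := by
      ext p
      simp [V, and_left_comm]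
    rw [this]
    refine isOpen_biUnion fun d _ => ?_
    exact (isOpen_lt (by fun_prop) (by fun_prop)).inter
      (isOpen_iInter_of_finite fun i => isOpen_lt (by fun_prop) (by fun_prop))
  have hVc : Convex ℝ V := by
    rintro p ⟨d, hd, hp1, hp2⟩ q ⟨e, he, hq1, hq2⟩ a b ha hb hab
    refine ⟨a • d + b • e, hD hd he ha hb hab, ?_, fun i => ?_⟩
    · simp only [map_add, map_smul, smul_eq_mul, Prod.fst_add, Prod.smul_fst]
      rcases ha.eq_or_lt with rfl | ha
      · have : b = 1 := by linarith
        subst this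
        simpa using hq1
      · nlinarith [mul_lt_mul_of_pos_left hp1 ha, mul_le_mul_of_nonneg_left hq1.le hb]
    · simp only [map_add, map_smul, smul_eq_mul, Prod.snd_add, Prod.smul_snd, Pi.add_apply,
        Pi.smul_apply]
      rcases ha.eq_or_lt with rfl | ha
      · have : b = 1 := by linarith
        subst this
        simpa using hq2 i
      · nlinarith [mul_lt_mul_of_pos_left (hp2 i) ha, mul_le_mul_of_nonneg_left (hq2 i).le hb]
  have hV0 : (0 : ℝ × (ι → ℝ)) ∉ V := by
    rintro ⟨d, hd, h1, h2⟩
    exact (h d hd h2).not_gt h1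
  obtain ⟨φ, hφ⟩ := geometric_hahn_banach_open_point hVc hVo hV0
  rw [map_zero] at hφ
  set p := φ (1, 0) with hp
  set q : ι → ℝ := fun i => φ (0, Pi.single i 1) with hq
  have hrep : ∀ (α : ℝ) (β : ι → ℝ), φ (α, β) = α * p + ∑ i, β i * q i := by
    intro α β
    have e : (α, β) = α • ((1, 0) : ℝ × (ι → ℝ))
        + ∑ i, β i • ((0, Pi.single i 1) : ℝ × (ι → ℝ)) := by
      refine Prod.ext (by simp [Prod.fst_sum]) ?_
      funext i
      simp [Prod.snd_sum, Finset.sum_apply, Pi.single_apply]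
    rw [e]
    simp only [map_add, map_smul, map_sum, smul_eq_mul, hp, hq]
  have hsep : ∀ d ∈ D, ∀ (r : ℝ) (ε : ι → ℝ), 0 < r → (∀ i, 0 < ε i) →
      (f d - r) * p + ∑ i, (g i d + ε i) * q i < 0 := by
    intro d hd r ε hr hε
    rw [← hrep (f d - r) (fun i => g i d + ε i)]
    exact hφ _ ⟨d, hd, by simpa using hr, fun i => by simpa using hε i⟩
  -- Large `r` gives the sign of the slope, small `r` that of the constant term.
  have hlin : ∀ a b : ℝ, (∀ r, 0 < r → a + r * b < 0) → b ≤ 0 ∧ a ≤ 0 := by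
    intro a b hab
    constructor
    · by_contra hb
      push Not at hb
      have h1 := hab (|a| / b + 1) (by positivity)
      have : |a| / b * b = |a| := by field_simp
      nlinarith [neg_abs_le a]
    · by_contra ha
      push Not at ha
      have h1 := hab (a / (|b| + 1)) (by positivity)
      have h2 : a / (|b| + 1) * (|b| + 1) = a := by field_simp
      have h3 : 0 < a / (|b| + 1) := by positivity
      nlinarith [neg_abs_le b]
  have hp0 : 0 ≤ p := by
    have := (hlin (f d₀ * p + ∑ i, (g i d₀ + 1) * q i) (-p) fun r hr => by
      have := hsep d₀ hd₀ r (fun _ => 1) hr (fun _ => one_pos)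
      linarith).1
    linarith
  have hq0 : ∀ i, q i ≤ 0 := by
    intro i
    refine (hlin ((f d₀ - 1) * p + ∑ i, (g i d₀ + 1) * q i) (q i) fun r hr => ?_).1
    have := hsep d₀ hd₀ 1 (fun i' => 1 + if i' = i then r else 0) one_pos
      (fun i' => by split_ifs <;> linarith)
    simp only [← add_assoc, add_mul _ (ite _ _ _), Finset.sum_add_distrib, ite_mul, zero_mul,
      Finset.sum_ite_eq', Finset.mem_univ, if_true] at this
    linarith
  have hle : ∀ d ∈ D, f d * p + ∑ i, g i d * q i ≤ 0 := by
    intro d hd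
    refine (hlin (f d * p + ∑ i, g i d * q i) (-p + ∑ i, q i) fun r hr => ?_).2
    have := hsep d hd r (fun _ => r) hr (fun _ => hr)
    simp only [add_mul, Finset.sum_add_distrib, ← Finset.mul_sum] at this
    linarith
  -- If `p` vanished, Slater's point would force every `q i` to vanish, contradicting strict
  -- separation.
  have hp1 : 0 < p := by
    refine hp0.lt_of_ne' fun h0 => ?_
    have h1 := hle d₀ hd₀
    rw [h0, mul_zero, zero_add] at h1
    have h2 : ∀ i ∈ Finset.univ, 0 ≤ g i d₀ * q i := fun i _ =>
      mul_nonneg_of_nonpos_of_nonpos (hg₀ i).le (hq0 i)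
    have h3 := (Finset.sum_eq_zero_iff_of_nonneg h2).1 (le_antisymm h1 (Finset.sum_nonneg h2))
    have h4 : ∀ i, q i = 0 := fun i =>
      (mul_eq_zero.1 (h3 i (Finset.mem_univ i))).resolve_left (hg₀ i).ne
    have := hsep d₀ hd₀ 1 (fun _ => 1) one_pos (fun _ => one_pos)
    simp [h4, h0] at this
  refine ⟨fun i => -q i / p, fun i => div_nonneg (by linarith [hq0 i]) hp0, fun d hd => ?_⟩
  have e : ∑ i, -q i / p * g i d = -(∑ i, g i d * q i) / p := by
    rw [← Finset.sum_neg_distrib, Finset.sum_div]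
    exact Finset.sum_congr rfl fun i _ => by ring
  rw [e, le_div_iff₀ hp1]
  linarith [hle d hd]

/-! ### Directional derivatives -/

theorem hasDerivAt_line (T : Point K J L M →ₗ[ℝ] ℝ) (b : ℝ) (x d : Point K J L M) :
    HasDerivAt (fun ε : ℝ => T (x + ε • d) + b) (T d) 0 := by
  simp only [map_add, map_smul, smul_eq_mul]
  simpa using (((hasDerivAt_id (0 : ℝ)).mul_const (T d)).const_add (T x)).add_const b

theorem hasDerivAt_logb_line (T : Point K J L M →ₗ[ℝ] ℝ) (b : ℝ) {x : Point K J L M}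
    (d : Point K J L M) (h : 0 < T x + b) :
    HasDerivAt (fun ε : ℝ => Real.logb 2 (T (x + ε • d) + b)) ((T x + b)⁻¹ / Real.log 2 * T d)
      0 := by
  have h1 := (hasDerivAt_line T b x d).log (by simpa using h.ne')
  have h2 := h1.div_const (Real.log 2)
  have e : T d / (T (x + (0 : ℝ) • d) + b) / Real.log 2 = (T x + b)⁻¹ / Real.log 2 * T d := by
    rw [zero_smul, add_zero]
    field_simp
  rw [e] at h2
  exact h2

/-- The derivative of `rateD` at `x`. -/
def rateDL (S : System K J L Z M) (x : Point K J L M) (k : Fin K) : Point K J L M →ₗ[ℝ] ℝ :=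
  ((quadD S k (x.1 k) + gamD S k x)⁻¹ / Real.log 2) • (sigDL S k + gamDL S k)
    - ((gamD S k x)⁻¹ / Real.log 2) • gamDL S k

/-- The derivative of `rateU` at `x`. -/
def rateUL (S : System K J L Z M) (u : Receiver J M) (x : Point K J L M) (j : Fin J) :
    Point K J L M →ₗ[ℝ] ℝ :=
  ((x.2 j * gainU S j j (u j) + gamU S u j x)⁻¹ / Real.log 2) • (sigUL S u j + gamUL S u j)
    - ((gamU S u j x)⁻¹ / Real.log 2) • gamUL S u j

/-- The derivative of `sumRate` at `x`. -/
def sumRateL (S : System K J L Z M) (u : Receiver J M) (x : Point K J L M) :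
    Point K J L M →ₗ[ℝ] ℝ :=
  (∑ k, rateDL S x k) + ∑ j, rateUL S u x j

/-- The derivative of `load` at `x`. -/
def Scheme.loadL (A : Scheme K L) (S : System K J L Z M) (x : Point K J L M) (l : Fin L) :
    Point K J L M →ₗ[ℝ] ℝ :=
  ∑ k, ((A.wd l k (trT (x.1 k) l) * rateD S k x) • linkL l k
    + A.w l k (trT (x.1 k) l) • rateDL S x k)

section Deriv

variable {S : System K J L Z M} {x : Point K J L M} {u : Receiver J M}

theorem hasDerivAt_logb_gamD (hx : x ∈ cone K J L M) (d : Point K J L M) (k : Fin K) :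
    HasDerivAt (fun ε : ℝ => Real.logb 2 (gamD S k (x + ε • d)))
      ((gamD S k x)⁻¹ / Real.log 2 * gamDL S k d) 0 := by
  have := gamD_pos S k hx
  simp only [gamD_eq] at this ⊢
  exact hasDerivAt_logb_line _ _ _ this

theorem hasDerivAt_logb_gamU (hx : (x, u) ∈ domain K J L M) (d : Point K J L M) (j : Fin J) :
    HasDerivAt (fun ε : ℝ => Real.logb 2 (gamU S u j (x + ε • d)))
      ((gamU S u j x)⁻¹ / Real.log 2 * gamUL S u j d) 0 := by
  have := gamU_pos S j hx.1 (hx.2 j)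
  simp only [gamU_eq] at this ⊢
  exact hasDerivAt_logb_line _ _ _ this

theorem hasDerivAt_logb_totalD (hx : x ∈ cone K J L M) (d : Point K J L M) (k : Fin K) :
    HasDerivAt (fun ε : ℝ => Real.logb 2 (quadD S k ((x + ε • d).1 k) + gamD S k (x + ε • d)))
      ((quadD S k (x.1 k) + gamD S k x)⁻¹ / Real.log 2 * (sigDL S k + gamDL S k) d) 0 := by
  have e : ∀ y : Point K J L M, quadD S k (y.1 k) + gamD S k y
      = (sigDL S k + gamDL S k) y + S.sigD k := by
    intro y
    rw [gamD_eq, LinearMap.add_apply, sigDL_apply, add_assoc]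
  have := add_pos_of_nonneg_of_pos (quadD_nonneg S k (hx.1 k)) (gamD_pos S k hx)
  simp only [e] at this ⊢
  exact hasDerivAt_logb_line _ _ _ this

theorem hasDerivAt_logb_totalU (hx : (x, u) ∈ domain K J L M) (d : Point K J L M) (j : Fin J) :
    HasDerivAt (fun ε : ℝ => Real.logb 2 ((x + ε • d).2 j * gainU S j j (u j)
        + gamU S u j (x + ε • d)))
      ((x.2 j * gainU S j j (u j) + gamU S u j x)⁻¹ / Real.log 2
        * (sigUL S u j + gamUL S u j) d) 0 := by
  have e : ∀ y : Point K J L M, y.2 j * gainU S j j (u j) + gamU S u j y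
      = (sigUL S u j + gamUL S u j) y + S.sigU (S.serv j) * sqNorm (u j) := by
    intro y
    rw [gamU_eq, LinearMap.add_apply, sigUL_apply, add_assoc]
  have := add_pos_of_nonneg_of_pos (mul_nonneg (hx.1.2 j) (gainU_nonneg S j j (u j)))
    (gamU_pos S j hx.1 (hx.2 j))
  simp only [e] at this ⊢
  exact hasDerivAt_logb_line _ _ _ this

theorem hasDerivAt_fPart (hx : (x, u) ∈ domain K J L M) (d : Point K J L M) :
    HasDerivAt (fun ε : ℝ => fPart S u (x + ε • d))
      ((∑ k, (quadD S k (x.1 k) + gamD S k x)⁻¹ / Real.log 2 * (sigDL S k + gamDL S k) d)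
        + ∑ j, (x.2 j * gainU S j j (u j) + gamU S u j x)⁻¹ / Real.log 2
          * (sigUL S u j + gamUL S u j) d) 0 :=
  (HasDerivAt.fun_sum fun k _ => hasDerivAt_logb_totalD hx.1 d k).add
    (HasDerivAt.fun_sum fun j _ => hasDerivAt_logb_totalU hx d j)

/-- At its expansion point the surrogate has the derivative of the sum rate, so first-order
optimality transfers from one to the other. -/
theorem hasDerivAt_surr (hx : (x, u) ∈ domain K J L M) (d : Point K J L M) :
    HasDerivAt (fun ε : ℝ => surr S (x, u) (x + ε • d)) (sumRateL S u x d) 0 := by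
  have h1 : ∀ k, HasDerivAt (fun ε : ℝ => (gamD S k x)⁻¹ / Real.log 2
      * (gamD S k (x + ε • d) - gamD S k x)) ((gamD S k x)⁻¹ / Real.log 2 * gamDL S k d) 0 := by
    intro k
    refine HasDerivAt.const_mul _ (HasDerivAt.sub_const _ ?_)
    simp only [gamD_eq]
    exact hasDerivAt_line _ _ _ _
  have h2 : ∀ j, HasDerivAt (fun ε : ℝ => (gamU S u j x)⁻¹ / Real.log 2
      * (gamU S u j (x + ε • d) - gamU S u j x))
      ((gamU S u j x)⁻¹ / Real.log 2 * gamUL S u j d) 0 := by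
    intro j
    refine HasDerivAt.const_mul _ (HasDerivAt.sub_const _ ?_)
    simp only [gamU_eq]
    exact hasDerivAt_line _ _ _ _
  have h := (hasDerivAt_fPart (S := S) hx d).sub (((HasDerivAt.fun_sum fun k (_ : k ∈ Finset.univ) =>
    h1 k).const_add (hPart S u x)).add (HasDerivAt.fun_sum fun j (_ : j ∈ Finset.univ) => h2 j))
  refine h.congr_deriv ?_
  simp only [sumRateL, rateDL, rateUL, LinearMap.add_apply, LinearMap.sum_apply,
    LinearMap.sub_apply, LinearMap.smul_apply, smul_eq_mul, Finset.sum_sub_distrib]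
  ring

theorem eventually_pos_line (T : Point K J L M →ₗ[ℝ] ℝ) (b : ℝ) (d : Point K J L M)
    (h : 0 < T x + b) : ∀ᶠ ε in 𝓝 (0 : ℝ), 0 < T (x + ε • d) + b :=
  (hasDerivAt_line T b x d).continuousAt.eventually (lt_mem_nhds (by simpa using h))

theorem hasDerivAt_rateD (hx : x ∈ cone K J L M) (d : Point K J L M) (k : Fin K) :
    HasDerivAt (fun ε : ℝ => rateD S k (x + ε • d)) (rateDL S x k d) 0 := by
  have hg := gamD_pos S k hx
  have ht := add_pos_of_nonneg_of_pos (quadD_nonneg S k (hx.1 k)) hg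
  have h := (hasDerivAt_logb_totalD (S := S) hx d k).sub (hasDerivAt_logb_gamD (S := S) hx d k)
  refine HasDerivAt.congr_of_eventuallyEq (h.congr_deriv ?_) ?_
  · simp [rateDL, mul_add]
  -- The logarithm of the quotient splits only where both affine arguments are positive, which holds
  -- near `ε = 0`.
  · rw [gamD_eq] at hg ht
    have e1 := eventually_pos_line _ _ d hg
    have e2 := eventually_pos_line (sigDL S k + gamDL S k) (S.sigD k) (x := x) d
      (by rw [LinearMap.add_apply, sigDL_apply]; linarith)
    filter_upwards [e1, e2] with ε h1 h2
    rw [← gamD_eq] at h1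
    rw [LinearMap.add_apply, add_assoc, ← gamD_eq, sigDL_apply] at h2
    exact logb_one_add_div h1 h2

theorem hasDerivAt_rateU (hx : (x, u) ∈ domain K J L M) (d : Point K J L M) (j : Fin J) :
    HasDerivAt (fun ε : ℝ => rateU S u j (x + ε • d)) (rateUL S u x j d) 0 := by
  have hg := gamU_pos S j hx.1 (hx.2 j)
  have ht := add_pos_of_nonneg_of_pos (mul_nonneg (hx.1.2 j) (gainU_nonneg S j j (u j))) hg
  have h := (hasDerivAt_logb_totalU (S := S) hx d j).sub (hasDerivAt_logb_gamU (S := S) hx d j)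
  refine HasDerivAt.congr_of_eventuallyEq (h.congr_deriv ?_) ?_
  · simp [rateUL, mul_add]
  · rw [gamU_eq] at hg ht
    have e1 := eventually_pos_line _ _ d hg
    have e2 := eventually_pos_line (sigUL S u j + gamUL S u j)
      (S.sigU (S.serv j) * sqNorm (u j)) (x := x) d
      (by rw [LinearMap.add_apply, sigUL_apply]; linarith)
    filter_upwards [e1, e2] with ε h1 h2
    rw [← gamU_eq] at h1
    rw [LinearMap.add_apply, add_assoc, ← gamU_eq, sigUL_apply] at h2
    exact logb_one_add_div h1 h2

theorem lineDeriv_sumRate (hx : (x, u) ∈ domain K J L M) (d : Point K J L M) :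
    lineDeriv ℝ (sumRate S u) x d = sumRateL S u x d := by
  have h := (HasDerivAt.fun_sum fun k (_ : k ∈ Finset.univ) =>
    hasDerivAt_rateD (S := S) hx.1 d k).add
    (HasDerivAt.fun_sum fun j (_ : j ∈ Finset.univ) => hasDerivAt_rateU (S := S) hx d j)
  have e : sumRateL S u x d = (∑ k, rateDL S x k d) + ∑ j, rateUL S u x j d := by
    simp [sumRateL, LinearMap.sum_apply]
  rw [e]
  exact h.deriv

theorem linkL_line (l : Fin L) (k : Fin K) (d : Point K J L M) (ε : ℝ) :
    trT ((x + ε • d).1 k) l = trT (x.1 k) l + ε * linkL l k d := by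
  rw [← linkL_apply, ← linkL_apply, map_add, map_smul, smul_eq_mul]

theorem hasDerivAt_link (l : Fin L) (k : Fin K) (d : Point K J L M) :
    HasDerivAt (fun ε : ℝ => trT ((x + ε • d).1 k) l) (linkL l k d) 0 := by
  simpa [linkL_apply] using hasDerivAt_line (linkL l k) 0 x d

theorem Scheme.lineDeriv_load (A : Scheme K L) (hx : x ∈ cone K J L M) (d : Point K J L M)
    (l : Fin L) : lineDeriv ℝ (load S A.w l) x d = A.loadL S x l d := by
  have h1 : ∀ k, HasDerivAt (fun ε : ℝ => A.w l k (trT ((x + ε • d).1 k) l))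
      (A.wd l k (trT (x.1 k) l) * linkL l k d) 0 := by
    intro k
    have := A.w_deriv l k (trT ((x + (0 : ℝ) • d).1 k) l)
    have h2 := this.comp (0 : ℝ) (hasDerivAt_link (x := x) l k d)
    rw [zero_smul, add_zero] at h2
    exact h2
  have h := HasDerivAt.fun_sum fun k (_ : k ∈ Finset.univ) =>
    (h1 k).mul (hasDerivAt_rateD (S := S) hx d k)
  have e := h.deriv
  refine e.trans ?_
  simp only [zero_smul, add_zero, loadL, LinearMap.sum_apply, LinearMap.add_apply,
    LinearMap.smul_apply, smul_eq_mul]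
  exact Finset.sum_congr rfl fun k _ => by ring

end Deriv

/-! ### Bounds on the auxiliary variables -/

theorem quadD_le (S : System K J L Z M) (k : Fin K) {Q : Mat L M} (hQ : Q.PosSemidef) :
    quadD S k Q ≤ (∑ p, ‖S.hD k p‖) ^ 2 * ∑ l, trT Q l := by
  have h : ‖star (S.hD k) ⬝ᵥ (Q *ᵥ S.hD k)‖ ≤ (∑ p, ‖S.hD k p‖) ^ 2 * ∑ l, trT Q l := by
    simp only [dotProduct, Matrix.mulVec, Finset.mul_sum]
    have h0 : 0 ≤ ∑ l, trT Q l := Finset.sum_nonneg fun l _ => trT_nonneg hQ l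
    calc _ ≤ ∑ p, ∑ q, ‖S.hD k p‖ * ((∑ l, trT Q l) * ‖S.hD k q‖) := by
          refine (norm_sum_le _ _).trans (Finset.sum_le_sum fun p _ => ?_)
          refine (norm_sum_le _ _).trans (Finset.sum_le_sum fun q _ => ?_)
          rw [norm_mul, norm_mul, Pi.star_apply, norm_star]
          have := posSemidef_norm_apply_le hQ p q
          rw [← sum_trT] at this
          gcongr
      _ = _ := by
          simp only [← Finset.mul_sum, ← Finset.sum_mul]
          ring
  exact (Complex.re_le_norm _).trans h

/-- A uniform positive lower bound of the received signal power. -/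
def sigMin (S : System K J L Z M) (k : Fin K) : ℝ := ((2 : ℝ) ^ S.RDmin k - 1) * S.sigD k

theorem sigMin_pos (S : System K J L Z M) (k : Fin K) : 0 < sigMin S k :=
  mul_pos (rpow_two_sub_one_pos (S.RDmin_pos k)) (S.sigD_pos k)

/-- Received power is at most a constant times the total transmit power, so the QoS bound forbids
all links of a user to be weak at once. -/
theorem exists_link_ge (S : System K J L Z M) (k : Fin K) :
    ∃ t₁, 0 < t₁ ∧ ∀ (off : Fin L → Fin K → Prop) (u : Receiver J M) (x : Point K J L M),
      x ∈ convexSet S off u → ∃ l, t₁ ≤ trT (x.1 k) l := by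
  have hs := sigMin_pos S k
  -- The two summands `1` keep the denominators positive; the first also makes the final
  -- contradiction strict.
  refine ⟨sigMin S k / (((∑ p, ‖S.hD k p‖) ^ 2 + 1) * (L + 1)), by positivity,
    fun off u x hx => ?_⟩
  by_contra hcon
  push Not at hcon
  have h1 := (quadD_lower hx k).trans (quadD_le S k (hx.2.1 k))
  have h2 : ∑ l, trT (x.1 k) l ≤ L * (sigMin S k / (((∑ p, ‖S.hD k p‖) ^ 2 + 1) * (L + 1))) := by
    refine (Finset.sum_le_sum fun l _ => (hcon l).le).trans (le_of_eq ?_)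
    simp
  have h3 : (L : ℝ) * (sigMin S k / (((∑ p, ‖S.hD k p‖) ^ 2 + 1) * (L + 1)))
      ≤ sigMin S k / ((∑ p, ‖S.hD k p‖) ^ 2 + 1) := by
    rw [← mul_div_assoc, div_le_div_iff₀ (by positivity) (by positivity)]
    have : 0 ≤ sigMin S k * ((∑ p, ‖S.hD k p‖) ^ 2 + 1) := by positivity
    nlinarith
  have h4 : (∑ p, ‖S.hD k p‖) ^ 2 * (sigMin S k / ((∑ p, ‖S.hD k p‖) ^ 2 + 1)) < sigMin S k := by
    rw [← mul_div_assoc, div_lt_iff₀ (by positivity)]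
    nlinarith
  have h5 := mul_le_mul_of_nonneg_left (h2.trans h3)
    (by positivity : 0 ≤ (∑ p, ‖S.hD k p‖) ^ 2)
  have h6 : sigMin S k ≤ (∑ p, ‖S.hD k p‖) ^ 2 * ∑ l, trT (x.1 k) l := h1
  linarith

theorem one_add_div_le_two_rpow {a g μ ρ : ℝ} (ha : 0 ≤ a) (hμ : 1 / g ≤ μ)
    (h : μ * a ≤ (2 : ℝ) ^ ρ - 1) : 1 + a / g ≤ (2 : ℝ) ^ ρ := by
  have := mul_le_mul_of_nonneg_right hμ ha
  have e : 1 / g * a = a / g := by ring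
  linarith

namespace Scheme

variable {A : Scheme K L} {S : System K J L Z M}

theorem Good.cone {s : State K J L M} (h : A.Good S s) : s.x ∈ cone K J L M :=
  convexSet_subset_cone S _ _ h.mem

theorem Good.rateD_le {s : State K J L M} (h : A.Good S s) (k : Fin K) :
    rateD S k s.x ≤ s.ρ k := by
  have ha := quadD_pos h.mem k
  have hg := gamD_pos S k h.cone
  have h1 := one_add_div_le_two_rpow ha.le (h.μ_ge k) (h.ρ_ge k)
  refine (Real.logb_le_iff_le_rpow (by norm_num) (by positivity)).2 h1

/-- This keeps `ρ` positive in the limit, where the backhaul linearization divides by it. -/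
theorem Good.ρ_lower {s : State K J L M} (h : A.Good S s) (k : Fin K) : S.RDmin k ≤ s.ρ k := by
  have ha := quadD_pos h.mem k
  have hg := gamD_pos S k h.cone
  have h1 := one_add_div_le_two_rpow ha.le (h.μ_ge k) (h.ρ_ge k)
  have h2 := h.mem.2.2.2.1 k
  have h3 : (2 : ℝ) ^ S.RDmin k - 1 ≤ quadD S k (s.x.1 k) / gamD S k s.x := by
    rw [le_div_iff₀ hg]
    linarith
  exact (Real.rpow_le_rpow_left_iff (by norm_num : (1 : ℝ) < 2)).1 (by linarith)

/-- Some link of the user has a trace, hence a weight, bounded below; the capacity of that T-RAU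
then bounds `ρ`. Summing `|S.C l|` makes the bound independent of the link. -/
theorem exists_ρ_bound (A : Scheme K L) (S : System K J L Z M) (k : Fin K) :
    ∃ r, ∀ s : State K J L M, A.Good S s → s.ρ k ≤ r := by
  obtain ⟨t₁, ht₁, hex⟩ := exists_link_ge S k
  obtain ⟨ω, hω, hw⟩ := A.w_pos t₁ ht₁
  refine ⟨(∑ l, |S.C l|) / ω, fun s hs => ?_⟩
  obtain ⟨l, hl⟩ := hex _ _ _ hs.mem
  rw [le_div_iff₀ hω]
  have hoff : ¬ A.off l k (trT (s.x.1 k) l) := fun h => by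
    have := hs.mem.2.2.2.2.2 l k h
    linarith
  have h1 : A.w l k (trT (s.x.1 k) l) * s.ρ k ≤ S.C l := by
    refine le_trans ?_ (hs.load_le l)
    exact Finset.single_le_sum (f := fun k => A.w l k (trT (s.x.1 k) l) * s.ρ k)
      (fun k _ => mul_nonneg (A.w_nonneg l k (trT_nonneg (hs.cone.1 k) l)) (hs.init.2.2.1 k).le)
      (Finset.mem_univ k)
  have h2 := mul_le_mul_of_nonneg_right (hw l k _ _ hoff hl) (hs.init.2.2.1 k).le
  have h3 : |S.C l| ≤ ∑ l, |S.C l| :=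
    Finset.single_le_sum (f := fun l => |S.C l|) (fun l _ => abs_nonneg _) (Finset.mem_univ l)
  have h4 := le_abs_self (S.C l)
  linarith

theorem Good.μ_le {s : State K J L M} (h : A.Good S s) {k : Fin K} {r : ℝ} (hr : s.ρ k ≤ r) :
    s.μ k ≤ (2 : ℝ) ^ r / sigMin S k := by
  rw [le_div_iff₀ (sigMin_pos S k)]
  have h1 := mul_le_mul_of_nonneg_left (quadD_lower h.mem k) (h.μ_pos k).le
  have h2 := h.ρ_ge k
  have h3 := Real.rpow_le_rpow_of_exponent_le (by norm_num : (1 : ℝ) ≤ 2) hr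
  have h4 : s.μ k * sigMin S k ≤ s.μ k * quadD S k (s.x.1 k) := h1
  linarith

end Scheme

/-! ### The limit state -/

/-- Working along an ultrafilter makes all bounded auxiliary sequences converge at once, without
repeated extraction of subsequences. -/
theorem exists_lim_of_bounded {U : Ultrafilter ℕ} {f : ℕ → ℝ} {a b : ℝ}
    (h : ∀ᶠ n in (U : Filter ℕ), f n ∈ Set.Icc a b) :
    ∃ y, Tendsto f U (𝓝 y) := by
  obtain ⟨y, _, hy⟩ := (isCompact_Icc (a := a) (b := b)).ultrafilter_le_nhds (U.map f)
    (by rw [le_principal_iff]; exact h)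
  exact ⟨y, hy⟩

namespace Scheme

variable {A : Scheme K L} {S : System K J L Z M} {s : ℕ → State K J L M}

theorem IsRun.eventually_good (h : A.IsRun S s) {F : Filter ℕ} (hF : F ≤ atTop) :
    ∀ᶠ n in F, A.Good S (s n) := by
  refine hF ?_
  filter_upwards [eventually_ge_atTop 1] with n hn
  obtain ⟨m, rfl⟩ := Nat.exists_eq_add_of_le' hn
  exact h.good m

/-- Along an ultrafilter at which the points and receivers converge, the whole states converge to a
state with the same invariants. -/
theorem IsRun.exists_limit (h : A.IsRun S s) {U : Ultrafilter ℕ} (hU : (U : Filter ℕ) ≤ atTop)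
    {x : Point K J L M} {u : Receiver J M}
    (ht : Tendsto (fun n => ((s n).x, (s n).u)) U (𝓝 (x, u))) :
    ∃ σ : State K J L M, σ.x = x ∧ σ.u = u ∧ A.Good S σ ∧
      (∀ k, Tendsto (fun n => (s n).ρ k) U (𝓝 (σ.ρ k))) ∧
      ∀ k, Tendsto (fun n => (s n).φ k) U (𝓝 (σ.φ k)) := by
  have hg := h.eventually_good hU
  have hmem := mem_trapGraph_of_tendsto h hU ht
  obtain ⟨y, hy, hyx⟩ := hmem
  obtain ⟨rfl, rfl⟩ := Prod.ext_iff.1 hyx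
  simp only at ht ⊢
  have hdom := mem_domain_of_mem_trap S hy
  choose r hr using A.exists_ρ_bound S (J := J) (M := M)
  have hρ : ∀ k, ∃ ρ, Tendsto (fun n => (s n).ρ k) U (𝓝 ρ) := fun k =>
    exists_lim_of_bounded (a := 0) (b := r k)
      (hg.mono fun n hn => ⟨(hn.init.2.2.1 k).le, hr k _ hn⟩)
  have hμ : ∀ k, ∃ μ, Tendsto (fun n => (s n).μ k) U (𝓝 μ) := fun k =>
    exists_lim_of_bounded (a := 0) (b := (2 : ℝ) ^ r k / sigMin S k)
      (hg.mono fun n hn => ⟨(hn.μ_pos k).le, hn.μ_le (hr k _ hn)⟩)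
  choose ρ hρ using hρ
  choose μ hμ using hμ
  have hx : Tendsto (fun n => (s n).x) U (𝓝 y) :=
    (continuous_fst.tendsto _).comp ht
  have hquad : ∀ k, Tendsto (fun n => quadD S k ((s n).x.1 k)) U (𝓝 (quadD S k (y.1 k))) :=
    fun k => ((by fun_prop : Continuous fun x : Point K J L M => quadD S k (x.1 k)).tendsto
      y).comp hx
  have htr : ∀ l k, Tendsto (fun n => trT ((s n).x.1 k) l) U (𝓝 (trT (y.1 k) l)) :=
    fun l k => ((by fun_prop : Continuous fun x : Point K J L M => trT (x.1 k) l).tendsto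
      y).comp hx
  have hgam : ∀ k, Tendsto (fun n => gamD S k (s n).x) U (𝓝 (gamD S k y)) :=
    fun k => ((continuous_gamD S k).tendsto y).comp hx
  have ha : ∀ k, sigMin S k ≤ quadD S k (y.1 k) := fun k =>
    ge_of_tendsto (hquad k) (hg.mono fun n hn => quadD_lower hn.mem k)
  have ha0 : ∀ k, 0 < quadD S k (y.1 k) := fun k => (sigMin_pos S k).trans_le (ha k)
  have hgpos : ∀ k, 0 < gamD S k y := fun k => gamD_pos S k hdom.1
  have hμge : ∀ k, 1 / gamD S k y ≤ μ k := fun k =>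
    le_of_tendsto_of_tendsto (tendsto_const_nhds.div (hgam k) (hgpos k).ne') (hμ k)
      (hg.mono fun n hn => hn.μ_ge k)
  have hμ0 : ∀ k, 0 < μ k := fun k => (one_div_pos.2 (hgpos k)).trans_le (hμge k)
  have hφ : ∀ k, Tendsto (fun n => (s n).φ k) U (𝓝 (μ k / quadD S k (y.1 k))) := fun k =>
    ((hμ k).div (hquad k) (ha0 k).ne').congr' (hg.mono fun n hn => (hn.φ_eq k).symm)
  have hρ0 : ∀ k, S.RDmin k ≤ ρ k := fun k =>
    ge_of_tendsto (hρ k) (hg.mono fun n hn => hn.ρ_lower k)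
  have hcs : y ∈ convexSet S (A.offOf y) (mmse S y) := by
    refine ⟨hy.1.1, hy.1.2.1, hy.1.2.2, fun k => ?_, fun j => ?_, fun l k hlk => ?_⟩
    · exact le_of_tendsto (((hgam k).const_mul _).sub (hquad k))
        (hg.mono fun n hn => hn.mem.2.2.2.1 k)
    · have hc : Continuous fun p : Point K J L M × Receiver J M => qosU S p.2 j p.1 :=
        (continuous_const.mul (continuous_gamU S j)).sub (continuous_sigU S j)
      have hq := (hc.tendsto (y, mmse S y)).comp ht
      have hle : ∀ᶠ n in (U : Filter ℕ), qosU S (s n).u j (s n).x ≤ 0 :=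
        hg.mono fun n hn => hn.mem.2.2.2.2.1 j
      have hlim : qosU S (mmse S y) j y ≤ 0 := le_of_tendsto hq hle
      exact hlim
    · exact A.off_closed (htr l k) (hg.mono fun n hn => hn.mem.2.2.2.2.2 l k) hlk
  have hρge : ∀ k, μ k * quadD S k (y.1 k) ≤ (2 : ℝ) ^ ρ k - 1 := by
    intro k
    have h2 : Tendsto (fun n => (2 : ℝ) ^ (s n).ρ k - 1) U (𝓝 ((2 : ℝ) ^ ρ k - 1)) :=
      (((Real.continuous_const_rpow two_ne_zero).tendsto _).comp (hρ k)).sub_const 1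
    exact le_of_tendsto_of_tendsto ((hμ k).mul (hquad k)) h2 (hg.mono fun n hn => hn.ρ_ge k)
  have hload : ∀ l, ∑ k, A.w l k (trT (y.1 k) l) * ρ k ≤ S.C l := by
    intro l
    refine le_of_tendsto (tendsto_finsetSum _ fun k _ => ?_) (hg.mono fun n hn => hn.load_le l)
    exact (((A.w_deriv l k _).continuousAt.tendsto).comp (htr l k)).mul (hρ k)
  exact ⟨⟨⟨y, ρ, μ⟩, fun k => μ k / quadD S k (y.1 k), mmse S y⟩, rfl, rfl,
    ⟨⟨hdom.1.1, hdom.1.2, fun k => (S.RDmin_pos k).trans_le (hρ0 k),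
      fun k => div_pos (hμ0 k) (ha0 k), hdom.2⟩, hcs, rfl, fun k => rfl, hμ0, hμge, hρge,
      hload, hy.2⟩, hρ, hφ⟩

theorem Good.isFeasible {σ : State K J L M} (h : A.Good S σ) :
    IsFeasible S A.w (A.offOf σ.x) σ.u σ.x :=
  ⟨h.mem, fun l => (Finset.sum_le_sum fun k _ => mul_le_mul_of_nonneg_left (h.rateD_le k)
    (A.w_nonneg l k (trT_nonneg (h.cone.1 k) l))).trans (h.load_le l)⟩

/-- A point that satisfies the backhaul and uplink constraints of the limiting subproblem strictly is
not better than the limit point. -/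
theorem IsRun.surr_le_of_strict (h : A.IsRun S s) {U : Ultrafilter ℕ}
    (hU : (U : Filter ℕ) ≤ atTop) {σ : State K J L M} (hσ : A.Good S σ)
    (ht : Tendsto (fun n => ((s n).x, (s n).u)) U (𝓝 (σ.x, σ.u)))
    (hρ : ∀ k, Tendsto (fun n => (s n).ρ k) U (𝓝 (σ.ρ k)))
    (hφ : ∀ k, Tendsto (fun n => (s n).φ k) U (𝓝 (σ.φ k)))
    {z : Point K J L M} (hz : z ∈ convexSet S (A.offOf σ.x) σ.u)
    (hq : ∀ j, qosU S σ.u j z < 0)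
    (hc : ∀ l, ∑ k, A.c l k (σ.ρ k) (trT (σ.x.1 k) l) (rmin S σ k z) (trT (z.1 k) l) < S.C l) :
    surr S (σ.x, σ.u) z ≤ surr S (σ.x, σ.u) σ.x := by
  have hzc := convexSet_subset_cone S _ _ hz
  have hx : Tendsto (fun n => (s n).x) U (𝓝 σ.x) := (continuous_fst.tendsto _).comp ht
  have hu : Tendsto (fun n => (s n).u) U (𝓝 σ.u) := (continuous_snd.tendsto _).comp ht
  have htr : ∀ l k, Tendsto (fun n => trT ((s n).x.1 k) l) U (𝓝 (trT (σ.x.1 k) l)) :=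
    fun l k => ((by fun_prop : Continuous fun x : Point K J L M => trT (x.1 k) l).tendsto
      _).comp hx
  have e1 : ∀ᶠ n in (U : Filter ℕ), ∀ j, qosU S (s n).u j z < 0 := by
    refine eventually_all.2 fun j => ?_
    have hcont : Continuous fun u : Receiver J M => qosU S u j z := by
      have hj : Continuous fun u : Receiver J M => (z, u) := by fun_prop
      exact (continuous_const.mul ((continuous_gamU S j).comp hj)).sub
        ((continuous_sigU S j).comp hj)
    exact ((hcont.tendsto _).comp hu).eventually (gt_mem_nhds (hq j))
  -- Links switched off in the limit are off at `z` as well; all other links are eventually not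
  -- switched off.
  have e2 : ∀ᶠ n in (U : Filter ℕ), ∀ l k, A.off l k (trT ((s n).x.1 k) l) → trT (z.1 k) l = 0 := by
    refine eventually_all.2 fun l => eventually_all.2 fun k => ?_
    by_cases ho : A.off l k (trT (σ.x.1 k) l)
    · exact Eventually.of_forall fun _ _ => hz.2.2.2.2.2 l k ho
    · exact (A.off_lim (htr l k) ho).mono fun n hn h => absurd h hn
  have e3 : ∀ᶠ n in (U : Filter ℕ), ∀ l, ∑ k, A.c l k ((s n).ρ k) (trT ((s n).x.1 k) l)
      (rmin S (s n) k z) (trT (z.1 k) l) < S.C l := by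
    refine eventually_all.2 fun l => ?_
    refine Tendsto.eventually (tendsto_finsetSum _ fun k _ => ?_) (gt_mem_nhds (hc l))
    have hr : Tendsto (fun n => rmin S (s n) k z) U (𝓝 (rmin S σ k z)) := by
      have hcr := continuousAt_rbound (X := ℝ × ℝ) (ρ₀ := Prod.fst) (φ := Prod.snd)
        (g := fun _ => gamD S k z) (a := fun _ => quadD S k (z.1 k)) (x := (σ.ρ k, σ.φ k))
        continuousAt_fst continuousAt_snd continuousAt_const continuousAt_const
        (hσ.init.2.2.2.1 k).ne' (gamD_pos S k hzc).ne'
      exact hcr.tendsto.comp ((hρ k).prodMk_nhds (hφ k))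
    exact A.c_lim (hρ k) (hσ.init.2.2.1 k)
      ((h.eventually_good hU).mono fun n hn => trT_nonneg (hn.cone.1 k) l) (htr l k)
      (trT_nonneg (hσ.cone.1 k) l) hr (hz.2.2.2.2.2 l k)
  obtain ⟨-, -, -, R, hR1, -, hR3⟩ := h.converges
  have hlimpt : IsLimitPoint s σ.x σ.u := mapClusterPt_iff_ultrafilter.2 ⟨U, hU, ht⟩
  rw [surr_self S hσ.domain, (hR3 _ _ hlimpt).1]
  have hl : Tendsto (fun n => surr S ((s n).x, (s n).u) z) U (𝓝 (surr S (σ.x, σ.u) z)) :=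
    (continuousAt_surr_left S hσ.domain hzc).tendsto.comp ht
  -- Late in the run `z` is a competitor, so its surrogate value is at most the optimal value, which
  -- tends to the sum rate at the limit point.
  refine le_of_tendsto_of_tendsto hl (hR1.mono_left hU) ?_
  filter_upwards [e1, e2, e3] with n h1 h2 h3
  have hf : A.RFeas S (s n) z :=
    ⟨⟨hz.1, hz.2.1, hz.2.2.1, hz.2.2.2.1, fun j => (h1 j).le, h2⟩, fun l => (h3 l).le⟩
  have := (h.2 n).2.1 _ hf.feas
  rwa [surrogate_eq] at this

/-! ### Stationarity -/

theorem Good.rmin_self_le {σ : State K J L M} (h : A.Good S σ) (k : Fin K) :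
    rmin S σ k σ.x ≤ σ.ρ k := rmin_le h.init.2.2.2.1 h.cone h.feas.2.1 k

/-- With the updated `φ` the Young bound is at most the mean of the true ratio and of `μ` times the
signal power. The second is at most `2 ^ ρ - 1` and the first is strictly smaller. -/
theorem Good.rmin_self_lt {σ : State K J L M} (h : A.Good S σ) {k : Fin K}
    (hk : rateD S k σ.x < σ.ρ k) : rmin S σ k σ.x < σ.ρ k := by
  have ha := quadD_pos h.mem k
  have hg := gamD_pos S k h.cone
  have hμ := h.μ_pos k
  have h2 := (Real.logb_lt_iff_lt_rpow (by norm_num) (by positivity)).1 hk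
  have hl : 0 < Real.log 2 := Real.log_pos (by norm_num)
  refine max_lt (h.init.2.2.1 k) ?_
  have h3 : 1 / (2 * σ.φ k) * (1 / gamD S k σ.x) ^ 2 + σ.φ k / 2 * quadD S k (σ.x.1 k) ^ 2
      ≤ (quadD S k (σ.x.1 k) / gamD S k σ.x + σ.μ k * quadD S k (σ.x.1 k)) / 2 := by
    rw [h.φ_eq k]
    have e : 1 / (2 * (σ.μ k / quadD S k (σ.x.1 k))) * (1 / gamD S k σ.x) ^ 2
        + σ.μ k / quadD S k (σ.x.1 k) / 2 * quadD S k (σ.x.1 k) ^ 2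
        = (quadD S k (σ.x.1 k) / gamD S k σ.x * (1 / gamD S k σ.x / σ.μ k)
          + σ.μ k * quadD S k (σ.x.1 k)) / 2 := by
      field_simp
    rw [e]
    have h4 : 1 / gamD S k σ.x / σ.μ k ≤ 1 := (div_le_one hμ).2 (h.μ_ge k)
    have h5 := mul_le_mul_of_nonneg_left h4
      (by positivity : 0 ≤ quadD S k (σ.x.1 k) / gamD S k σ.x)
    linarith
  have h6 := h.ρ_ge k
  have h7 : (1 + (1 / (2 * σ.φ k) * (1 / gamD S k σ.x) ^ 2
      + σ.φ k / 2 * quadD S k (σ.x.1 k) ^ 2)) / (2 : ℝ) ^ σ.ρ k < 1 := by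
    rw [div_lt_one (by positivity)]
    linarith
  have h8 := div_neg_of_neg_of_pos (sub_neg.2 h7) hl
  linarith

/-- The rate bound is exact to first order where it is tight. -/
theorem Good.hasDerivAt_rmin {σ : State K J L M} (h : A.Good S σ) {k : Fin K}
    (hk : rateD S k σ.x = σ.ρ k) (d : Point K J L M) :
    rmin S σ k σ.x = σ.ρ k ∧
      HasDerivAt (fun ε : ℝ => rmin S σ k (σ.x + ε • d)) (rateDL S σ.x k d) 0 := by
  have ha := quadD_pos h.mem k
  have hg := gamD_pos S k h.cone
  have hρ := h.init.2.2.1 k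
  have h2 : (2 : ℝ) ^ σ.ρ k = 1 + quadD S k (σ.x.1 k) / gamD S k σ.x := by
    rw [← hk]
    exact Real.rpow_logb (by norm_num) (by norm_num) (by positivity)
  -- Tightness of the rate bound squeezes `μ` to the reciprocal interference, which also fixes `φ`.
  -- With these values the derivatives of the majorant and of the rate agree.
  have hμ : σ.μ k = 1 / gamD S k σ.x := by
    refine le_antisymm ?_ (h.μ_ge k)
    have h3 := h.ρ_ge k
    rw [h2] at h3
    refine le_of_mul_le_mul_right ?_ ha
    have e : 1 / gamD S k σ.x * quadD S k (σ.x.1 k) = quadD S k (σ.x.1 k) / gamD S k σ.x := by ring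
    linarith
  have hφ : σ.φ k = 1 / (gamD S k σ.x * quadD S k (σ.x.1 k)) := by
    rw [h.φ_eq k, hμ, div_div]
  have hl : Real.log 2 ≠ 0 := (Real.log_pos (by norm_num)).ne'
  set inner : ℝ → ℝ := fun ε => σ.ρ k + ((1 + (1 / (2 * σ.φ k)
    * (1 / gamD S k (σ.x + ε • d)) ^ 2 + σ.φ k / 2 * quadD S k ((σ.x + ε • d).1 k) ^ 2))
      / (2 : ℝ) ^ σ.ρ k - 1) / Real.log 2 with hinner
  have hda : HasDerivAt (fun ε : ℝ => quadD S k ((σ.x + ε • d).1 k)) (sigDL S k d) 0 := by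
    simpa [sigDL_apply] using hasDerivAt_line (sigDL S k) 0 σ.x d
  have hdg : HasDerivAt (fun ε : ℝ => gamD S k (σ.x + ε • d)) (gamDL S k d) 0 := by
    simp only [gamD_eq]
    exact hasDerivAt_line _ _ _ _
  have h0 : inner 0 = σ.ρ k := by
    simp only [hinner, zero_smul, add_zero]
    rw [h2, hφ]
    field_simp
    ring
  have hd : HasDerivAt inner (rateDL S σ.x k d) 0 := by
    have hinv : HasDerivAt (fun ε : ℝ => 1 / gamD S k (σ.x + ε • d))
        (-(gamDL S k d) / gamD S k σ.x ^ 2) 0 := by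
      have := hdg.fun_inv (by rw [zero_smul, add_zero]; exact hg.ne')
      simpa [one_div] using this
    have := ((((((hinv.fun_pow 2).const_mul (1 / (2 * σ.φ k))).add
      ((hda.fun_pow 2).const_mul (σ.φ k / 2))).const_add 1).div_const
        ((2 : ℝ) ^ σ.ρ k)).sub_const 1).div_const (Real.log 2) |>.const_add (σ.ρ k)
    refine this.congr_deriv ?_
    simp only [zero_smul, add_zero, rateDL, LinearMap.sub_apply, LinearMap.smul_apply,
      LinearMap.add_apply, smul_eq_mul, show (2 : ℕ) - 1 = 1 from rfl, pow_one, Nat.cast_ofNat]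
    rw [h2, hφ]
    have hag : quadD S k (σ.x.1 k) + gamD S k σ.x ≠ 0 := by positivity
    have hag' : gamD S k σ.x + quadD S k (σ.x.1 k) ≠ 0 := by positivity
    field_simp
    ring
  -- The maximum with zero is inactive nearby because `ρ` is positive.
  have he : (fun ε : ℝ => rmin S σ k (σ.x + ε • d)) =ᶠ[𝓝 0] inner := by
    have := hd.continuousAt.eventually (lt_mem_nhds (a := 0) (by rw [h0]; exact hρ))
    filter_upwards [this] with ε hε
    exact max_eq_right hε.le
  refine ⟨?_, hd.congr_of_eventuallyEq he⟩
  have := he.eq_of_nhds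
  rw [h0] at this
  simpa using this

theorem eventually_lt_of_hasDerivAt_neg {f : ℝ → ℝ} {f' : ℝ} (h : HasDerivAt f f' 0)
    (hf : f' < 0) : ∀ᶠ ε in 𝓝[>] (0 : ℝ), f ε < f 0 := by
  have h1 := (hasDerivAt_iff_tendsto_slope_zero.1 h).eventually (gt_mem_nhds hf)
  have h2 : ∀ᶠ ε in 𝓝[>] (0 : ℝ), ε⁻¹ • (f (0 + ε) - f 0) < 0 :=
    h1.filter_mono (nhdsWithin_mono (0 : ℝ) (s := Set.Ioi 0) (t := {0}ᶜ) fun _ hx => hx.ne')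
  filter_upwards [h2, self_mem_nhdsWithin] with ε h3 h4
  rw [zero_add, smul_eq_mul] at h3
  by_contra hcon
  have := mul_nonneg (inv_nonneg.2 (le_of_lt h4)) (sub_nonneg.2 (not_lt.1 hcon))
  linarith

/-- Moving from the limit point in a direction that decreases the active loads makes the backhaul
constraints of the limiting subproblem strict. -/
theorem Good.eventually_backhaul {σ : State K J L M} (h : A.Good S σ) {y : Point K J L M}
    (hy : y ∈ convexSet S (A.offOf σ.x) σ.u) (l : Fin L)
    (hd : load S A.w l σ.x = S.C l → A.loadL S σ.x l (y - σ.x) < 0) :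
    ∀ᶠ ε in 𝓝[>] (0 : ℝ), ∑ k, A.c l k (σ.ρ k) (trT (σ.x.1 k) l)
      (rmin S σ k (σ.x + ε • (y - σ.x))) (trT ((σ.x + ε • (y - σ.x)).1 k) l) < S.C l := by
  set d := y - σ.x with hdef
  have ht : ∀ k, 0 ≤ trT (σ.x.1 k) l := fun k => trT_nonneg (h.cone.1 k) l
  have hρ := h.init.2.2.1
  have hw : ∀ k, 0 ≤ A.w l k (trT (σ.x.1 k) l) := fun k => A.w_nonneg l k (ht k)
  have hle : ∀ k ∈ Finset.univ, A.w l k (trT (σ.x.1 k) l) * rateD S k σ.x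
      ≤ A.w l k (trT (σ.x.1 k) l) * σ.ρ k := fun k _ =>
    mul_le_mul_of_nonneg_left (h.rateD_le k) (hw k)
  set E : ℝ → ℝ := fun ε => ∑ k, A.c l k (σ.ρ k) (trT (σ.x.1 k) l)
      (rmin S σ k (σ.x + ε • d)) (trT ((σ.x + ε • d).1 k) l) with hE
  by_cases hact : load S A.w l σ.x = S.C l
  -- The capacity lies above the load computed with `ρ`, which lies above the true load. For an
  -- active constraint all three coincide, so the summands agree one by one.
  · have heq : ∀ k, A.w l k (trT (σ.x.1 k) l) = 0 ∨ rateD S k σ.x = σ.ρ k := by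
      have h1 : ∑ k, A.w l k (trT (σ.x.1 k) l) * rateD S k σ.x
          = ∑ k, A.w l k (trT (σ.x.1 k) l) * σ.ρ k :=
        le_antisymm (Finset.sum_le_sum hle) ((h.load_le l).trans (le_of_eq hact.symm))
      intro k
      have h2 := (Finset.sum_eq_sum_iff_of_le hle).1 h1 k (Finset.mem_univ k)
      rcases mul_eq_mul_left_iff.1 h2 with h3 | h3
      · exact Or.inr h3
      · exact Or.inl h3
    have hderiv : ∀ k, A.c l k (σ.ρ k) (trT (σ.x.1 k) l) (rmin S σ k σ.x) (trT (σ.x.1 k) l)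
          = A.w l k (trT (σ.x.1 k) l) * rateD S k σ.x ∧
        HasDerivAt (fun ε : ℝ => A.c l k (σ.ρ k) (trT (σ.x.1 k) l)
          (rmin S σ k (σ.x + ε • d)) (trT ((σ.x + ε • d).1 k) l))
        (((A.wd l k (trT (σ.x.1 k) l) * rateD S k σ.x) • linkL l k
          + A.w l k (trT (σ.x.1 k) l) • rateDL S σ.x k : Point K J L M →ₗ[ℝ] ℝ) d) 0 := by
      intro k
      simp only [LinearMap.add_apply, LinearMap.smul_apply, smul_eq_mul]
      -- A link of zero weight has zero majorant and contributes nothing to the derivative along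
      -- `d`, whether or not its rate bound is tight.
      rcases (hw k).eq_or_lt with hw0 | hw0
      · have hoff : A.off l k (trT (σ.x.1 k) l) → linkL l k d = 0 := by
          intro ho
          rw [hdef, map_sub, linkL_apply, linkL_apply, hy.2.2.2.2.2 l k ho,
            h.mem.2.2.2.2.2 l k ho, sub_zero]
        have h3 := A.wd_zero hw0.symm hoff
        have e : A.wd l k (trT (σ.x.1 k) l) * rateD S k σ.x * linkL l k d
            + A.w l k (trT (σ.x.1 k) l) * rateDL S σ.x k d = 0 := by
          rw [mul_right_comm, h3, ← hw0]
          ring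
        rw [e]
        simp only [A.c_zero (ht k) hw0.symm, ← hw0, zero_mul, true_and]
        exact hasDerivAt_const _ _
      · have htight := (heq k).resolve_left hw0.ne'
        obtain ⟨hr0, hr⟩ := h.hasDerivAt_rmin htight d
        have hr0' : rmin S σ k (σ.x + (0 : ℝ) • d) = σ.ρ k := by rw [zero_smul, add_zero, hr0]
        refine ⟨by rw [hr0, A.c_self (hρ k) (ht k), htight], ?_⟩
        have h4 := A.c_deriv (l := l) (k := k) (t₀ := trT (σ.x.1 k) l) (t' := linkL l k d)
          (r := fun ε : ℝ => rmin S σ k (σ.x + ε • d)) (by rw [hr0']; exact hρ k) (ht k) hw0 hr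
        simp only [hr0'] at h4
        simp only [linkL_line]
        refine h4.congr_deriv ?_
        rw [htight]
        ring
    have hEd : HasDerivAt E (A.loadL S σ.x l d) 0 := by
      have := HasDerivAt.fun_sum fun k (_ : k ∈ Finset.univ) => (hderiv k).2
      simpa only [loadL, LinearMap.sum_apply] using this
    have hE0 : E 0 = S.C l := by
      rw [← hact]
      simp only [hE, zero_smul, add_zero]
      exact Finset.sum_congr rfl fun k _ => (hderiv k).1
    have := eventually_lt_of_hasDerivAt_neg hEd (hd hact)
    rwa [hE0] at this
  · have hlt : load S A.w l σ.x < S.C l := lt_of_le_of_ne (h.isFeasible.2 l) hact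
    have hc : ∀ k, A.c l k (σ.ρ k) (trT (σ.x.1 k) l) (rmin S σ k σ.x) (trT (σ.x.1 k) l)
        ≤ A.w l k (trT (σ.x.1 k) l) * σ.ρ k := fun k =>
      (A.c_mono (hρ k) (h.rmin_self_le k)).trans (le_of_eq (A.c_self (hρ k) (ht k)))
    have hE0 : E 0 < S.C l := by
      simp only [hE, zero_smul, add_zero]
      -- A loose rate bound on a link of positive weight gives slack at once; otherwise the load
      -- computed with `ρ` equals the true load, which is below capacity.
      by_cases hloose : ∃ k, 0 < A.w l k (trT (σ.x.1 k) l) ∧ rateD S k σ.x < σ.ρ k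
      · obtain ⟨k, hk, hk'⟩ := hloose
        refine (Finset.sum_lt_sum (fun k _ => hc k) ⟨k, Finset.mem_univ k, ?_⟩).trans_le
          (h.load_le l)
        exact A.c_strict (hρ k) (ht k) hk (h.rmin_self_lt hk')
      · push Not at hloose
        refine (Finset.sum_le_sum fun k _ => (hc k).trans ?_).trans_lt hlt
        rcases (hw k).eq_or_lt with hw0 | hw0
        · simp [← hw0]
        · exact mul_le_mul_of_nonneg_left (hloose k hw0) (hw k)
    have hcont : ContinuousAt E 0 := by
      refine tendsto_finsetSum _ fun k _ => ?_
      have hline : ContinuousAt (fun ε : ℝ => σ.x + ε • d) 0 :=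
        Continuous.continuousAt (by fun_prop)
      have hr : ContinuousAt (fun ε : ℝ => rmin S σ k (σ.x + ε • d)) 0 := by
        refine ContinuousAt.comp (g := fun x => rmin S σ k x) ?_ hline
        rw [zero_smul, add_zero]
        exact continuousAt_rmin h.init.2.2.2.1 h.cone k
      exact ContinuousAt.comp (g := fun p : ℝ × ℝ => A.c l k (σ.ρ k) (trT (σ.x.1 k) l) p.1 p.2)
        (A.c_cont (hρ k)).continuousAt (hr.prodMk (hasDerivAt_link l k d).continuousAt)
    exact (hcont.eventually (gt_mem_nhds hE0)).filter_mono nhdsWithin_le_nhds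

theorem line_mem_convexSet {off : Fin L → Fin K → Prop} {u : Receiver J M} {x y : Point K J L M}
    (hx : x ∈ convexSet S off u) (hy : y ∈ convexSet S off u) {ε : ℝ} (h0 : 0 ≤ ε) (h1 : ε ≤ 1) :
    x + ε • (y - x) ∈ convexSet S off u :=
  (convex_convexSet S off u).add_smul_sub_mem hx hy ⟨h0, h1⟩

/-- No direction of descent of the active loads that makes the uplink constraints strict improves the
sum rate to first order. -/
theorem IsRun.sumRateL_nonpos (h : A.IsRun S s) {U : Ultrafilter ℕ}
    (hU : (U : Filter ℕ) ≤ atTop) {σ : State K J L M} (hσ : A.Good S σ)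
    (ht : Tendsto (fun n => ((s n).x, (s n).u)) U (𝓝 (σ.x, σ.u)))
    (hρ : ∀ k, Tendsto (fun n => (s n).ρ k) U (𝓝 (σ.ρ k)))
    (hφ : ∀ k, Tendsto (fun n => (s n).φ k) U (𝓝 (σ.φ k)))
    {y : Point K J L M} (hy : y ∈ convexSet S (A.offOf σ.x) σ.u)
    (hq : ∀ j, qosU S σ.u j y < 0)
    (hd : ∀ l, load S A.w l σ.x = S.C l → A.loadL S σ.x l (y - σ.x) < 0) :
    sumRateL S σ.u σ.x (y - σ.x) ≤ 0 := by
  by_contra hcon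
  push Not at hcon
  have h1 := eventually_lt_of_hasDerivAt_neg (hasDerivAt_surr hσ.domain (y - σ.x)).neg
    (neg_neg_of_pos hcon)
  have h2 : ∀ᶠ ε in 𝓝[>] (0 : ℝ), ∀ l, ∑ k, A.c l k (σ.ρ k) (trT (σ.x.1 k) l)
      (rmin S σ k (σ.x + ε • (y - σ.x))) (trT ((σ.x + ε • (y - σ.x)).1 k) l) < S.C l :=
    eventually_all.2 fun l => hσ.eventually_backhaul hy l (hd l)
  have h3 : ∀ᶠ ε in 𝓝[>] (0 : ℝ), ε < 1 :=
    (gt_mem_nhds one_pos).filter_mono nhdsWithin_le_nhds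
  obtain ⟨ε, h1, h2, h3, h4⟩ := (h1.and (h2.and (h3.and self_mem_nhdsWithin))).exists
  have h4 : 0 < ε := h4
  have hz := line_mem_convexSet hσ.mem hy h4.le h3.le
  have hqz : ∀ j, qosU S σ.u j (σ.x + ε • (y - σ.x)) < 0 := by
    intro j
    have e : σ.x + ε • (y - σ.x) = (1 - ε) • σ.x + ε • y := by module
    rw [e, qosU_combo S σ.u j σ.x y (by ring)]
    have h5 : qosU S σ.u j σ.x ≤ 0 := hσ.mem.2.2.2.2.1 j
    have h6 := mul_neg_of_pos_of_neg h4 (hq j)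
    have h7 := mul_nonpos_of_nonneg_of_nonpos (sub_nonneg.2 h3.le) h5
    linarith
  have := h.surr_le_of_strict hU hσ ht hρ hφ hz hqz h2
  simp only [Pi.neg_apply, zero_smul, add_zero] at h1
  linarith

/-- Regular limit points are stationary. -/
theorem IsRun.isStationary (h : A.IsRun S s) {x : Point K J L M} {u : Receiver J M}
    (hl : IsLimitPoint s x u) :
    IsFeasible S A.w (A.offOf x) u x ∧
      (IsRegular S A.w (A.offOf x) u x → IsStationary S A.w (A.offOf x) u x) := by
  obtain ⟨U, hU, ht⟩ := mapClusterPt_iff_ultrafilter.1 hl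
  obtain ⟨σ, rfl, rfl, hσ, hρ, hφ⟩ := h.exists_limit hU ht
  refine ⟨hσ.isFeasible, ?_⟩
  rintro ⟨y₀, hy₀, hq₀, hd₀⟩
  simp only [A.lineDeriv_load hσ.cone] at hd₀
  set X := convexSet S (A.offOf σ.x) σ.u with hX
  -- Uplink QoS must be strict because it is the only part of the convex set that moves with the
  -- receivers; a strict inequality persists for late iterates.
  let D : Set (Point K J L M) := {d | σ.x + d ∈ X ∧ ∀ j, qosU S σ.u j (σ.x + d) < 0}
  have hDc : Convex ℝ D := by
    rintro d ⟨hd, hd'⟩ e ⟨he, he'⟩ a b ha hb hab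
    have e1 : σ.x + (a • d + b • e) = a • (σ.x + d) + b • (σ.x + e) := by
      have : b = 1 - a := by linarith
      subst this
      module
    refine ⟨?_, fun j => ?_⟩
    · rw [e1]
      exact convex_convexSet S _ _ hd he ha hb hab
    · rw [e1, qosU_combo S σ.u j _ _ hab]
      rcases ha.eq_or_lt with rfl | ha
      · have : b = 1 := by linarith
        subst this
        simpa using he' j
      · have h1 := mul_neg_of_pos_of_neg ha (hd' j)
        have h2 := mul_nonpos_of_nonneg_of_nonpos hb (he' j).le
        linarith
  have hadd : ∀ y : Point K J L M, σ.x + (y - σ.x) = y := fun y => by abel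
  classical
  obtain ⟨ν, hν0, hν⟩ := exists_multipliers (ι := {l // load S A.w l σ.x = S.C l}) hDc
    (sumRateL S σ.u σ.x) (fun l => A.loadL S σ.x l) (d₀ := y₀ - σ.x)
    ⟨by rw [hadd]; exact hy₀, fun j => by rw [hadd]; exact hq₀ j⟩ (fun l => hd₀ l l.2)
    (fun d hd hdl => by
      have e : d = σ.x + d - σ.x := by abel
      rw [e]
      refine h.sumRateL_nonpos hU hσ ht hρ hφ hd.1 hd.2 fun l hl => ?_
      rw [← e]
      exact hdl ⟨l, hl⟩)
  refine ⟨hσ.isFeasible, fun l => if hl : load S A.w l σ.x = S.C l then ν ⟨l, hl⟩ else 0,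
    fun l => ?_, fun l => ?_, fun y hy => ?_⟩
  · dsimp only
    split_ifs with hl
    · exact hν0 _
    · exact le_rfl
  · dsimp only
    split_ifs with hl
    · rw [hl, sub_self, mul_zero]
    · rw [zero_mul]
  · simp only [A.lineDeriv_load hσ.cone, lineDeriv_sumRate hσ.domain]
    set Φ : Point K J L M →ₗ[ℝ] ℝ := sumRateL S σ.u σ.x
      - ∑ l : {l // load S A.w l σ.x = S.C l}, ν l • A.loadL S σ.x l with hΦ
    have hsum : sumRateL S σ.u σ.x (y - σ.x) - ∑ l, (if hl : load S A.w l σ.x = S.C l then ν ⟨l, hl⟩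
        else 0) * A.loadL S σ.x l (y - σ.x) = Φ (y - σ.x) := by
      simp only [hΦ, LinearMap.sub_apply, LinearMap.sum_apply, LinearMap.smul_apply, smul_eq_mul]
      congr 1
      simp only [dite_mul, zero_mul]
      rw [Finset.sum_dite]
      simp only [Finset.sum_const_zero, add_zero]
      refine Finset.sum_bij (fun l _ => ⟨l.1, (Finset.mem_filter.1 l.2).2⟩) (by simp) ?_ ?_ ?_
      · intro a _ b _ hab
        exact Subtype.ext (congrArg (fun l => l.1) hab)
      · rintro ⟨b, hb⟩ _
        exact ⟨⟨b, by simp [hb]⟩, by simp, rfl⟩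
      · intro a _
        rfl
    rw [hsum]
    have hΦD : ∀ d ∈ D, Φ d ≤ 0 := by
      intro d hd
      have := hν d hd
      simp only [hΦ, LinearMap.sub_apply, LinearMap.sum_apply, LinearMap.smul_apply, smul_eq_mul]
      linarith
    -- Mixing `y` with the regular direction `y₀` makes the uplink constraints strict; letting `τ`
    -- tend to zero extends the inequality from `D` to the whole convex set.
    have hτ : ∀ᶠ τ in 𝓝[>] (0 : ℝ),
        (1 - τ) * Φ (y - σ.x) + τ * Φ (y₀ - σ.x) ≤ 0 := by
      have h3 : ∀ᶠ τ in 𝓝[>] (0 : ℝ), τ < 1 :=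
        (gt_mem_nhds one_pos).filter_mono nhdsWithin_le_nhds
      filter_upwards [h3, self_mem_nhdsWithin] with τ h3 h4
      have h4 : 0 < τ := h4
      have e : σ.x + ((1 - τ) • (y - σ.x) + τ • (y₀ - σ.x)) = (1 - τ) • y + τ • y₀ := by module
      have := hΦD ((1 - τ) • (y - σ.x) + τ • (y₀ - σ.x)) ⟨?_, fun j => ?_⟩
      · simpa only [map_add, map_smul, smul_eq_mul] using this
      · rw [e]
        exact convex_convexSet S _ _ hy hy₀ (by linarith) h4.le (by ring)
      · rw [e, qosU_combo S σ.u j _ _ (by ring)]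
        have h1 := mul_neg_of_pos_of_neg h4 (hq₀ j)
        have h1' : τ * qosU S σ.u j y₀ < 0 := h1
        have h2 : qosU S σ.u j y ≤ 0 := hy.2.2.2.2.1 j
        have h5 := mul_nonpos_of_nonneg_of_nonpos (sub_nonneg.2 h3.le) h2
        linarith
    have hcont : Tendsto (fun τ : ℝ => (1 - τ) * Φ (y - σ.x) + τ * Φ (y₀ - σ.x)) (𝓝[>] 0)
        (𝓝 (Φ (y - σ.x))) := by
      have : Continuous fun τ : ℝ => (1 - τ) * Φ (y - σ.x) + τ * Φ (y₀ - σ.x) := by fun_prop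
      have h5 := (this.tendsto 0).mono_left (nhdsWithin_le_nhds (s := Set.Ioi 0))
      simpa using h5
    exact le_of_tendsto hcont hτ

end Scheme

/-! ### The first stage -/

section FirstStage

variable (S : System K J L Z M)

theorem lam_zero : lam S 0 = 0 := by simp [lam]

theorem lam_mono {t t' : ℝ} (h : t ≤ t') : lam S t ≤ lam S t' := by
  have := mul_le_mul_of_nonneg_left h S.theta_pos.le
  exact sub_le_sub_left (Real.exp_le_exp.2 (by linarith)) _

theorem lam_pos {t : ℝ} (h : 0 < t) : 0 < lam S t := by
  have := mul_pos S.theta_pos h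
  exact sub_pos.2 (Real.exp_lt_one_iff.2 (by linarith))

theorem lam_nonneg {t : ℝ} (h : 0 ≤ t) : 0 ≤ lam S t := (lam_zero S).symm.trans_le (lam_mono S h)

theorem lam_eq_zero {t : ℝ} (h : 0 ≤ t) (h0 : lam S t = 0) : t = 0 := by
  by_contra hne
  exact (lam_pos S (h.lt_of_ne' hne)).ne' h0

theorem hasDerivAt_lam (t : ℝ) :
    HasDerivAt (lam S) (S.theta * Real.exp (-S.theta * t)) t := by
  have := (((hasDerivAt_id t).const_mul (-S.theta)).exp).const_sub 1
  refine this.congr_deriv ?_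
  simp
  ring

theorem Psi_eq (t₀ t : ℝ) : Psi S t₀ t = Real.log (lam S t₀)
    + S.theta * Real.exp (-S.theta * t₀) / lam S t₀ * (t - t₀) := by
  unfold Psi lam
  ring

/-- Two tangent bounds are composed, one for the logarithm and one for the concave function `lam`.
-/
theorem log_lam_le_Psi {t₀ t : ℝ} (h₀ : 0 < t₀) (h : 0 < t) :
    Real.log (lam S t) ≤ Psi S t₀ t := by
  have hl₀ := lam_pos S h₀
  have hl := lam_pos S h
  have h1 := Real.log_le_sub_one_of_pos (div_pos hl hl₀)
  rw [Real.log_div hl.ne' hl₀.ne'] at h1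
  have h2 : lam S t / lam S t₀ - 1
      ≤ S.theta * Real.exp (-S.theta * t₀) / lam S t₀ * (t - t₀) := by
    have e : lam S t / lam S t₀ - 1 = (lam S t - lam S t₀) / lam S t₀ := by
      field_simp
    rw [e, div_mul_eq_mul_div]
    refine div_le_div_of_nonneg_right ?_ hl₀.le
    have h3 := Real.add_one_le_exp (-S.theta * (t - t₀))
    have h4 : Real.exp (-S.theta * t)
        = Real.exp (-S.theta * t₀) * Real.exp (-S.theta * (t - t₀)) := by
      rw [← Real.exp_add]
      ring_nf
    have h5 := mul_le_mul_of_nonneg_left h3 (Real.exp_pos (-S.theta * t₀)).le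
    unfold lam
    nlinarith
  rw [Psi_eq]
  linarith

open Classical in
/-- The backhaul part of the first stage. -/
def firstStage : Scheme K L where
  off _ _ t := t = 0
  w := weight1 S
  wd _ _ t := S.theta * Real.exp (-S.theta * t)
  c _ _ ρ₀ t₀ ρ t :=
    -- The least `ρhat` allowed by the linearized constraint, or by its limiting form.
    if t₀ = 0 then 0 else Real.exp ((ρ - ρ₀) / ρ₀ + Real.log ρ₀ + Psi S t₀ t)
  off_trans := fun _ h => h
  off_lim := fun hτ h => hτ.eventually_ne h
  off_closed := fun _ _ h => h
  w_nonneg := fun _ _ _ h => lam_nonneg S h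
  w_deriv := fun _ _ t => hasDerivAt_lam S t
  w_pos := fun t₁ h => ⟨lam S t₁, lam_pos S h, fun _ _ _ _ _ ht => lam_mono S ht⟩
  wd_zero := by
    intro _ _ t t' h0 h
    by_cases ht : t = 0
    · rw [h ht, mul_zero]
    · have h1 : lam S t = 0 := h0
      have h2 : Real.exp (-S.theta * t) = 1 := by
        unfold lam at h1
        linarith
      rw [Real.exp_eq_one_iff] at h2
      simp [S.theta_pos.ne', ht] at h2
  le_c := by
    intro _ _ ρ₀ t₀ ρ t hρ₀ hρ ht₀ ht hoff
    change lam S t * ρ ≤ _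
    split_ifs with h0
    · rw [hoff h0, lam_zero, zero_mul]
    · have ht₀' := ht₀.lt_of_ne' h0
      rcases ht.eq_or_lt with rfl | ht
      · rw [lam_zero, zero_mul]
        positivity
      · have hl := lam_pos S ht
        have h1 := Real.log_le_sub_one_of_pos (div_pos hρ hρ₀)
        rw [Real.log_div hρ.ne' hρ₀.ne'] at h1
        have h2 := log_lam_le_Psi S ht₀' ht
        have e : (ρ - ρ₀) / ρ₀ = ρ / ρ₀ - 1 := by field_simp
        calc lam S t * ρ = Real.exp (Real.log (lam S t) + Real.log ρ) := by
              rw [Real.exp_add, Real.exp_log hl, Real.exp_log hρ]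
          _ ≤ _ := Real.exp_le_exp.2 (by rw [e]; linarith)
  c_self := by
    intro _ _ ρ₀ t₀ hρ₀ ht₀
    change _ = lam S t₀ * ρ₀
    split_ifs with h0
    · rw [h0, lam_zero, zero_mul]
    · have hl := lam_pos S (ht₀.lt_of_ne' h0)
      rw [Psi_eq, sub_self, sub_self, zero_div, zero_add, mul_zero, add_zero, Real.exp_add,
        Real.exp_log hρ₀, Real.exp_log hl, mul_comm]
  c_mono := by
    intro _ _ ρ₀ t₀ t hρ₀ ρ ρ' h
    dsimp only
    split_ifs
    · exact le_rfl
    · gcongr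
  c_cont := by
    intro _ _ ρ₀ t₀ _
    split_ifs
    · exact continuous_const
    · simp only [Psi_eq]
      fun_prop
  c_lim := by
    intro _ _ F ρ₀ τ₀ r ρ t₀ r' t hρ hρ0 hτ0 hτ ht₀ hr hoff
    have hρ1 := hρ.eventually (lt_mem_nhds hρ0)
    have hA : Tendsto (fun n => (r n - ρ₀ n) / ρ₀ n) F (𝓝 ((r' - ρ) / ρ)) :=
      (hr.sub hρ).div hρ hρ0.ne'
    have hlam : Tendsto (fun n => lam S (τ₀ n)) F (𝓝 (lam S t₀)) :=
      (hasDerivAt_lam S t₀).continuousAt.tendsto.comp hτ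
    -- On a link that dies out in the limit the test trace is zero, where the tangent `Psi` is at
    -- most `log (lam S (τ₀ n))`. The majorant is thus dominated by a multiple of `lam S (τ₀ n)`,
    -- which tends to zero.
    by_cases h0 : t₀ = 0
    · rw [if_pos h0, hoff h0]
      rw [h0, lam_zero] at hlam
      have hb : Tendsto (fun n => Real.exp ((r n - ρ₀ n) / ρ₀ n) * ρ₀ n * lam S (τ₀ n)) F (𝓝 0) := by
        have := ((Real.continuous_exp.tendsto _).comp hA).mul hρ |>.mul hlam
        rwa [mul_zero] at this
      refine tendsto_of_tendsto_of_tendsto_of_le_of_le' tendsto_const_nhds hb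
        (Eventually.of_forall fun n => ?_) ?_
      · split_ifs <;> positivity
      · filter_upwards [hρ1, hτ0] with n h1 h2
        split_ifs with h3
        · exact mul_nonneg (by positivity) (lam_nonneg S h2)
        · have hl := lam_pos S (h2.lt_of_ne' h3)
          rw [Psi_eq, zero_sub, Real.exp_add, Real.exp_add, Real.exp_log h1]
          refine mul_le_mul_of_nonneg_left ?_ (by positivity)
          rw [Real.exp_add, Real.exp_log hl]
          refine mul_le_of_le_one_right hl.le (Real.exp_le_one_iff.2 ?_)
          have h5 := S.theta_pos
          exact mul_nonpos_of_nonneg_of_nonpos (by positivity) (by linarith)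
    · have hl := lam_pos S (ht₀.lt_of_ne' h0)
      rw [if_neg h0]
      have hmain : Tendsto (fun n => Real.exp ((r n - ρ₀ n) / ρ₀ n + Real.log (ρ₀ n)
          + Psi S (τ₀ n) t)) F (𝓝 (Real.exp ((r' - ρ) / ρ + Real.log ρ + Psi S t₀ t))) := by
        refine (Real.continuous_exp.tendsto _).comp ((hA.add (hρ.log hρ0.ne')).add ?_)
        simp only [Psi_eq]
        have he : Tendsto (fun n => S.theta * Real.exp (-S.theta * τ₀ n)) F
            (𝓝 (S.theta * Real.exp (-S.theta * t₀))) :=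
          ((Real.continuous_exp.tendsto _).comp (hτ.const_mul _)).const_mul _
        exact (hlam.log hl.ne').add ((he.div hlam hl.ne').mul (tendsto_const_nhds.sub hτ))
      refine hmain.congr' ?_
      filter_upwards [hτ.eventually_ne h0] with n hn
      rw [if_neg hn]
  c_zero := by
    intro _ _ ρ₀ t₀ ρ t ht₀ h0
    exact if_pos (lam_eq_zero S ht₀ h0)
  c_strict := by
    intro _ _ ρ₀ t₀ ρ hρ₀ ht₀ hw h
    change _ < lam S t₀ * ρ₀
    have hl : 0 < lam S t₀ := hw
    have h0 : t₀ ≠ 0 := by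
      rintro rfl
      rw [lam_zero] at hl
      exact lt_irrefl _ hl
    rw [if_neg h0, Psi_eq, sub_self, mul_zero, add_zero, Real.exp_add, Real.exp_add,
      Real.exp_log hρ₀, Real.exp_log hl, mul_comm (lam S t₀)]
    refine mul_lt_mul_of_pos_right ?_ hl
    refine mul_lt_of_lt_one_left hρ₀ (Real.exp_lt_one_iff.2 ?_)
    exact div_neg_of_neg_of_pos (by linarith) hρ₀
  c_deriv := by
    intro _ _ t₀ t' ρ' r hr0 ht₀ hw hr
    change HasDerivAt _ (_ + lam S t₀ * ρ') 0
    have hl : 0 < lam S t₀ := hw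
    have h0 : t₀ ≠ 0 := by
      rintro rfl
      rw [lam_zero] at hl
      exact lt_irrefl _ hl
    simp only [if_neg h0, Psi_eq, add_sub_cancel_left]
    have h1 : HasDerivAt (fun ε : ℝ => (r ε - r 0) / r 0 + Real.log (r 0)
        + (Real.log (lam S t₀) + S.theta * Real.exp (-S.theta * t₀) / lam S t₀ * (ε * t')))
        (ρ' / r 0 + S.theta * Real.exp (-S.theta * t₀) / lam S t₀ * t') 0 := by
      have h2 := ((hr.sub_const (r 0)).div_const (r 0)).add_const (Real.log (r 0))
      have h3 := (((hasDerivAt_id (0 : ℝ)).mul_const t').const_mul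
        (S.theta * Real.exp (-S.theta * t₀) / lam S t₀)).const_add (Real.log (lam S t₀))
      exact (h2.add h3).congr_deriv (by simp)
    refine h1.exp.congr_deriv ?_
    rw [sub_self, zero_div, zero_add, zero_mul, mul_zero, add_zero, Real.exp_add,
      Real.exp_log hr0, Real.exp_log hl]
    field_simp
    ring

variable {S}

theorem Feasible1.feas {s : State K J L M} {v : Vars K J L M} {ρhat : Fin L → Fin K → ℝ}
    (hs : IsInit s) (h : Feasible1 S s v ρhat) : (firstStage S).Feas S s v := by
  obtain ⟨h1, h2, h3, h4⟩ := h
  refine ⟨⟨h1.1, h1.2.1, h1.2.2.1, h1.2.2.2.1, h1.2.2.2.2.1, fun l k hlk => ((h3 l k).2 hlk).2⟩,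
    h2, fun l => (Finset.sum_le_sum fun k _ => ?_).trans (h4 l)⟩
  change (if _ then _ else _) ≤ _
  split_ifs with h0
  · exact ((h3 l k).2 h0).1
  · obtain ⟨h5, h6⟩ := (h3 l k).1 ((trT_nonneg (hs.1 k) l).lt_of_ne' h0)
    exact (Real.le_log_iff_exp_le h5).1 h6

theorem Scheme.Feas.feasible1 {s : State K J L M} {v : Vars K J L M}
    (h : (firstStage S).Feas S s v) : ∃ ρhat, Feasible1 S s v ρhat := by
  obtain ⟨h1, h2, h3⟩ := h
  refine ⟨fun l k => (firstStage S).c l k (s.ρ k) (trT (s.x.1 k) l) (v.ρ k) (trT (v.x.1 k) l),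
    ⟨h1.1, h1.2.1, h1.2.2.1, h1.2.2.2.1, h1.2.2.2.2.1, fun _ _ h => h.elim⟩, h2,
    fun l k => ⟨fun h0 => ?_, fun h0 => ⟨?_, h1.2.2.2.2.2 l k h0⟩⟩, h3⟩
  · have e : (firstStage S).c l k (s.ρ k) (trT (s.x.1 k) l) (v.ρ k) (trT (v.x.1 k) l)
        = Real.exp ((v.ρ k - s.ρ k) / s.ρ k + Real.log (s.ρ k)
          + Psi S (trT (s.x.1 k) l) (trT (v.x.1 k) l)) := if_neg h0.ne'
    beta_reduce
    rw [e, Real.log_exp]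
    exact ⟨Real.exp_pos _, le_rfl⟩
  · have e : (firstStage S).c l k (s.ρ k) (trT (s.x.1 k) l) (v.ρ k) (trT (v.x.1 k) l) = 0 :=
      if_pos h0
    exact e.ge

/-- Eliminating `ρhat` needs nonnegative traces at the current state, so the invariants are
propagated by induction together with the translation. -/
theorem IsRun1.isRun {s : ℕ → State K J L M} (h : IsRun1 S s) : (firstStage S).IsRun S s := by
  have hf : ∀ n, IsInit (s n) → (firstStage S).Feas S (s n) (s (n + 1)).toVars := fun n hn => by
    obtain ⟨ρhat, hρ⟩ := (h.2 n).1
    exact Feasible1.feas hn hρ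
  have hinit : ∀ n, IsInit (s n) := by
    intro n
    induction n with
    | zero => exact h.1
    | succ n ih => exact (Scheme.Feas.good ih (hf n ih) (h.2 n).2.2).init
  refine ⟨h.1, fun n => ⟨hf n (hinit n), fun v hv => ?_, (h.2 n).2.2⟩⟩
  obtain ⟨ρhat, hρ⟩ := hv.feasible1
  exact (h.2 n).2.1 v ρhat hρ

theorem Scheme.IsRun.isRun1 {s : ℕ → State K J L M} (h : (firstStage S).IsRun S s) :
    IsRun1 S s :=
  ⟨h.1, fun n => ⟨(h.2 n).1.feasible1, fun v _ hv => (h.2 n).2.1 v (Feasible1.feas (h.isInit n) hv),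
    (h.2 n).2.2⟩⟩

end FirstStage

/-! ### The second stage -/

section SecondStage

theorem weight2_of_assoc {ψ : Fin L → Fin K → Prop} {l : Fin L} {k : Fin K} (h : ψ l k) (t : ℝ) :
    weight2 ψ l k t = 1 := if_pos h

theorem weight2_nonneg (ψ : Fin L → Fin K → Prop) (l : Fin L) (k : Fin K) (t : ℝ) :
    0 ≤ weight2 ψ l k t := by
  unfold weight2
  split_ifs <;> norm_num

theorem hasDerivAt_weight2 (ψ : Fin L → Fin K → Prop) (l : Fin L) (k : Fin K) (t : ℝ) :
    HasDerivAt (weight2 ψ l k) 0 t := hasDerivAt_const _ _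

/-- The backhaul part of the second stage. -/
def secondStage (ψ : Fin L → Fin K → Prop) : Scheme K L where
  off l k _ := ¬ ψ l k
  w := weight2 ψ
  wd _ _ _ := 0
  -- The weights are constant, so the load is already linear in `ρ` and needs no approximation.
  c l k _ _ ρ t := weight2 ψ l k t * ρ
  off_trans := fun h => h
  off_lim := fun _ h => Eventually.of_forall fun _ => h
  off_closed := fun hτ h h0 =>
    tendsto_nhds_unique (hτ.congr' (h.mono fun _ hn => hn h0)) tendsto_const_nhds
  w_nonneg := fun l k t _ => weight2_nonneg ψ l k t
  w_deriv := hasDerivAt_weight2 ψ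
  w_pos := fun _ _ => ⟨1, one_pos, fun _ _ _ t h _ => (weight2_of_assoc (not_not.1 h) t).ge⟩
  wd_zero := fun _ _ => zero_mul _
  le_c := fun _ _ _ _ _ => le_rfl
  c_self := fun _ _ => rfl
  c_mono := fun _ _ _ h => mul_le_mul_of_nonneg_left h (weight2_nonneg ψ _ _ _)
  c_cont := fun {l k _ _} _ => by
    have : Continuous (weight2 ψ l k) := continuous_const
    fun_prop
  c_lim := fun _ _ _ _ _ hr _ => hr.const_mul _
  c_zero := fun {l k _ t₀ ρ t} _ h => by
    have h' : weight2 ψ l k t = 0 := h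
    change weight2 ψ l k t * ρ = 0
    rw [h', zero_mul]
  c_strict := fun _ _ hw h => mul_lt_mul_of_pos_left h hw
  c_deriv := fun {l k t₀ t' ρ' r} _ _ _ hr => by
    refine (hr.const_mul (weight2 ψ l k t₀)).congr_deriv ?_
    ring

variable {S : System K J L Z M} {ψ : Fin L → Fin K → Prop}

theorem secondStage_feas {s : State K J L M} {v : Vars K J L M} :
    (secondStage ψ).Feas S s v ↔ Feasible2 S ψ s v := by
  classical
  refine and_congr Iff.rfl (and_congr Iff.rfl (forall_congr' fun l => ?_))
  refine iff_of_eq (congrArg (· ≤ S.C l) ?_)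
  rw [Finset.sum_filter]
  refine Finset.sum_congr rfl fun k _ => ?_
  change weight2 ψ l k _ * v.ρ k = _
  unfold weight2
  split_ifs <;> simp

theorem secondStage_isRun {s : ℕ → State K J L M} :
    (secondStage ψ).IsRun S s ↔ IsRun2 S ψ s := by
  simp only [Scheme.IsRun, IsRun2, secondStage_feas]

end SecondStage

end

end NAFD

/-! ### Assembly of both stages -/

theorem proposition1 {K J L Z M : ℕ} (S : NAFD.System K J L Z M) :
    -- first stage: the iteration never breaks down
    (∀ s₀ : NAFD.State K J L M, NAFD.IsInit s₀ →
      (∃ v ρhat, NAFD.Feasible1 S s₀ v ρhat) → ∃ s, NAFD.IsRun1 S s ∧ s 0 = s₀) ∧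
    -- first stage: convergence to stationary points of the relaxed problem
    (∀ s : ℕ → NAFD.State K J L M, NAFD.IsRun1 S s →
      NAFD.Converges S s ∧
      ∀ x u, NAFD.IsLimitPoint s x u →
        NAFD.IsFeasible S (NAFD.weight1 S) NAFD.noneOff u x ∧
        ((∀ l k, 0 < NAFD.trT (x.1 k) l) →
          NAFD.IsRegular S (NAFD.weight1 S) NAFD.noneOff u x →
          NAFD.IsStationary S (NAFD.weight1 S) NAFD.noneOff u x) ∧
        (NAFD.IsRegular S (NAFD.weight1 S) (NAFD.offAt x) u x →
          NAFD.IsStationary S (NAFD.weight1 S) (NAFD.offAt x) u x)) ∧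
    -- second stage, for the association obtained by thresholding any covariances
    (∀ (ξ : ℝ) (Qbar : Fin K → NAFD.Mat L M),
      (∀ s₀ : NAFD.State K J L M, NAFD.IsInit s₀ →
        (∃ v, NAFD.Feasible2 S (NAFD.assoc S ξ Qbar) s₀ v) →
        ∃ s, NAFD.IsRun2 S (NAFD.assoc S ξ Qbar) s ∧ s 0 = s₀) ∧
      (∀ s : ℕ → NAFD.State K J L M, NAFD.IsRun2 S (NAFD.assoc S ξ Qbar) s →
        NAFD.Converges S s ∧
        ∀ x u, NAFD.IsLimitPoint s x u →
          NAFD.IsFeasible S (NAFD.weight2 (NAFD.assoc S ξ Qbar))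
            (NAFD.notAssoc (NAFD.assoc S ξ Qbar)) u x ∧
          (NAFD.IsRegular S (NAFD.weight2 (NAFD.assoc S ξ Qbar))
              (NAFD.notAssoc (NAFD.assoc S ξ Qbar)) u x →
            NAFD.IsStationary S (NAFD.weight2 (NAFD.assoc S ξ Qbar))
              (NAFD.notAssoc (NAFD.assoc S ξ Qbar)) u x))) := by
  refine ⟨fun s₀ h₀ ⟨v, ρhat, hv⟩ => ?_, fun s hs => ?_, fun ξ Qbar => ⟨fun s₀ h₀ ⟨v, hv⟩ => ?_,
    fun s hs => ?_⟩⟩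
  · obtain ⟨s, hs, h0⟩ := NAFD.Scheme.exists_run h₀ ⟨v, NAFD.Feasible1.feas h₀ hv⟩
    exact ⟨s, hs.isRun1, h0⟩
  · have hr := hs.isRun
    refine ⟨hr.converges, fun x u hl => ?_⟩
    obtain ⟨hfeas, hstat⟩ := hr.isStationary hl
    -- Dropping the switch-off constraints only enlarges the convex set, so feasibility carries
    -- over. Stationarity does not carry over in this way; below it uses that no trace vanishes.
    have hf : NAFD.IsFeasible S (NAFD.weight1 S) NAFD.noneOff u x :=
      ⟨⟨hfeas.1.1, hfeas.1.2.1, hfeas.1.2.2.1, hfeas.1.2.2.2.1, hfeas.1.2.2.2.2.1,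
        fun _ _ h => h.elim⟩, hfeas.2⟩
    refine ⟨hf, fun hpos hreg => ?_, hstat⟩
    have e : (NAFD.firstStage S).offOf x = NAFD.noneOff := by
      funext l k
      exact propext ⟨fun h => (hpos l k).ne' h, fun h => h.elim⟩
    rw [e] at hstat
    exact hstat hreg
  · obtain ⟨s, hs, h0⟩ := NAFD.Scheme.exists_run h₀ ⟨v, NAFD.secondStage_feas.2 hv⟩
    exact ⟨s, NAFD.secondStage_isRun.1 hs, h0⟩
  · have hr := NAFD.secondStage_isRun.2 hs
    exact ⟨hr.converges, fun x u hl => hr.isStationary hl⟩
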